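/- Let $k$ be a field. For a quiver $Q$ (vertices and arrows may be infinite in number), let $kQ$ be its path coalgebra: the vector space with basis the paths of $Q$, with $$\Delta(a_n\cdots a_1)=t(a_n)\otimes a_n\cdots a_1+\sum_{i=1}^{n-1}a_n\cdots a_{i+1}\otimes a_i\cdots a_1+a_n\cdots a_1\otimes s(a_1),\qquad \varepsilon(a_n\cdots a_1)=0\quad(n\ge 1),$$ and $\Delta(g)=g\otimes g$, $\varepsilon(g)=1$ for each vertex $g$. Let $kQ_n$ be the span of the paths of length $n$. A graded bialgebra structure on $kQ$ is a unital associative multiplication on $kQ$ with $1\in kQ_0$ and $kQ_m\cdot kQ_n\subseteq kQ_{m+n}$ which makes the path coalgebra $kQ$ a bialgebra. Let $B$ be a pointed bialgebra over $k$ (every simple subcoalgebra is one-dimensional), let $B_0\subseteq B_1\subseteq\cdots$ be its coradical filtration ($B_0$ is the sum of the simple subcoalgebras and $B_{n+1}=\Delta^{-1}(B_0\otimes B+B\otimes B_n)$), and let $\operatorname{gr}B=B_0\oplus B_1/B_0\oplus B_2/B_1\oplus\cdots$ be the associated graded bialgebra. **Proposition 3.3.** There exist a quiver $Q$, a graded bialgebra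 structure on $kQ$ and an injective bialgebra map $\Theta:\operatorname{gr}B\to kQ$ with $kQ_0\oplus kQ_1\subseteq\Theta(\operatorname{gr}B)$; moreover $\Theta$ can be chosen to preserve degrees. The quiver and the structure are unique in the following sense. Let $Q'$ be a quiver with a graded bialgebra structure on $kQ'$, and let $\Theta':\operatorname{gr}B\to kQ'$ be any injective bialgebra map with $kQ'_0\oplus kQ'_1\subseteq\Theta'(\operatorname{gr}B)$. Then the quivers $Q$ and $Q'$ are isomorphic, and $kQ$ and $kQ'$ are isomorphic as graded bialgebras. If moreover $\Theta'$ preserves degrees, there is exactly one isomorphism of graded bialgebras $F:kQ\to kQ'$ with $F\circ\Theta=\Theta'$. -/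

import Mathlib

open scoped TensorProduct

universe u v w₁ w₂

noncomputable section

/-! ### Subcoalgebras, the coradical and pointedness -/

section Coradical

variable (k : Type u) {C : Type v} [Field k] [AddCommGroup C] [Module k C] [Coalgebra k C]

/-- `U ⊗ V` regarded as a subspace of `C ⊗ C`. -/
abbrev tensorSub (U V : Submodule k C) : Submodule k (C ⊗[k] C) :=
  Submodule.map₂ (TensorProduct.mk k C C) U V

/-- A subspace `D` is a subcoalgebra if `Δ(D) ⊆ D ⊗ D`. -/
def IsSubcoalgebra (D : Submodule k C) : Prop :=
  ∀ x ∈ D, Coalgebra.comul (R := k) x ∈ tensorSub k D D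

/-- A subcoalgebra is simple if it is nonzero and has no nonzero proper subcoalgebra. -/
structure IsSimpleSubcoalgebra (D : Submodule k C) : Prop where
  isSubcoalgebra : IsSubcoalgebra k D
  ne_bot : D ≠ ⊥
  eq_of_le : ∀ E : Submodule k C, IsSubcoalgebra k E → E ≤ D → E ≠ ⊥ → E = D

variable (C)

/-- A coalgebra is pointed if all its simple subcoalgebras are one-dimensional. -/
def IsPointedCoalgebra : Prop :=
  ∀ D : Submodule k C, IsSimpleSubcoalgebra k D → Module.finrank k D = 1

/-- The coradical: the sum of all simple subcoalgebras. -/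
def coradical : Submodule k C :=
  sSup {D : Submodule k C | IsSimpleSubcoalgebra k D}

/-- The coradical filtration: `C₀` is the coradical and
`Cₙ₊₁ = Δ⁻¹(C₀ ⊗ C + C ⊗ Cₙ)`. -/
def coradicalFiltration : ℕ → Submodule k C
  | 0 => coradical k C
  | n + 1 => (tensorSub k (coradical k C) ⊤ ⊔ tensorSub k ⊤ (coradicalFiltration n)).comap
      (Coalgebra.comul (R := k) (A := C))

end Coradical

/-! ### The coradical filtration is a coalgebra filtration -/

section CoradicalLemmas

variable {k : Type u} {C : Type v} [Field k] [AddCommGroup C] [Module k C]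

lemma exists_linearMap_ker_eq (U : Submodule k C) :
    ∃ c : C →ₗ[k] C, (∀ x, c x = 0 ↔ x ∈ U) ∧ ∀ x, x - c x ∈ U := by
  obtain ⟨p, hp⟩ := LinearMap.exists_extend (LinearMap.id : U →ₗ[k] U)
  have hp' : ∀ x (hx : x ∈ U), p x = ⟨x, hx⟩ := fun x hx => LinearMap.congr_fun hp ⟨x, hx⟩
  refine ⟨LinearMap.id - U.subtype ∘ₗ p, fun x => ⟨fun h => ?_, fun h => ?_⟩, fun x => ?_⟩
  · have : x = (p x : C) := by simpa [sub_eq_zero] using h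
    rw [this]; exact (p x).2
  · simp [hp' x h]
  · simp

lemma exists_linearMap_comp_eq {D E : Type*} [AddCommGroup D] [Module k D] [AddCommGroup E]
    [Module k E] (f : C →ₗ[k] D) (g : C →ₗ[k] E) (h : ∀ x, f x = 0 → g x = 0) :
    ∃ l : D →ₗ[k] E, ∀ x, l (f x) = g x := by
  obtain ⟨l, hl⟩ := LinearMap.exists_extend
    (((LinearMap.ker f).liftQ g (fun x hx => by simpa using h x (by simpa using hx))) ∘ₗ
      f.quotKerEquivRange.symm.toLinearMap)
  refine ⟨l, fun x => ?_⟩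
  have := LinearMap.congr_fun hl ⟨f x, x, rfl⟩
  simp only [LinearMap.comp_apply, Submodule.subtype_apply] at this
  rw [this]
  have h2 : f.quotKerEquivRange.symm ⟨f x, x, rfl⟩ = (LinearMap.ker f).mkQ x := by
    rw [LinearEquiv.symm_apply_eq]; rfl
  simp [h2]

lemma map_eq_zero_of_mem {D E : Type*} [AddCommGroup D] [Module k D] [AddCommGroup E]
    [Module k E] {U V : Submodule k C} {f : C →ₗ[k] D} {g : C →ₗ[k] E}
    (hf : ∀ x ∈ U, f x = 0) (hg : ∀ x ∈ V, g x = 0) {z : C ⊗[k] C}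
    (hz : z ∈ tensorSub k U ⊤ ⊔ tensorSub k ⊤ V) : TensorProduct.map f g z = 0 := by
  have : tensorSub k U ⊤ ⊔ tensorSub k ⊤ V ≤ LinearMap.ker (TensorProduct.map f g) := by
    refine sup_le (Submodule.map₂_le.2 fun x hx y _ => ?_) (Submodule.map₂_le.2 fun x _ y hy => ?_)
    · simp [hf x hx]
    · simp [hg y hy]
  exact this hz

lemma mem_of_map_eq_zero {U V : Submodule k C} {f g : C →ₗ[k] C}
    (hf : ∀ x, x - f x ∈ U) (hg : ∀ x, x - g x ∈ V) {z : C ⊗[k] C}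
    (hz : TensorProduct.map f g z = 0) : z ∈ tensorSub k U ⊤ ⊔ tensorSub k ⊤ V := by
  have key : ∀ z : C ⊗[k] C, z - TensorProduct.map f g z ∈
      tensorSub k U ⊤ ⊔ tensorSub k ⊤ V := by
    intro z
    induction z with
    | zero => simp
    | add a b ha hb =>
      rw [map_add, add_sub_add_comm]; exact add_mem ha hb
    | tmul x y =>
      have : x ⊗ₜ[k] y - TensorProduct.map f g (x ⊗ₜ y) = (x - f x) ⊗ₜ y + f x ⊗ₜ (y - g y) := by
        simp [TensorProduct.sub_tmul, TensorProduct.tmul_sub]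
      rw [this]
      exact add_mem (Submodule.mem_sup_left (Submodule.apply_mem_map₂ _ (hf x) trivial))
        (Submodule.mem_sup_right (Submodule.apply_mem_map₂ _ trivial (hg y)))
  simpa [hz] using key z

lemma mem_iSup_tensorSub_of_forall {F : ℕ → Submodule k C} (hF : Monotone F) (h0 : F 0 = ⊥)
    (n : ℕ) (z : C ⊗[k] C)
    (hz : ∀ a b, a + b = n + 1 → z ∈ tensorSub k (F a) ⊤ ⊔ tensorSub k ⊤ (F b)) :
    z ∈ ⨆ p ∈ Finset.HasAntidiagonal.antidiagonal n, tensorSub k (F (p.1 + 1)) (F (p.2 + 1)) := by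
  choose c hc hc' using fun n => exists_linearMap_ker_eq (F n)
  have hid : c 0 = LinearMap.id := by
    ext x
    have := hc' 0 x
    simp only [h0, Submodule.mem_bot, sub_eq_zero] at this
    simpa using this.symm
  let q : ℕ → C →ₗ[k] C := fun i => if i ≤ n then c i - c (i + 1) else c (n + 1)
  have hq0 : ∀ i ≤ n + 1, ∀ x ∈ F i, q i x = 0 := by
    intro i hi x hx
    by_cases h : i ≤ n
    · simp [q, h, (hc i x).2 hx, (hc (i + 1) x).2 (hF (Nat.le_succ i) hx)]
    · obtain rfl : i = n + 1 := by omega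
      simp [q, (hc (n + 1) x).2 hx]
  have hq1 : ∀ i ≤ n, ∀ x, q i x ∈ F (i + 1) := by
    intro i hi x
    have : q i x = (x - c (i + 1) x) - (x - c i x) := by simp [q, hi]
    rw [this]
    exact sub_mem (hc' _ _) (hF (Nat.le_succ i) (hc' _ _))
  have hsum : ∀ m ≤ n + 1, ∑ i ∈ Finset.range m, q i = LinearMap.id - c m := by
    intro m hm
    induction m with
    | zero => simp [hid]
    | succ m ih =>
      rw [Finset.sum_range_succ, ih (by omega)]
      simp [q, show m ≤ n by omega]
  have hsum' : ∑ i ∈ Finset.range (n + 2), q i = LinearMap.id := by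
    rw [Finset.sum_range_succ, hsum (n + 1) le_rfl]
    simp [q]
  have hzs : z = ∑ i ∈ Finset.range (n + 2), ∑ j ∈ Finset.range (n + 2),
      TensorProduct.map (q i) (q j) z := by
    have h1 : TensorProduct.map (∑ i ∈ Finset.range (n + 2), q i)
        (∑ i ∈ Finset.range (n + 2), q i) z = z := by
      rw [hsum', TensorProduct.map_id]; rfl
    conv_lhs => rw [← h1]
    simp only [← TensorProduct.mapBilinear_apply, map_sum, LinearMap.sum_apply]
    exact Finset.sum_comm
  rw [hzs]
  refine sum_mem fun i hi => sum_mem fun j hj => ?_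
  rw [Finset.mem_range] at hi hj
  by_cases hij : i + j ≤ n
  · have hle : tensorSub k (F (i + 1)) (F (j + 1)) ≤
        ⨆ p ∈ Finset.HasAntidiagonal.antidiagonal n, tensorSub k (F (p.1 + 1)) (F (p.2 + 1)) := by
      refine le_trans ?_ (le_iSup₂_of_le (i, n - i) (by simp; omega) le_rfl)
      exact Submodule.map₂_le_map₂ le_rfl (hF (by simp; omega))
    refine hle ?_
    clear hzs hz
    induction z with
    | zero => simp
    | add a b ha hb => rw [map_add]; exact add_mem ha hb
    | tmul x y =>
      exact Submodule.apply_mem_map₂ _ (hq1 i (by omega) x) (hq1 j (by omega) y)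
  · have : TensorProduct.map (q i) (q j) z = 0 :=
      map_eq_zero_of_mem (fun x hx => hq0 i (by omega) x (hF (by omega) hx))
        (fun x hx => hq0 j (by omega) x hx) (hz (n + 1 - j) j (by omega))
    rw [this]; exact zero_mem _

variable [Coalgebra k C]

open Coalgebra in
lemma map_map_comul {D E F : Type*} [AddCommGroup D] [Module k D] [AddCommGroup E] [Module k E]
    [AddCommGroup F] [Module k F] (f : C →ₗ[k] D) (g : C →ₗ[k] E) (h : C →ₗ[k] F) (x : C) :
    TensorProduct.map f (TensorProduct.map g h ∘ₗ comul) (comul (R := k) x) =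
      TensorProduct.assoc k D E F
        (TensorProduct.map (TensorProduct.map f g ∘ₗ comul) h (comul (R := k) x)) := by
  have h1 : TensorProduct.map f (TensorProduct.map g h ∘ₗ comul (R := k) (A := C)) =
      TensorProduct.map f (TensorProduct.map g h) ∘ₗ comul.lTensor C := by
    rw [LinearMap.lTensor, ← TensorProduct.map_comp, LinearMap.comp_id]
  have h2 : TensorProduct.map (TensorProduct.map f g ∘ₗ comul (R := k) (A := C)) h =
      TensorProduct.map (TensorProduct.map f g) h ∘ₗ comul.rTensor C := by
    rw [LinearMap.rTensor, ← TensorProduct.map_comp, LinearMap.comp_id]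
  rw [h1, h2, LinearMap.comp_apply, LinearMap.comp_apply, ← coassoc_apply,
    TensorProduct.map_map_assoc]

open Coalgebra in
lemma isSubcoalgebra_coradical : IsSubcoalgebra k (coradical k C) := by
  intro x hx
  have : coradical k C ≤ (tensorSub k (coradical k C) (coradical k C)).comap
      (comul (R := k) (A := C)) := by
    refine sSup_le fun D hD x hx => ?_
    exact Submodule.map₂_le_map₂ (le_sSup hD) (le_sSup hD) (hD.isSubcoalgebra x hx)
  exact this hx

/-- The coradical filtration shifted by one, starting with the zero subspace. -/
def coradicalShift (k : Type u) (C : Type v) [Field k] [AddCommGroup C] [Module k C]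
    [Coalgebra k C] : ℕ → Submodule k C
  | 0 => ⊥
  | n + 1 => coradicalFiltration k C n

open Coalgebra in
lemma mem_coradicalShift_succ (n : ℕ) (x : C) :
    x ∈ coradicalShift k C (n + 1) ↔ comul (R := k) x ∈
      tensorSub k (coradicalShift k C 1) ⊤ ⊔ tensorSub k ⊤ (coradicalShift k C n) := by
  cases n with
  | succ n => rfl
  | zero =>
    obtain ⟨c, hc, hc'⟩ := exists_linearMap_ker_eq (coradicalShift k C 1)
    constructor
    · intro hx
      exact Submodule.mem_sup_left (Submodule.map₂_le_map₂_right le_top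
        (isSubcoalgebra_coradical x hx))
    · intro hx
      have h := map_eq_zero_of_mem (f := c) (g := counit (R := k)) (fun x hx => (hc x).2 hx)
        (V := coradicalShift k C 0) (fun x hx => by
          have : x = 0 := by simpa [coradicalShift] using hx
          simp [this]) hx
      have h2 : TensorProduct.map c (counit (R := k) (A := C)) (comul (R := k) x) = c x ⊗ₜ 1 := by
        rw [← LinearMap.rTensor_comp_lTensor, LinearMap.comp_apply, lTensor_counit_comul]; simp
      rw [h2] at h
      rw [← hc]
      simpa using congrArg (TensorProduct.rid k C) h

lemma coradicalFiltration_mono : Monotone (coradicalFiltration k C) := by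
  refine monotone_nat_of_le_succ fun n => ?_
  induction n with
  | zero =>
    intro x hx
    exact Submodule.mem_sup_left (Submodule.map₂_le_map₂_right le_top
      (isSubcoalgebra_coradical x hx))
  | succ n ih =>
    intro x hx
    have h : tensorSub k (coradical k C) ⊤ ⊔ tensorSub k ⊤ (coradicalFiltration k C n) ≤
        tensorSub k (coradical k C) ⊤ ⊔ tensorSub k ⊤ (coradicalFiltration k C (n + 1)) :=
      sup_le_sup_left (Submodule.map₂_le_map₂_right ih) _
    exact h hx

lemma coradicalShift_mono : Monotone (coradicalShift k C) := by
  refine monotone_nat_of_le_succ fun n => ?_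
  cases n with
  | zero => exact bot_le
  | succ n => exact coradicalFiltration_mono (Nat.le_succ n)

open Coalgebra in
lemma comul_mem_of_mem_coradicalShift (a b : ℕ) (x : C) (hx : x ∈ coradicalShift k C (a + b)) :
    comul (R := k) x ∈
      tensorSub k (coradicalShift k C a) ⊤ ⊔ tensorSub k ⊤ (coradicalShift k C b) := by
  choose c hc hc' using fun n => exists_linearMap_ker_eq (coradicalShift k C n)
  have hstep : ∀ n x, TensorProduct.map (c 1) (c n) (comul (R := k) x) = 0 ↔ c (n + 1) x = 0 := by
    intro n x
    rw [hc, mem_coradicalShift_succ]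
    exact ⟨mem_of_map_eq_zero (hc' 1) (hc' n),
      map_eq_zero_of_mem (fun x hx => (hc 1 x).2 hx) (fun x hx => (hc n x).2 hx)⟩
  suffices h : ∀ a b x, x ∈ coradicalShift k C (a + b) →
      TensorProduct.map (c a) (c b) (comul (R := k) x) = 0 from
    mem_of_map_eq_zero (hc' a) (hc' b) (h a b x hx)
  clear hx x a b
  intro a
  induction a with
  | zero =>
    have hid : c 0 = LinearMap.id := by
      ext x
      have := hc' 0 x
      simp only [coradicalShift, Submodule.mem_bot, sub_eq_zero] at this
      simpa using this.symm
    intro b x hx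
    rw [zero_add] at hx
    rw [hid]
    cases b with
    | zero =>
      have : x = 0 := by simpa [coradicalShift] using hx
      simp [this]
    | succ b =>
      obtain ⟨l, hl⟩ := exists_linearMap_comp_eq (TensorProduct.map (c 1) (c b) ∘ₗ comul)
        (c (b + 1)) (fun x hx => (hstep b x).1 hx)
      have hl' : c (b + 1) = l ∘ₗ (TensorProduct.map (c 1) (c b) ∘ₗ comul) := by
        ext x; exact (hl x).symm
      have hcomp : TensorProduct.map (LinearMap.id : C →ₗ[k] C) (c (b + 1)) =
          TensorProduct.map LinearMap.id l ∘ₗ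
            TensorProduct.map LinearMap.id (TensorProduct.map (c 1) (c b) ∘ₗ comul) := by
        rw [← TensorProduct.map_comp, hl', LinearMap.comp_id]
      rw [hcomp, LinearMap.comp_apply, map_map_comul]
      have : TensorProduct.map (TensorProduct.map LinearMap.id (c 1) ∘ₗ comul) (c b)
          (comul (R := k) x) = 0 := by
        refine map_eq_zero_of_mem (fun y hy => ?_) (fun y hy => (hc b y).2 hy)
          ((mem_coradicalShift_succ b x).1 hx)
        exact map_eq_zero_of_mem (U := ⊥) (V := coradicalShift k C 1)
          (fun y hy => by simpa using hy) (fun y hy => (hc 1 y).2 hy)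
          (Submodule.mem_sup_right (Submodule.map₂_le_map₂_left le_top
            (isSubcoalgebra_coradical y hy)))
      rw [this, map_zero, map_zero]
  | succ a ih =>
    intro b x hx
    obtain ⟨l, hl⟩ := exists_linearMap_comp_eq (TensorProduct.map (c 1) (c a) ∘ₗ comul)
      (c (a + 1)) (fun x hx => (hstep a x).1 hx)
    have hl' : c (a + 1) = l ∘ₗ (TensorProduct.map (c 1) (c a) ∘ₗ comul) := by
      ext x; exact (hl x).symm
    have hcomp : TensorProduct.map (c (a + 1)) (c b) =
        TensorProduct.map l LinearMap.id ∘ₗ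
          TensorProduct.map (TensorProduct.map (c 1) (c a) ∘ₗ comul) (c b) := by
      rw [← TensorProduct.map_comp, hl', LinearMap.id_comp]
    have hx' : x ∈ coradicalShift k C ((a + b) + 1) := by
      rwa [show a + b + 1 = a + 1 + b by omega]
    have h0 : TensorProduct.map (TensorProduct.map (c 1) (c a) ∘ₗ comul) (c b)
        (comul (R := k) x) = 0 := by
      apply (TensorProduct.assoc k C C C).injective
      rw [← map_map_comul, map_zero]
      exact map_eq_zero_of_mem (fun y hy => (hc 1 y).2 hy) (fun y hy => ih b y hy)
        ((mem_coradicalShift_succ (a + b) x).1 hx')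
    rw [hcomp, LinearMap.comp_apply, h0, map_zero]

open Coalgebra in
lemma comul_mem_coradicalFiltration (n : ℕ) (x : C) (hx : x ∈ coradicalFiltration k C n) :
    comul (R := k) x ∈ ⨆ p ∈ Finset.HasAntidiagonal.antidiagonal n,
      tensorSub k (coradicalFiltration k C p.1) (coradicalFiltration k C p.2) :=
  mem_iSup_tensorSub_of_forall (F := coradicalShift k C) coradicalShift_mono rfl n _
    fun a b hab => comul_mem_of_mem_coradicalShift a b x (by rw [hab]; exact hx)

open Coalgebra in
lemma isSimpleSubcoalgebra_span_of_isGroupLikeElem {g : C} (hg : IsGroupLikeElem k g) :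
    IsSimpleSubcoalgebra k (Submodule.span k {g}) where
  isSubcoalgebra := by
    intro x hx
    obtain ⟨c, rfl⟩ := Submodule.mem_span_singleton.1 hx
    rw [map_smul, hg.comul_eq_tmul_self]
    exact Submodule.smul_mem _ _ (Submodule.apply_mem_map₂ _
      (Submodule.mem_span_singleton_self g) (Submodule.mem_span_singleton_self g))
  ne_bot := by simpa using hg.ne_zero
  eq_of_le := by
    intro E _ hle hne
    obtain ⟨x, hx, hx0⟩ := Submodule.exists_mem_ne_zero_of_ne_bot hne
    obtain ⟨c, rfl⟩ := Submodule.mem_span_singleton.1 (hle hx)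
    have hc : c ≠ 0 := by rintro rfl; simp at hx0
    refine le_antisymm hle ((Submodule.span_singleton_le_iff_mem _ _).2 ?_)
    simpa [smul_smul, inv_mul_cancel₀ hc] using E.smul_mem c⁻¹ hx

open Coalgebra in
/-- In a pointed coalgebra every simple subcoalgebra is spanned by a group-like element. -/
lemma exists_isGroupLikeElem_of_isPointed (hC : IsPointedCoalgebra k C) {D : Submodule k C}
    (hD : IsSimpleSubcoalgebra k D) :
    ∃ g, IsGroupLikeElem k g ∧ D = Submodule.span k {g} := by
  obtain ⟨⟨d, hdD⟩, hd0, hd⟩ := finrank_eq_one_iff'.1 (hC D hD)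
  have hDd : D = Submodule.span k {d} := by
    refine le_antisymm (fun x hx => ?_) ((Submodule.span_singleton_le_iff_mem _ _).2 hdD)
    obtain ⟨c, hc⟩ := hd ⟨x, hx⟩
    exact Submodule.mem_span_singleton.2 ⟨c, congrArg Subtype.val hc⟩
  have hd0' : d ≠ 0 := fun h => hd0 (by simpa using h)
  have hcom := hD.isSubcoalgebra d hdD
  rw [hDd, tensorSub, Submodule.map₂_span_span] at hcom
  simp only [Set.image2_singleton, TensorProduct.mk_apply] at hcom
  obtain ⟨c, hc⟩ := Submodule.mem_span_singleton.1 hcom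
  have h1 : (c * counit (R := k) d) • d = d := by
    have := congrArg (fun z => TensorProduct.lid k C ((counit (R := k) (A := C)).rTensor C z)) hc
    simpa [smul_smul] using this
  have h2 : c * counit (R := k) d = 1 := by
    have : (c * counit (R := k) d - 1) • d = 0 := by rw [sub_smul, h1]; simp
    rcases smul_eq_zero.1 this with h | h
    · exact sub_eq_zero.1 h
    · exact absurd h hd0'
  have hc0 : c ≠ 0 := left_ne_zero_of_mul_eq_one h2
  refine ⟨c • d, ⟨by simpa using h2, ?_⟩, ?_⟩
  · rw [map_smul, ← hc, TensorProduct.smul_tmul_smul, smul_smul]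
  · rw [hDd, Submodule.span_singleton_smul_eq hc0.isUnit]

end CoradicalLemmas

/-! ### Associated graded bialgebras -/

/-- A filtration of a bialgebra by subspaces `F₀ ⊆ F₁ ⊆ ⋯` compatible with the bialgebra structure:
`1 ∈ F₀`, `FₘFₙ ⊆ Fₘ₊ₙ` and `Δ(Fₙ) ⊆ ∑_{i+j=n} Fᵢ ⊗ Fⱼ`. -/
structure BialgebraFiltration (k : Type u) (B : Type v) [Field k] [Ring B] [Bialgebra k B] where
  /-- the pieces of the filtration -/
  F : ℕ → Submodule k B
  mono : Monotone F
  one_mem : (1 : B) ∈ F 0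
  mul_mem : ∀ {m n : ℕ} {x y : B}, x ∈ F m → y ∈ F n → x * y ∈ F (m + n)
  comul_mem : ∀ {n : ℕ} {x : B}, x ∈ F n → Coalgebra.comul (R := k) x ∈
    ⨆ p ∈ Finset.HasAntidiagonal.antidiagonal n, tensorSub k (F p.1) (F p.2)

namespace BialgebraFiltration

open Coalgebra

variable {k : Type u} {B : Type v} [Field k] [Ring B] [Bialgebra k B]
  (𝓕 : BialgebraFiltration k B)

/-- The preceding piece of the filtration: `F₋₁ = 0` and `prev (n + 1) = Fₙ`. -/
def prev : ℕ → Submodule k B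
  | 0 => ⊥
  | n + 1 => 𝓕.F n

lemma le_prev {m n : ℕ} (h : m < n) : 𝓕.F m ≤ 𝓕.prev n := by
  cases n with
  | zero => omega
  | succ n => exact 𝓕.mono (by omega)

/-- The `n`-th graded piece `Fₙ / Fₙ₋₁`. -/
def Piece (n : ℕ) : Type v := 𝓕.F n ⧸ (𝓕.prev n).submoduleOf (𝓕.F n)

instance (n : ℕ) : AddCommGroup (𝓕.Piece n) :=
  inferInstanceAs (AddCommGroup (𝓕.F n ⧸ (𝓕.prev n).submoduleOf (𝓕.F n)))

instance (n : ℕ) : Module k (𝓕.Piece n) :=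
  inferInstanceAs (Module k (𝓕.F n ⧸ (𝓕.prev n).submoduleOf (𝓕.F n)))

/-- The projection `Fₙ → Fₙ / Fₙ₋₁` onto the `n`-th graded piece. -/
def toPiece (n : ℕ) : 𝓕.F n →ₗ[k] 𝓕.Piece n := ((𝓕.prev n).submoduleOf (𝓕.F n)).mkQ

lemma toPiece_surjective (n : ℕ) : Function.Surjective (𝓕.toPiece n) :=
  Submodule.mkQ_surjective _

/-- The linear map `Fₙ / Fₙ₋₁ → M` induced by a linear map `Fₙ → M` that kills `Fₙ₋₁`. -/
def liftPiece {M : Type*} [AddCommGroup M] [Module k M] (n : ℕ) (f : 𝓕.F n →ₗ[k] M)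
    (hf : ∀ x : 𝓕.F n, (x : B) ∈ 𝓕.prev n → f x = 0) : 𝓕.Piece n →ₗ[k] M :=
  ((𝓕.prev n).submoduleOf (𝓕.F n)).liftQ f (fun x hx => hf x hx)

lemma liftPiece_toPiece {M : Type*} [AddCommGroup M] [Module k M] (n : ℕ) (f : 𝓕.F n →ₗ[k] M)
    (hf : ∀ x : 𝓕.F n, (x : B) ∈ 𝓕.prev n → f x = 0) (x : 𝓕.F n) :
    𝓕.liftPiece n f hf (𝓕.toPiece n x) = f x := rfl

/-- The associated graded space `gr B = F₀ ⊕ F₁/F₀ ⊕ F₂/F₁ ⊕ ⋯`. -/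
def Gr : Type v := DirectSum ℕ 𝓕.Piece

instance : AddCommGroup 𝓕.Gr := inferInstanceAs (AddCommGroup (DirectSum ℕ 𝓕.Piece))

instance : Module k 𝓕.Gr := inferInstanceAs (Module k (DirectSum ℕ 𝓕.Piece))

/-- The inclusion of the `n`-th graded piece. -/
def ofPiece (n : ℕ) : 𝓕.Piece n →ₗ[k] 𝓕.Gr := DirectSum.lof k ℕ 𝓕.Piece n

/-- The homogeneous component of degree `n` of `gr B`. -/
def degree (n : ℕ) : Submodule k 𝓕.Gr := LinearMap.range (𝓕.ofPiece n)

/-- The projection `Fₙ → Fₙ / Fₙ₋₁ ⊆ gr B`. -/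
def symbol (n : ℕ) : 𝓕.F n →ₗ[k] 𝓕.Gr :=
  𝓕.ofPiece n ∘ₗ 𝓕.toPiece n

/-- A linear map out of `gr B` given on the homogeneous components. -/
def lift {M : Type*} [AddCommGroup M] [Module k M] (f : ∀ n, 𝓕.Piece n →ₗ[k] M) :
    𝓕.Gr →ₗ[k] M :=
  DirectSum.toModule k ℕ M f

lemma lift_symbol {M : Type*} [AddCommGroup M] [Module k M] (f : ∀ n, 𝓕.Piece n →ₗ[k] M)
    (n : ℕ) (x : 𝓕.F n) : 𝓕.lift f (𝓕.symbol n x) = f n (𝓕.toPiece n x) :=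
  DirectSum.toModule_lof (ι := ℕ) k n _

lemma symbol_congr {m n : ℕ} (h : m = n) {x : 𝓕.F m} {y : 𝓕.F n} (hxy : (x : B) = y) :
    𝓕.symbol m x = 𝓕.symbol n y := by
  subst h
  rw [Subtype.ext hxy]

lemma symbol_eq_zero {n : ℕ} {x : 𝓕.F n} (h : (x : B) ∈ 𝓕.prev n) : 𝓕.symbol n x = 0 := by
  have : 𝓕.toPiece n x = 0 := (Submodule.Quotient.mk_eq_zero _).2 h
  rw [symbol, LinearMap.comp_apply, this, map_zero]

@[elab_as_elim]
lemma gr_induction {p : 𝓕.Gr → Prop} (x : 𝓕.Gr) (h0 : p 0)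
    (hs : ∀ n (x : 𝓕.F n), p (𝓕.symbol n x)) (ha : ∀ x y, p x → p y → p (x + y)) : p x := by
  refine DirectSum.induction_on x h0 (fun n y => ?_) ha
  obtain ⟨y, rfl⟩ := 𝓕.toPiece_surjective n y
  exact hs n y

/-- A linear map `B → gr B` extending the projection `Fₙ → Fₙ / Fₙ₋₁`. It is an auxiliary choice:
the structure of `gr B` does not depend on it, as `tensorSymbol_tmul` shows. -/
def ext (n : ℕ) : B →ₗ[k] 𝓕.Gr := (LinearMap.exists_extend (𝓕.symbol n)).choose

lemma ext_apply {n : ℕ} {x : B} (hx : x ∈ 𝓕.F n) : 𝓕.ext n x = 𝓕.symbol n ⟨x, hx⟩ :=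
  LinearMap.congr_fun (LinearMap.exists_extend (𝓕.symbol n)).choose_spec ⟨x, hx⟩

lemma ext_eq_zero {m n : ℕ} (h : m < n) {x : B} (hx : x ∈ 𝓕.F m) : 𝓕.ext n x = 0 := by
  rw [𝓕.ext_apply (𝓕.mono h.le hx)]
  exact 𝓕.symbol_eq_zero (𝓕.le_prev h hx)

/-- `∑_{i+j=n} Fᵢ ⊗ Fⱼ` inside `B ⊗ B`. -/
def tensorF (n : ℕ) : Submodule k (B ⊗[k] B) :=
  ⨆ p ∈ Finset.HasAntidiagonal.antidiagonal n, tensorSub k (𝓕.F p.1) (𝓕.F p.2)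

lemma tensorF_le {n : ℕ} {S : Submodule k (B ⊗[k] B)}
    (h : ∀ i j, i + j = n → ∀ a ∈ 𝓕.F i, ∀ b ∈ 𝓕.F j, a ⊗ₜ[k] b ∈ S) : 𝓕.tensorF n ≤ S :=
  iSup₂_le fun p hp => Submodule.map₂_le.2 fun a ha b hb =>
    h p.1 p.2 (Finset.HasAntidiagonal.mem_antidiagonal.1 hp) a ha b hb

lemma eq_on_tensorF {n : ℕ} {M : Type*} [AddCommGroup M] [Module k M] (f g : B ⊗[k] B →ₗ[k] M)
    (h : ∀ i j, i + j = n → ∀ a ∈ 𝓕.F i, ∀ b ∈ 𝓕.F j, f (a ⊗ₜ[k] b) = g (a ⊗ₜ[k] b))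
    {z : B ⊗[k] B} (hz : z ∈ 𝓕.tensorF n) : f z = g z :=
  𝓕.tensorF_le (S := LinearMap.eqLocus f g) h hz

/-- The map `B ⊗ B → gr B ⊗ gr B` which on `∑_{i+j=n} Fᵢ ⊗ Fⱼ` is the sum of the projections
`Fᵢ ⊗ Fⱼ → Fᵢ/Fᵢ₋₁ ⊗ Fⱼ/Fⱼ₋₁` (see `tensorSymbol_tmul`). -/
def tensorSymbol (n : ℕ) : B ⊗[k] B →ₗ[k] 𝓕.Gr ⊗[k] 𝓕.Gr :=
  ∑ p ∈ Finset.HasAntidiagonal.antidiagonal n, TensorProduct.map (𝓕.ext p.1) (𝓕.ext p.2)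

lemma tensorSymbol_tmul {i j n : ℕ} (h : i + j = n) {a b : B} (ha : a ∈ 𝓕.F i) (hb : b ∈ 𝓕.F j) :
    𝓕.tensorSymbol n (a ⊗ₜ b) = 𝓕.symbol i ⟨a, ha⟩ ⊗ₜ 𝓕.symbol j ⟨b, hb⟩ := by
  rw [tensorSymbol, LinearMap.sum_apply, Finset.sum_eq_single (i, j)]
  · simp [𝓕.ext_apply ha, 𝓕.ext_apply hb]
  · rintro ⟨p, q⟩ hpq hne
    rw [Finset.HasAntidiagonal.mem_antidiagonal] at hpq
    simp only at hpq
    rw [TensorProduct.map_tmul]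
    rcases lt_trichotomy i p with h' | h' | h'
    · simp [𝓕.ext_eq_zero h' ha]
    · exact absurd (Prod.ext h'.symm (by simp; omega)) hne
    · simp [𝓕.ext_eq_zero (show j < q by omega) hb]
  · intro h'
    exact absurd (Finset.HasAntidiagonal.mem_antidiagonal.2 h) h'

lemma tensorSymbol_eq_zero {m n : ℕ} (h : m < n) {z : B ⊗[k] B} (hz : z ∈ 𝓕.tensorF m) :
    𝓕.tensorSymbol n z = 0 := by
  refine 𝓕.eq_on_tensorF (𝓕.tensorSymbol n) 0 (fun i j hij a ha b hb => ?_) hz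
  rw [𝓕.tensorSymbol_tmul (i := n - j) (by omega) (𝓕.mono (by omega) ha) hb,
    𝓕.symbol_eq_zero (𝓕.le_prev (show i < n - j by omega) ha)]
  simp

/-- The product of two graded pieces, `(x + Fₘ₋₁)(y + Fₙ₋₁) = xy + Fₘ₊ₙ₋₁`. -/
def mulPiece (m n : ℕ) : 𝓕.Piece m →ₗ[k] 𝓕.Piece n →ₗ[k] 𝓕.Gr :=
  𝓕.liftPiece m
    (𝓕.liftPiece n
      (LinearMap.mk₂ k (fun (y : 𝓕.F n) (x : 𝓕.F m) =>
          𝓕.symbol (m + n) ⟨(x : B) * y, 𝓕.mul_mem x.2 y.2⟩)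
        (fun y y' x => by
          rw [← map_add]; exact congrArg _ (Subtype.ext (mul_add (x : B) y y')))
        (fun c y x => by
          rw [← map_smul]; exact congrArg _ (Subtype.ext (mul_smul_comm c (x : B) y)))
        (fun y x x' => by
          rw [← map_add]; exact congrArg _ (Subtype.ext (add_mul (x : B) x' y)))
        (fun c y x => by
          rw [← map_smul]; exact congrArg _ (Subtype.ext (smul_mul_assoc c (x : B) y))))
      (fun y hy => by
        ext x
        refine 𝓕.symbol_eq_zero ?_
        cases n with
        | zero =>
          have : (y : B) = 0 := hy
          simp [this]
        | succ n => exact 𝓕.mul_mem x.2 hy)).flip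
    (fun x hx => by
      refine LinearMap.ext fun y => ?_
      obtain ⟨y, rfl⟩ := 𝓕.toPiece_surjective n y
      refine 𝓕.symbol_eq_zero (x := ⟨(x : B) * y, 𝓕.mul_mem x.2 y.2⟩) ?_
      cases m with
      | zero =>
        have : (x : B) = 0 := hx
        simp [this]
      | succ m =>
        have h : (x : B) * y ∈ 𝓕.F (m + n) := 𝓕.mul_mem hx y.2
        exact 𝓕.le_prev (show m + n < m + 1 + n by omega) h)

/-- The product of `gr B`. -/
def grMul : 𝓕.Gr →ₗ[k] 𝓕.Gr →ₗ[k] 𝓕.Gr :=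
  𝓕.lift fun m => (𝓕.lift fun n => (𝓕.mulPiece m n).flip).flip

lemma grMul_symbol {m n : ℕ} (x : 𝓕.F m) (y : 𝓕.F n) :
    𝓕.grMul (𝓕.symbol m x) (𝓕.symbol n y) =
      𝓕.symbol (m + n) ⟨(x : B) * y, 𝓕.mul_mem x.2 y.2⟩ := by
  rw [grMul, lift_symbol, LinearMap.flip_apply, lift_symbol]
  rfl

lemma grMul_assoc (x y z : 𝓕.Gr) :
    𝓕.grMul (𝓕.grMul x y) z = 𝓕.grMul x (𝓕.grMul y z) := by
  induction x using 𝓕.gr_induction with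
  | h0 => simp
  | ha x x' hx hx' => simp [hx, hx']
  | hs l x =>
    induction y using 𝓕.gr_induction with
    | h0 => simp
    | ha y y' hy hy' => simp [hy, hy']
    | hs m y =>
      induction z using 𝓕.gr_induction with
      | h0 => simp
      | ha z z' hz hz' => simp [hz, hz']
      | hs n z =>
        simp only [grMul_symbol]
        exact 𝓕.symbol_congr (add_assoc _ _ _) (mul_assoc _ _ _)

lemma one_grMul (x : 𝓕.Gr) : 𝓕.grMul (𝓕.symbol 0 ⟨1, 𝓕.one_mem⟩) x = x := by
  induction x using 𝓕.gr_induction with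
  | h0 => simp
  | ha x x' hx hx' => rw [map_add, hx, hx']
  | hs l x =>
    rw [grMul_symbol]
    exact 𝓕.symbol_congr (zero_add _) (one_mul _)

lemma grMul_one (x : 𝓕.Gr) : 𝓕.grMul x (𝓕.symbol 0 ⟨1, 𝓕.one_mem⟩) = x := by
  induction x using 𝓕.gr_induction with
  | h0 => simp
  | ha x x' hx hx' => rw [map_add, LinearMap.add_apply, hx, hx']
  | hs l x =>
    rw [grMul_symbol]
    exact 𝓕.symbol_congr (add_zero _) (mul_one _)

instance : Ring 𝓕.Gr :=
  { (inferInstance : AddCommGroup 𝓕.Gr) with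
    mul := fun x y => 𝓕.grMul x y
    one := 𝓕.symbol 0 ⟨1, 𝓕.one_mem⟩
    left_distrib := fun x y z => map_add (𝓕.grMul x) y z
    right_distrib := fun x y z => LinearMap.map_add₂ 𝓕.grMul x y z
    zero_mul := fun x => LinearMap.map_zero₂ 𝓕.grMul x
    mul_zero := fun x => map_zero (𝓕.grMul x)
    mul_assoc := 𝓕.grMul_assoc
    one_mul := 𝓕.one_grMul
    mul_one := 𝓕.grMul_one }

lemma mul_def (x y : 𝓕.Gr) : x * y = 𝓕.grMul x y := rfl

lemma one_def : (1 : 𝓕.Gr) = 𝓕.symbol 0 ⟨1, 𝓕.one_mem⟩ := rfl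

lemma symbol_mul_symbol {m n : ℕ} (x : 𝓕.F m) (y : 𝓕.F n) :
    𝓕.symbol m x * 𝓕.symbol n y = 𝓕.symbol (m + n) ⟨(x : B) * y, 𝓕.mul_mem x.2 y.2⟩ :=
  𝓕.grMul_symbol x y

instance : Algebra k 𝓕.Gr :=
  Algebra.ofModule (fun c x y => LinearMap.map_smul₂ 𝓕.grMul c x y)
    (fun c x y => map_smul (𝓕.grMul x) c y)

/-- The counit of `gr B`: that of `B` on `F₀`, and zero in positive degrees. -/
def grCounit : 𝓕.Gr →ₗ[k] k :=
  𝓕.lift fun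
    | 0 => 𝓕.liftPiece 0 (counit (R := k) (A := B) ∘ₗ (𝓕.F 0).subtype) (fun x hx => by
        have : (x : B) = 0 := hx
        simp [this])
    | _ + 1 => 0

/-- The comultiplication of `gr B`: for `x ∈ Fₙ` with `Δ(x) = ∑ a ⊗ b` where each `a ⊗ b` lies in
some `Fᵢ ⊗ Fⱼ` with `i + j = n`, one has `Δ(x + Fₙ₋₁) = ∑ (a + Fᵢ₋₁) ⊗ (b + Fⱼ₋₁)`. -/
def grComul : 𝓕.Gr →ₗ[k] 𝓕.Gr ⊗[k] 𝓕.Gr :=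
  𝓕.lift fun n => 𝓕.liftPiece n
    (𝓕.tensorSymbol n ∘ₗ comul (R := k) (A := B) ∘ₗ (𝓕.F n).subtype) (fun x hx => by
      cases n with
      | zero =>
        have : (x : B) = 0 := hx
        simp [this]
      | succ n => exact 𝓕.tensorSymbol_eq_zero (Nat.lt_succ_self n) (𝓕.comul_mem hx))

lemma grCounit_symbol_zero (x : 𝓕.F 0) :
    𝓕.grCounit (𝓕.symbol 0 x) = counit (R := k) (x : B) := by
  rw [grCounit, lift_symbol]; rfl

lemma grCounit_symbol_of_pos {n : ℕ} (hn : 0 < n) (x : 𝓕.F n) :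
    𝓕.grCounit (𝓕.symbol n x) = 0 := by
  obtain ⟨n, rfl⟩ : ∃ m, n = m + 1 := ⟨n - 1, by omega⟩
  rw [grCounit, lift_symbol]; rfl

lemma grComul_symbol {n : ℕ} (x : 𝓕.F n) :
    𝓕.grComul (𝓕.symbol n x) = 𝓕.tensorSymbol n (comul (R := k) (x : B)) := by
  rw [grComul, lift_symbol]; rfl

instance : CoalgebraStruct k 𝓕.Gr where
  comul := 𝓕.grComul
  counit := 𝓕.grCounit

lemma rTensor_grCounit_grComul (x : 𝓕.Gr) :
    𝓕.grCounit.rTensor 𝓕.Gr (𝓕.grComul x) = 1 ⊗ₜ[k] x := by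
  induction x using 𝓕.gr_induction with
  | h0 => simp
  | ha x x' hx hx' => rw [map_add, map_add, hx, hx', TensorProduct.tmul_add]
  | hs n x =>
    rw [grComul_symbol]
    have key := 𝓕.eq_on_tensorF (n := n) (𝓕.grCounit.rTensor 𝓕.Gr ∘ₗ 𝓕.tensorSymbol n)
      ((𝓕.ext n).lTensor k ∘ₗ (counit (R := k) (A := B)).rTensor B) (fun i j hij a ha b hb => by
        simp only [LinearMap.comp_apply, LinearMap.rTensor_tmul, LinearMap.lTensor_tmul,
          𝓕.tensorSymbol_tmul hij ha hb]
        rcases Nat.eq_zero_or_pos i with rfl | hi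
        · obtain rfl : j = n := by omega
          rw [grCounit_symbol_zero, 𝓕.ext_apply hb]
        · rw [𝓕.grCounit_symbol_of_pos hi, 𝓕.ext_eq_zero (show j < n by omega) hb]
          simp) (𝓕.comul_mem x.2)
    rw [LinearMap.comp_apply] at key
    rw [key, LinearMap.comp_apply, rTensor_counit_comul, LinearMap.lTensor_tmul, 𝓕.ext_apply x.2]

lemma lTensor_grCounit_grComul (x : 𝓕.Gr) :
    𝓕.grCounit.lTensor 𝓕.Gr (𝓕.grComul x) = x ⊗ₜ[k] 1 := by
  induction x using 𝓕.gr_induction with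
  | h0 => simp
  | ha x x' hx hx' => rw [map_add, map_add, hx, hx', TensorProduct.add_tmul]
  | hs n x =>
    rw [grComul_symbol]
    have key := 𝓕.eq_on_tensorF (n := n) (𝓕.grCounit.lTensor 𝓕.Gr ∘ₗ 𝓕.tensorSymbol n)
      ((𝓕.ext n).rTensor k ∘ₗ (counit (R := k) (A := B)).lTensor B) (fun i j hij a ha b hb => by
        simp only [LinearMap.comp_apply, LinearMap.rTensor_tmul, LinearMap.lTensor_tmul,
          𝓕.tensorSymbol_tmul hij ha hb]
        rcases Nat.eq_zero_or_pos j with rfl | hi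
        · obtain rfl : i = n := by omega
          rw [grCounit_symbol_zero, 𝓕.ext_apply ha]
        · rw [𝓕.grCounit_symbol_of_pos hi, 𝓕.ext_eq_zero (show i < n by omega) ha]
          simp) (𝓕.comul_mem x.2)
    rw [LinearMap.comp_apply] at key
    rw [key, LinearMap.comp_apply, lTensor_counit_comul, LinearMap.rTensor_tmul, 𝓕.ext_apply x.2]

lemma tensorSymbol_comul_eq_zero {m n : ℕ} (h : m < n) {x : B} (hx : x ∈ 𝓕.F m) :
    𝓕.tensorSymbol n (comul (R := k) x) = 0 :=
  𝓕.tensorSymbol_eq_zero h (𝓕.comul_mem hx)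

lemma rTensor_grComul_tensorSymbol (n : ℕ) {z : B ⊗[k] B} (hz : z ∈ 𝓕.tensorF n) :
    𝓕.grComul.rTensor 𝓕.Gr (𝓕.tensorSymbol n z) =
      ∑ p ∈ Finset.HasAntidiagonal.antidiagonal n,
        TensorProduct.map (𝓕.tensorSymbol p.1 ∘ₗ comul (R := k)) (𝓕.ext p.2) z := by
  rw [← LinearMap.comp_apply, ← LinearMap.sum_apply]
  refine 𝓕.eq_on_tensorF _ _ (fun i j hij a ha b hb => ?_) hz
  rw [LinearMap.comp_apply, 𝓕.tensorSymbol_tmul hij ha hb, LinearMap.rTensor_tmul,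
    grComul_symbol, LinearMap.sum_apply, Finset.sum_eq_single (i, j)]
  · simp [𝓕.ext_apply hb]
  · rintro ⟨p, q⟩ hpq hne
    rw [Finset.HasAntidiagonal.mem_antidiagonal] at hpq
    simp only at hpq
    rw [TensorProduct.map_tmul, LinearMap.comp_apply]
    rcases lt_trichotomy i p with h' | h' | h'
    · simp [𝓕.tensorSymbol_comul_eq_zero h' ha]
    · exact absurd (Prod.ext h'.symm (by simp; omega)) hne
    · simp [𝓕.ext_eq_zero (show j < q by omega) hb]
  · intro h'
    exact absurd (Finset.HasAntidiagonal.mem_antidiagonal.2 hij) h'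

lemma lTensor_grComul_tensorSymbol (n : ℕ) {z : B ⊗[k] B} (hz : z ∈ 𝓕.tensorF n) :
    𝓕.grComul.lTensor 𝓕.Gr (𝓕.tensorSymbol n z) =
      ∑ p ∈ Finset.HasAntidiagonal.antidiagonal n,
        TensorProduct.map (𝓕.ext p.1) (𝓕.tensorSymbol p.2 ∘ₗ comul (R := k)) z := by
  rw [← LinearMap.comp_apply, ← LinearMap.sum_apply]
  refine 𝓕.eq_on_tensorF _ _ (fun i j hij a ha b hb => ?_) hz
  rw [LinearMap.comp_apply, 𝓕.tensorSymbol_tmul hij ha hb, LinearMap.lTensor_tmul,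
    grComul_symbol, LinearMap.sum_apply, Finset.sum_eq_single (i, j)]
  · simp [𝓕.ext_apply ha]
  · rintro ⟨p, q⟩ hpq hne
    rw [Finset.HasAntidiagonal.mem_antidiagonal] at hpq
    simp only at hpq
    rw [TensorProduct.map_tmul, LinearMap.comp_apply]
    rcases lt_trichotomy i p with h' | h' | h'
    · simp [𝓕.ext_eq_zero h' ha]
    · exact absurd (Prod.ext h'.symm (by simp; omega)) hne
    · simp [𝓕.tensorSymbol_comul_eq_zero (show j < q by omega) hb]
  · intro h'
    exact absurd (Finset.HasAntidiagonal.mem_antidiagonal.2 hij) h'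

lemma grComul_coassoc (x : 𝓕.Gr) :
    TensorProduct.assoc k 𝓕.Gr 𝓕.Gr 𝓕.Gr (𝓕.grComul.rTensor 𝓕.Gr (𝓕.grComul x)) =
      𝓕.grComul.lTensor 𝓕.Gr (𝓕.grComul x) := by
  induction x using 𝓕.gr_induction with
  | h0 => simp
  | ha x x' hx hx' => simp only [map_add, hx, hx']
  | hs n x =>
    rw [grComul_symbol, 𝓕.rTensor_grComul_tensorSymbol n (𝓕.comul_mem x.2),
      𝓕.lTensor_grComul_tensorSymbol n (𝓕.comul_mem x.2)]
    have hl : ∀ p : ℕ × ℕ, TensorProduct.map (𝓕.tensorSymbol p.1 ∘ₗ comul (R := k)) (𝓕.ext p.2)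
        (comul (R := k) (x : B)) = ∑ q ∈ Finset.HasAntidiagonal.antidiagonal p.1,
          TensorProduct.map (TensorProduct.map (𝓕.ext q.1) (𝓕.ext q.2) ∘ₗ comul (R := k))
            (𝓕.ext p.2) (comul (R := k) (x : B)) := by
      intro p
      have : 𝓕.tensorSymbol p.1 ∘ₗ comul (R := k) (A := B) =
          ∑ q ∈ Finset.HasAntidiagonal.antidiagonal p.1,
            TensorProduct.map (𝓕.ext q.1) (𝓕.ext q.2) ∘ₗ comul (R := k) := by
        ext y; simp [tensorSymbol]
      rw [this, ← TensorProduct.mapBilinear_apply, map_sum, LinearMap.sum_apply,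
        LinearMap.sum_apply]
      rfl
    have hr : ∀ p : ℕ × ℕ, TensorProduct.map (𝓕.ext p.1) (𝓕.tensorSymbol p.2 ∘ₗ comul (R := k))
        (comul (R := k) (x : B)) = ∑ q ∈ Finset.HasAntidiagonal.antidiagonal p.2,
          TensorProduct.map (𝓕.ext p.1)
            (TensorProduct.map (𝓕.ext q.1) (𝓕.ext q.2) ∘ₗ comul (R := k))
            (comul (R := k) (x : B)) := by
      intro p
      have : 𝓕.tensorSymbol p.2 ∘ₗ comul (R := k) (A := B) =
          ∑ q ∈ Finset.HasAntidiagonal.antidiagonal p.2,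
            TensorProduct.map (𝓕.ext q.1) (𝓕.ext q.2) ∘ₗ comul (R := k) := by
        ext y; simp [tensorSymbol]
      rw [this, ← TensorProduct.mapBilinear_apply, map_sum, LinearMap.sum_apply]
      rfl
    simp only [hl, hr, map_sum, map_map_comul]
    rw [Finset.sum_sigma', Finset.sum_sigma']
    refine Finset.sum_nbij' (fun s => ⟨(s.2.1, s.2.2 + s.1.2), (s.2.2, s.1.2)⟩)
      (fun s => ⟨(s.1.1 + s.2.1, s.2.2), (s.1.1, s.2.1)⟩) ?_ ?_ ?_ ?_ ?_
    · rintro ⟨⟨a, b⟩, ⟨c, d⟩⟩ h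
      simp only [Finset.mem_sigma, Finset.HasAntidiagonal.mem_antidiagonal] at h ⊢
      exact ⟨by omega, trivial⟩
    · rintro ⟨⟨a, b⟩, ⟨c, d⟩⟩ h
      simp only [Finset.mem_sigma, Finset.HasAntidiagonal.mem_antidiagonal] at h ⊢
      exact ⟨by omega, trivial⟩
    · rintro ⟨⟨a, b⟩, ⟨c, d⟩⟩ h
      simp only [Finset.mem_sigma, Finset.HasAntidiagonal.mem_antidiagonal] at h
      obtain ⟨-, rfl⟩ := h
      rfl
    · rintro ⟨⟨a, b⟩, ⟨c, d⟩⟩ h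
      simp only [Finset.mem_sigma, Finset.HasAntidiagonal.mem_antidiagonal] at h
      obtain ⟨-, rfl⟩ := h
      rfl
    · rintro ⟨⟨a, b⟩, ⟨c, d⟩⟩ h
      rfl

instance : Coalgebra k 𝓕.Gr where
  coassoc := LinearMap.ext 𝓕.grComul_coassoc
  rTensor_counit_comp_comul := LinearMap.ext 𝓕.rTensor_grCounit_grComul
  lTensor_counit_comp_comul := LinearMap.ext 𝓕.lTensor_grCounit_grComul

lemma tensorSymbol_mul {m n : ℕ} {z w : B ⊗[k] B} (hz : z ∈ 𝓕.tensorF m)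
    (hw : w ∈ 𝓕.tensorF n) :
    𝓕.tensorSymbol (m + n) (z * w) = 𝓕.tensorSymbol m z * 𝓕.tensorSymbol n w := by
  refine 𝓕.eq_on_tensorF (𝓕.tensorSymbol (m + n) ∘ₗ LinearMap.mulRight k w)
    (LinearMap.mulRight k (𝓕.tensorSymbol n w) ∘ₗ 𝓕.tensorSymbol m)
    (fun i j hij a ha b hb => ?_) hz
  refine 𝓕.eq_on_tensorF (𝓕.tensorSymbol (m + n) ∘ₗ LinearMap.mulLeft k (a ⊗ₜ[k] b))
    (LinearMap.mulLeft k (𝓕.tensorSymbol m (a ⊗ₜ[k] b)) ∘ₗ 𝓕.tensorSymbol n)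
    (fun i' j' hij' a' ha' b' hb' => ?_) hw
  simp only [LinearMap.comp_apply, LinearMap.mulLeft_apply, Algebra.TensorProduct.tmul_mul_tmul]
  rw [𝓕.tensorSymbol_tmul (show (i + i') + (j + j') = m + n by omega) (𝓕.mul_mem ha ha')
    (𝓕.mul_mem hb hb'), 𝓕.tensorSymbol_tmul hij ha hb, 𝓕.tensorSymbol_tmul hij' ha' hb',
    Algebra.TensorProduct.tmul_mul_tmul, symbol_mul_symbol, symbol_mul_symbol]

lemma grComul_mul (x y : 𝓕.Gr) : 𝓕.grComul (x * y) = 𝓕.grComul x * 𝓕.grComul y := by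
  induction x using 𝓕.gr_induction with
  | h0 => simp
  | ha x x' hx hx' => rw [add_mul, map_add, hx, hx', map_add, add_mul]
  | hs m x =>
    induction y using 𝓕.gr_induction with
    | h0 => simp
    | ha y y' hy hy' => rw [mul_add, map_add, hy, hy', map_add, mul_add]
    | hs n y =>
      rw [symbol_mul_symbol, grComul_symbol, grComul_symbol, grComul_symbol,
        Bialgebra.comul_mul]
      exact 𝓕.tensorSymbol_mul (𝓕.comul_mem x.2) (𝓕.comul_mem y.2)

lemma grCounit_mul (x y : 𝓕.Gr) : 𝓕.grCounit (x * y) = 𝓕.grCounit x * 𝓕.grCounit y := by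
  induction x using 𝓕.gr_induction with
  | h0 => simp
  | ha x x' hx hx' => rw [add_mul, map_add, hx, hx', map_add, add_mul]
  | hs m x =>
    induction y using 𝓕.gr_induction with
    | h0 => simp
    | ha y y' hy hy' => rw [mul_add, map_add, hy, hy', map_add, mul_add]
    | hs n y =>
      rw [symbol_mul_symbol]
      rcases Nat.eq_zero_or_pos m with rfl | hm
      · rcases Nat.eq_zero_or_pos n with rfl | hn
        · rw [grCounit_symbol_zero, grCounit_symbol_zero, grCounit_symbol_zero]
          exact Bialgebra.counit_mul _ _
        · rw [𝓕.grCounit_symbol_of_pos hn, 𝓕.grCounit_symbol_of_pos (by omega), mul_zero]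
      · rw [𝓕.grCounit_symbol_of_pos hm, 𝓕.grCounit_symbol_of_pos (by omega), zero_mul]

/-- The associated graded bialgebra of a bialgebra filtration. -/
instance : Bialgebra k 𝓕.Gr :=
  Bialgebra.mk' k 𝓕.Gr
    ((𝓕.grCounit_symbol_zero _).trans Bialgebra.counit_one)
    (𝓕.grCounit_mul _ _)
    (by
      refine (𝓕.grComul_symbol _).trans ?_
      rw [Bialgebra.comul_one, Algebra.TensorProduct.one_def,
        𝓕.tensorSymbol_tmul (add_zero 0) 𝓕.one_mem 𝓕.one_mem]
      rfl)
    (𝓕.grComul_mul _ _)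

end BialgebraFiltration

/-! ### The coradically graded version of a pointed bialgebra -/

section CoradicalBialgebra

open Coalgebra

variable {k : Type u} {B : Type v} [Field k] [Ring B] [Bialgebra k B]

lemma one_mem_coradical : (1 : B) ∈ coradical k B :=
  (le_sSup (a := Submodule.span k {(1 : B)})
    (isSimpleSubcoalgebra_span_of_isGroupLikeElem .one))
    (Submodule.mem_span_singleton_self (1 : B))

lemma coradical_mul_mem (hB : IsPointedCoalgebra k B) {x y : B} (hx : x ∈ coradical k B)
    (hy : y ∈ coradical k B) : x * y ∈ coradical k B := by
  have hle : coradical k B ≤ Submodule.span k {g : B | IsGroupLikeElem k g} := by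
    refine sSup_le fun D hD => ?_
    obtain ⟨g, hg, rfl⟩ := exists_isGroupLikeElem_of_isPointed hB hD
    exact Submodule.span_mono (by simpa using hg)
  have hge : ∀ g : B, IsGroupLikeElem k g → g ∈ coradical k B := fun g hg =>
    (le_sSup (a := Submodule.span k {g}) (isSimpleSubcoalgebra_span_of_isGroupLikeElem hg))
      (Submodule.mem_span_singleton_self g)
  have hx' := hle hx
  have hy' := hle hy
  clear hx hy
  induction hx' using Submodule.span_induction with
  | zero => simp
  | add a b _ _ ha hb => rw [add_mul]; exact add_mem ha hb
  | smul c a _ ha => rw [smul_mul_assoc]; exact Submodule.smul_mem _ _ ha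
  | mem g hg =>
    induction hy' using Submodule.span_induction with
    | zero => simp
    | add a b _ _ ha hb => rw [mul_add]; exact add_mem ha hb
    | smul c a _ ha => rw [mul_smul_comm]; exact Submodule.smul_mem _ _ ha
    | mem h hh => exact hge _ (IsGroupLikeElem.mul hg hh)

lemma coradicalFiltration_mul_mem (hB : IsPointedCoalgebra k B) {m n : ℕ} {x y : B}
    (hx : x ∈ coradicalFiltration k B m) (hy : y ∈ coradicalFiltration k B n) :
    x * y ∈ coradicalFiltration k B (m + n) := by
  suffices h : ∀ s m n, m + n = s → ∀ x ∈ coradicalFiltration k B m,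
      ∀ y ∈ coradicalFiltration k B n, x * y ∈ coradicalFiltration k B s from
    h _ m n rfl x hx y hy
  clear hx hy x y m n
  intro s
  induction s with
  | zero =>
    intro m n hmn x hx y hy
    obtain ⟨rfl, rfl⟩ : m = 0 ∧ n = 0 := by omega
    exact coradical_mul_mem hB hx hy
  | succ s ih =>
    intro m n hmn x hx y hy
    have hmul : ∀ i j, i + j ≤ s → ∀ x ∈ coradicalFiltration k B i,
        ∀ y ∈ coradicalFiltration k B j, x * y ∈ coradicalFiltration k B s :=
      fun i j hij x hx y hy => ih i (s - i) (by omega) x hx y (coradicalFiltration_mono (by omega) hy)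
    have hz := comul_mem_coradicalFiltration m x hx
    have hw := comul_mem_coradicalFiltration n y hy
    let T : ℕ → Submodule k (B ⊗[k] B) := fun l => ⨆ p ∈ Finset.HasAntidiagonal.antidiagonal l,
      tensorSub k (coradicalFiltration k B p.1) (coradicalFiltration k B p.2)
    suffices h : ∀ z ∈ T m, ∀ w ∈ T n, z * w ∈ tensorSub k (coradical k B) ⊤ ⊔ tensorSub k ⊤ (coradicalFiltration k B s) by
      change comul (R := k) (x * y) ∈
        tensorSub k (coradical k B) ⊤ ⊔ tensorSub k ⊤ (coradicalFiltration k B s)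
      rw [Bialgebra.comul_mul]
      exact h _ hz _ hw
    have key : ∀ i i', i + i' = m → ∀ a ∈ coradicalFiltration k B i,
        ∀ a' ∈ coradicalFiltration k B i', ∀ j j', j + j' = n → ∀ b ∈ coradicalFiltration k B j,
        ∀ b' ∈ coradicalFiltration k B j', (a ⊗ₜ[k] a') * (b ⊗ₜ[k] b') ∈
          tensorSub k (coradical k B) ⊤ ⊔ tensorSub k ⊤ (coradicalFiltration k B s) := by
      intro i i' hi a ha a' ha' j j' hj b hb b' hb'
      rw [Algebra.TensorProduct.tmul_mul_tmul]
      by_cases h0 : i + j = 0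
      · obtain ⟨rfl, rfl⟩ : i = 0 ∧ j = 0 := by omega
        exact Submodule.mem_sup_left (Submodule.apply_mem_map₂ _ (coradical_mul_mem hB ha hb)
          trivial)
      · exact Submodule.mem_sup_right (Submodule.apply_mem_map₂ _ trivial
          (hmul i' j' (by omega) a' ha' b' hb'))
    intro z hz w hw
    let S := tensorSub k (coradical k B) ⊤ ⊔ tensorSub k ⊤ (coradicalFiltration k B s)
    have h1 : T m ≤ S.comap (LinearMap.mulRight k w) := by
      refine iSup₂_le fun p hp => Submodule.map₂_le.2 fun a ha a' ha' => ?_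
      have h2 : T n ≤ S.comap (LinearMap.mulLeft k (a ⊗ₜ[k] a')) := by
        refine iSup₂_le fun q hq => Submodule.map₂_le.2 fun b hb b' hb' => ?_
        exact key p.1 p.2 (Finset.HasAntidiagonal.mem_antidiagonal.1 hp) a ha a' ha' q.1 q.2
          (Finset.HasAntidiagonal.mem_antidiagonal.1 hq) b hb b' hb'
      exact h2 hw
    exact h1 hz

/-- The coradical filtration of a pointed bialgebra, as a bialgebra filtration. -/
def coradicalBialgebraFiltration (hB : IsPointedCoalgebra k B) : BialgebraFiltration k B where
  F := coradicalFiltration k B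
  mono := coradicalFiltration_mono
  one_mem := one_mem_coradical
  mul_mem := coradicalFiltration_mul_mem hB
  comul_mem := comul_mem_coradicalFiltration _ _

/-- The coradically graded version `gr B = B₀ ⊕ B₁/B₀ ⊕ B₂/B₁ ⊕ ⋯` of a pointed bialgebra. -/
abbrev CoradicalGr (hB : IsPointedCoalgebra k B) : Type v := (coradicalBialgebraFiltration hB).Gr

end CoradicalBialgebra

/-! ### Path coalgebras -/

/-- The paths of a quiver, including the trivial paths, bundled with their endpoints. -/
structure QuiverPath (V : Type w₁) [Quiver.{w₂} V] where
  /-- the source of the path -/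
  src : V
  /-- the target of the path -/
  tgt : V
  /-- the path itself -/
  path : Quiver.Path src tgt

/-- The splittings of a path `p = aₙ ⋯ a₁` as a concatenation of `q = aᵢ ⋯ a₁` followed by
`r = aₙ ⋯ aᵢ₊₁`, for `0 ≤ i ≤ n`, listed as the pairs `(r, q)` together with the vertex where
`q` ends and `r` starts. -/
def pathSplits {V : Type w₁} [Quiver.{w₂} V] {a : V} :
    {b : V} → Quiver.Path a b → List (Σ d : V, Quiver.Path d b × Quiver.Path a d)
  | _, .nil => [⟨a, .nil, .nil⟩]
  | c, .cons p e => ⟨c, .nil, .cons p e⟩ :: (pathSplits p).map fun s => ⟨s.1, s.2.1.cons e, s.2.2⟩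

/-- The path coalgebra `kQ` of a quiver `Q` with vertex set `V`: the vector space with basis the
set of paths. -/
def PathCoalgebra (k : Type u) [Field k] (V : Type w₁) [Quiver.{w₂} V] : Type max u w₁ w₂ :=
  QuiverPath V →₀ k

namespace PathCoalgebra

variable (k : Type u) [Field k] (V : Type w₁) [Quiver.{w₂} V]

instance : AddCommGroup (PathCoalgebra k V) := inferInstanceAs (AddCommGroup (QuiverPath V →₀ k))

instance : Module k (PathCoalgebra k V) := inferInstanceAs (Module k (QuiverPath V →₀ k))

/-- The basis of the path coalgebra consisting of the paths. -/
def basis : Module.Basis (QuiverPath V) k (PathCoalgebra k V) :=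
  Module.Basis.ofRepr (LinearEquiv.refl k (QuiverPath V →₀ k))

variable {V}

/-- A path as an element of the path coalgebra. -/
def ofPath {a b : V} (p : Quiver.Path a b) : PathCoalgebra k V := basis k V ⟨a, b, p⟩

variable (V)

/-- The comultiplication `Δ(p) = ∑ r ⊗ q` over all splittings of `p` as `q` followed by `r`. -/
def comulMap : PathCoalgebra k V →ₗ[k] PathCoalgebra k V ⊗[k] PathCoalgebra k V :=
  (basis k V).constr k fun p =>
    ((pathSplits p.path).map fun s => ofPath k s.2.1 ⊗ₜ[k] ofPath k s.2.2).sum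

/-- The counit: `1` on trivial paths and `0` on all other paths. -/
def counitMap : PathCoalgebra k V →ₗ[k] k :=
  (basis k V).constr k fun p => if p.path.length = 0 then 1 else 0

instance : CoalgebraStruct k (PathCoalgebra k V) where
  comul := comulMap k V
  counit := counitMap k V

variable {V}

lemma comul_ofPath {a b : V} (p : Quiver.Path a b) :
    Coalgebra.comul (R := k) (ofPath k p) =
      ((pathSplits p).map fun s => ofPath k s.2.1 ⊗ₜ[k] ofPath k s.2.2).sum :=
  (basis k V).constr_basis k _ _

lemma counit_ofPath {a b : V} (p : Quiver.Path a b) :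
    Coalgebra.counit (R := k) (ofPath k p) = if p.length = 0 then 1 else 0 :=
  (basis k V).constr_basis k _ _

lemma hom_ext {M : Type*} [AddCommGroup M] [Module k M] {f g : PathCoalgebra k V →ₗ[k] M}
    (h : ∀ (a b : V) (p : Quiver.Path a b), f (ofPath k p) = g (ofPath k p)) : f = g :=
  (basis k V).ext fun p => h p.src p.tgt p.path

lemma sum_pathSplits_assoc {M : Type*} [AddCommMonoid M] {a b : V} (p : Quiver.Path a b)
    (f : ∀ (d d' : V), Quiver.Path d' b → Quiver.Path d d' → Quiver.Path a d → M) :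
    ((pathSplits p).map fun s =>
      ((pathSplits s.2.1).map fun t => f s.1 t.1 t.2.1 t.2.2 s.2.2).sum).sum =
    ((pathSplits p).map fun s =>
      ((pathSplits s.2.2).map fun t => f t.1 s.1 s.2.1 t.2.1 t.2.2).sum).sum := by
  induction p with
  | nil => simp [pathSplits]
  | cons p e ih =>
    have := ih fun d d' r m q => f d d' (r.cons e) m q
    simp only [pathSplits, List.map_cons, List.map_map, Function.comp_def, List.sum_cons,
      List.map_nil, List.sum_nil, add_zero, List.sum_map_add, this, add_assoc]

lemma pathSplits_counit_left {M : Type*} [AddCommMonoid M] {a b : V} (p : Quiver.Path a b)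
    (f : ∀ d : V, Quiver.Path a d → M) :
    ((pathSplits p).map fun s => if s.2.1.length = 0 then f s.1 s.2.2 else 0).sum = f b p := by
  cases p with
  | nil => simp [pathSplits]
  | cons p e => simp [pathSplits, Function.comp_def]

lemma pathSplits_counit_right {M : Type*} [AddCommMonoid M] {a b : V} (p : Quiver.Path a b)
    (f : ∀ d : V, Quiver.Path d b → M) :
    ((pathSplits p).map fun s => if s.2.2.length = 0 then f s.1 s.2.1 else 0).sum = f a p := by
  induction p with
  | nil => simp [pathSplits]
  | cons p e ih =>
    have := ih fun d r => f d (r.cons e)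
    simp only [pathSplits, List.map_cons, List.map_map, Function.comp_def, List.sum_cons, this]
    simp

instance : Coalgebra k (PathCoalgebra k V) where
  coassoc := hom_ext k fun a b p => by
    have hl : ∀ (l : List (PathCoalgebra k V ⊗[k] PathCoalgebra k V)) (y : PathCoalgebra k V),
        l.sum ⊗ₜ[k] y = (l.map (· ⊗ₜ[k] y)).sum := fun l y =>
      map_list_sum ((TensorProduct.mk k _ _).flip y) l
    have hr : ∀ (x : PathCoalgebra k V) (l : List (PathCoalgebra k V ⊗[k] PathCoalgebra k V)),
        x ⊗ₜ[k] l.sum = (l.map (x ⊗ₜ[k] ·)).sum := fun x l =>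
      map_list_sum (TensorProduct.mk k _ _ x) l
    simp only [LinearMap.comp_apply, comul_ofPath, map_list_sum, List.map_map, Function.comp_def,
      LinearMap.rTensor_tmul, LinearMap.lTensor_tmul, hl, hr, LinearEquiv.coe_coe,
      TensorProduct.assoc_tmul]
    exact sum_pathSplits_assoc p fun d d' r m q =>
      ofPath k r ⊗ₜ[k] (ofPath k m ⊗ₜ[k] ofPath k q)
  rTensor_counit_comp_comul := hom_ext k fun a b p => by
    simp only [LinearMap.comp_apply, comul_ofPath, map_list_sum, List.map_map, Function.comp_def,
      LinearMap.rTensor_tmul, counit_ofPath, TensorProduct.ite_tmul, TensorProduct.mk_apply]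
    exact pathSplits_counit_left p fun d q => (1 : k) ⊗ₜ[k] ofPath k q
  lTensor_counit_comp_comul := hom_ext k fun a b p => by
    simp only [LinearMap.comp_apply, comul_ofPath, map_list_sum, List.map_map, Function.comp_def,
      LinearMap.lTensor_tmul, counit_ofPath, TensorProduct.tmul_ite, LinearMap.flip_apply,
      TensorProduct.mk_apply]
    exact pathSplits_counit_right p fun d r => ofPath k r ⊗ₜ[k] (1 : k)

variable (V)

/-- The subspace `kQₙ` spanned by the paths of length `n`. -/
def degree (n : ℕ) : Submodule k (PathCoalgebra k V) :=
  Submodule.span k {x | ∃ (a b : V) (p : Quiver.Path a b), p.length = n ∧ x = ofPath k p}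

end PathCoalgebra

/-- A graded bialgebra structure on the path coalgebra `kQ`: an associative unital multiplication
which respects the length grading and for which the comultiplication and the counit of the path
coalgebra are multiplicative and unital. -/
structure PathBialgebraStructure (k : Type u) [Field k] (V : Type w₁) [Quiver.{w₂} V] where
  /-- the multiplication -/
  mul : PathCoalgebra k V →ₗ[k] PathCoalgebra k V →ₗ[k] PathCoalgebra k V
  /-- the unit element -/
  one : PathCoalgebra k V
  mul_assoc : ∀ x y z, mul (mul x y) z = mul x (mul y z)
  one_mul : ∀ x, mul one x = x
  mul_one : ∀ x, mul x one = x
  comul_one : Coalgebra.comul (R := k) one = one ⊗ₜ[k] one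
  counit_one : Coalgebra.counit (R := k) one = 1
  comul_mul : ∀ x y, Coalgebra.comul (R := k) (mul x y) =
    TensorProduct.map₂ mul mul (Coalgebra.comul (R := k) x) (Coalgebra.comul (R := k) y)
  counit_mul : ∀ x y, Coalgebra.counit (R := k) (mul x y) =
    Coalgebra.counit (R := k) x * Coalgebra.counit (R := k) y
  one_mem : one ∈ PathCoalgebra.degree k V 0
  mul_mem : ∀ {m n : ℕ} {x y}, x ∈ PathCoalgebra.degree k V m → y ∈ PathCoalgebra.degree k V n →
    mul x y ∈ PathCoalgebra.degree k V (m + n)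

/-- The path coalgebra `kQ` endowed with a given graded bialgebra structure. -/
def PathBialgebra {k : Type u} [Field k] {V : Type w₁} [Quiver.{w₂} V]
    (_S : PathBialgebraStructure k V) : Type max u w₁ w₂ :=
  PathCoalgebra k V

namespace PathBialgebra

variable {k : Type u} [Field k] {V : Type w₁} [Quiver.{w₂} V] (S : PathBialgebraStructure k V)

instance : AddCommGroup (PathBialgebra S) := inferInstanceAs (AddCommGroup (PathCoalgebra k V))

instance : Module k (PathBialgebra S) := inferInstanceAs (Module k (PathCoalgebra k V))

instance : Coalgebra k (PathBialgebra S) := inferInstanceAs (Coalgebra k (PathCoalgebra k V))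

/-- The multiplication of the structure `S`. -/
def mulMap : PathBialgebra S →ₗ[k] PathBialgebra S →ₗ[k] PathBialgebra S := S.mul

instance : Ring (PathBialgebra S) :=
  { (inferInstance : AddCommGroup (PathBialgebra S)) with
    mul := fun x y => mulMap S x y
    one := S.one
    left_distrib := fun x y z => map_add (mulMap S x) y z
    right_distrib := fun x y z => LinearMap.map_add₂ (mulMap S) x y z
    zero_mul := fun x => LinearMap.map_zero₂ (mulMap S) x
    mul_zero := fun x => map_zero (mulMap S x)
    mul_assoc := S.mul_assoc
    one_mul := S.one_mul
    mul_one := S.mul_one }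

instance : Algebra k (PathBialgebra S) :=
  Algebra.ofModule (fun c x y => LinearMap.map_smul₂ (mulMap S) c x y)
    (fun c x y => map_smul (mulMap S x) c y)

lemma map₂_mulMap (z w : PathBialgebra S ⊗[k] PathBialgebra S) :
    TensorProduct.map₂ (mulMap S) (mulMap S) z w = z * w := by
  induction z with
  | zero => simp
  | add z z' hz hz' => rw [map_add, LinearMap.add_apply, hz, hz', add_mul]
  | tmul a b =>
    induction w with
    | zero => simp
    | add w w' hw hw' => rw [map_add, hw, hw', mul_add]
    | tmul c d =>
      rw [TensorProduct.map₂_apply_tmul, TensorProduct.map_tmul,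
        Algebra.TensorProduct.tmul_mul_tmul]
      rfl

instance : Bialgebra k (PathBialgebra S) :=
  Bialgebra.mk' k (PathBialgebra S) S.counit_one (S.counit_mul _ _) S.comul_one
    (fun {a b} => (S.comul_mul a b).trans (map₂_mulMap S _ _))

/-- The homogeneous component `kQₙ`. -/
def degree (n : ℕ) : Submodule k (PathBialgebra S) := PathCoalgebra.degree k V n

end PathBialgebra

/-- An isomorphism of quivers: a bijection on vertices together with bijections on arrows
compatible with source and target. -/
structure QuiverIso (V : Type*) [Quiver V] (W : Type*) [Quiver W] where
  /-- the bijection on vertices -/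
  onVertices : V ≃ W
  /-- the bijections on arrows -/
  onArrows : ∀ a b : V, (a ⟶ b) ≃ (onVertices a ⟶ onVertices b)

end

/-!
A coalgebra map `f` from a coalgebra `C` to a path coalgebra `kQ` is determined by its components
of length `0` and `1`, because a path of length `n + 1` is recovered from the component of its
comultiplication in `kQ₁ ⊗ kQₙ` by concatenation (`PathCoalgebra.concat_proj_comul`,
`PathCoalgebra.coalgHom_ext`). Conversely, if `C` is graded, then a pair of maps `f₀ : C₀ → kQ₀`,
`f₁ : C₁ → kQ₁` satisfying the identities `Δf₀ = (f₀ ⊗ f₀)Δ` and `Δf₁ = (f₀ ⊗ f₁ + f₁ ⊗ f₀)Δ`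
extends to a graded coalgebra map (`PathCoalgebra.exists_coalgHom_extending`). Such pairs, called
truncated coalgebra maps here, can be composed, tensored and inverted, so that every construction
with values in `kQ` has to be carried out, and every identity has to be checked, in degrees `0` and
`1` only.

*Existence.* Let `G = gr B`. Since `B` is pointed, `G₀` is spanned by group-like elements, and it
follows that `G₁` is spanned by skew-primitive elements
(`CoalgebraGrading.deg_one_le_span_isSkewPrimitive`). The vertices of `Q` are the group-like
elements, the arrows are a basis of `G₁` consisting of skew-primitive elements, and `G` and `kQ`
become isomorphic in degrees `0` and `1` (`PathCoalgebra.exists_quiver_truncatedIso`). The inverse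
of this truncated isomorphism extends to `Θ : G → kQ`, and the multiplication of `G`, transported to
`kQ` in degrees `0` and `1`, extends to `kQ ⊗ kQ → kQ` (`PathCoalgebra.exists_structure`). The map
`Θ` is injective because the components `Gₙ₊₁ → G₁ ⊗ Gₙ` of the comultiplication are injective,
which is a restatement of the definition of the coradical filtration (`coradicalGr_isStrict`,
`CoalgebraGrading.IsStrict.injective`).

*Uniqueness.* If `Θ' : G → kQ'` is injective with `kQ'₀ ⊕ kQ'₁` in its image, then `Θ'` maps `G₀`
onto `kQ'₀` since both are spanned by group-like elements, and it maps `G₁` into `kQ'₀ ⊕ kQ'₁`.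
Hence the components of `Θ'` of degrees `0` and `1` form a truncated isomorphism, even if `Θ'` is
not graded (`CoalgebraGrading.IsStrict.exists_truncatedIso`). Comparing it with the one of `Θ` gives
an isomorphism `kQ → kQ'` of graded coalgebras, whose multiplicativity is again checked in degrees
`0` and `1` (`PathBialgebra.exists_bialgEquiv_of_embeddings`). The quiver is recovered from `kQ`:
its vertices are the group-like elements, and the arrows from `a` to `b` are a basis of the
skew-primitive elements `x` of degree `1` with `Δ(x) = b ⊗ x + x ⊗ a`
(`PathCoalgebra.nonempty_quiverIso`).
-/

noncomputable section

/-! ### Graded coalgebras -/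

section Gradings

open Coalgebra

variable {k : Type*} [Field k]

/-- The subspace `∑_{i+j=n} Cᵢ ⊗ Dⱼ` of `C ⊗ D`, for families of subspaces of `C` and `D`. -/
def tensorDegree {C D : Type*} [AddCommGroup C] [Module k C] [AddCommGroup D] [Module k D]
    (𝒜 : ℕ → Submodule k C) (ℬ : ℕ → Submodule k D) (n : ℕ) : Submodule k (C ⊗[k] D) :=
  ⨆ p ∈ Finset.HasAntidiagonal.antidiagonal n,
    Submodule.map₂ (TensorProduct.mk k C D) (𝒜 p.1) (ℬ p.2)

lemma tensorDegree_le {C D : Type*} [AddCommGroup C] [Module k C] [AddCommGroup D] [Module k D]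
    {𝒜 : ℕ → Submodule k C} {ℬ : ℕ → Submodule k D} {n : ℕ} {S : Submodule k (C ⊗[k] D)}
    (h : ∀ i j, i + j = n → ∀ a ∈ 𝒜 i, ∀ b ∈ ℬ j, a ⊗ₜ[k] b ∈ S) : tensorDegree 𝒜 ℬ n ≤ S :=
  iSup₂_le fun p hp => Submodule.map₂_le.2 fun a ha b hb =>
    h p.1 p.2 (Finset.HasAntidiagonal.mem_antidiagonal.1 hp) a ha b hb

lemma tmul_mem_tensorDegree {C D : Type*} [AddCommGroup C] [Module k C] [AddCommGroup D]
    [Module k D] {𝒜 : ℕ → Submodule k C} {ℬ : ℕ → Submodule k D} {i j n : ℕ} (h : i + j = n)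
    {a : C} (ha : a ∈ 𝒜 i) {b : D} (hb : b ∈ ℬ j) : a ⊗ₜ[k] b ∈ tensorDegree 𝒜 ℬ n := by
  have hle : Submodule.map₂ (TensorProduct.mk k C D) (𝒜 i) (ℬ j) ≤ tensorDegree 𝒜 ℬ n :=
    le_iSup₂_of_le (f := fun (p : ℕ × ℕ) (_ : p ∈ Finset.HasAntidiagonal.antidiagonal n) =>
      Submodule.map₂ (TensorProduct.mk k C D) (𝒜 p.1) (ℬ p.2)) (i, j)
      (Finset.HasAntidiagonal.mem_antidiagonal.2 h) le_rfl
  exact hle (Submodule.apply_mem_map₂ _ ha hb)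

/-- Two linear maps which agree on the pure tensors `a ⊗ b` of total degree `n` agree on
`∑_{i+j=n} Cᵢ ⊗ Dⱼ`. -/
lemma eq_on_tensorDegree {C D M : Type*} [AddCommGroup C] [Module k C] [AddCommGroup D]
    [Module k D] [AddCommGroup M] [Module k M] {𝒜 : ℕ → Submodule k C} {ℬ : ℕ → Submodule k D}
    {n : ℕ} (f g : C ⊗[k] D →ₗ[k] M)
    (h : ∀ i j, i + j = n → ∀ a ∈ 𝒜 i, ∀ b ∈ ℬ j, f (a ⊗ₜ[k] b) = g (a ⊗ₜ[k] b))
    {z : C ⊗[k] D} (hz : z ∈ tensorDegree 𝒜 ℬ n) : f z = g z :=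
  tensorDegree_le (S := LinearMap.eqLocus f g) h hz

/-- A grading of a coalgebra by `ℕ`: homogeneous components `deg n` together with the projections
onto them, such that `Δ(Cₙ) ⊆ ∑_{i+j=n} Cᵢ ⊗ Cⱼ` and the counit vanishes in positive degrees. -/
structure CoalgebraGrading (k : Type*) (C : Type*) [Field k] [AddCommGroup C] [Module k C]
    [Coalgebra k C] where
  /-- the homogeneous components -/
  deg : ℕ → Submodule k C
  /-- the projections onto the homogeneous components -/
  proj : ℕ → C →ₗ[k] C
  proj_mem : ∀ n x, proj n x ∈ deg n
  proj_of_mem : ∀ {n x}, x ∈ deg n → proj n x = x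
  proj_of_mem_ne : ∀ {m n x}, x ∈ deg m → m ≠ n → proj n x = 0
  iSup_deg : ⨆ n, deg n = ⊤
  comul_mem : ∀ {n x}, x ∈ deg n → comul (R := k) x ∈ tensorDegree deg deg n
  counit_eq_zero : ∀ {n x}, x ∈ deg n → n ≠ 0 → counit (R := k) x = 0

namespace CoalgebraGrading

variable {C D E : Type*} [AddCommGroup C] [Module k C] [Coalgebra k C]
  [AddCommGroup D] [Module k D] [Coalgebra k D] [AddCommGroup E] [Module k E] [Coalgebra k E]
  (𝒢 : CoalgebraGrading k C) (ℋ : CoalgebraGrading k D)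

@[elab_as_elim]
lemma homogeneous_induction {p : C → Prop} (x : C) (hom : ∀ n, ∀ x ∈ 𝒢.deg n, p x) (zero : p 0)
    (add : ∀ x y, p x → p y → p (x + y)) : p x :=
  Submodule.iSup_induction 𝒢.deg (x := x) (by rw [𝒢.iSup_deg]; trivial) hom zero add

lemma linearMap_ext {M : Type*} [AddCommGroup M] [Module k M] {f g : C →ₗ[k] M}
    (h : ∀ n, ∀ x ∈ 𝒢.deg n, f x = g x) : f = g := by
  ext x
  induction x using 𝒢.homogeneous_induction with
  | hom n x hx => exact h n x hx
  | zero => simp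
  | add x y hx hy => rw [map_add, map_add, hx, hy]

lemma proj_proj (n : ℕ) (x : C) : 𝒢.proj n (𝒢.proj n x) = 𝒢.proj n x :=
  𝒢.proj_of_mem (𝒢.proj_mem n x)

lemma proj_proj_ne {m n : ℕ} (h : m ≠ n) (x : C) : 𝒢.proj n (𝒢.proj m x) = 0 :=
  𝒢.proj_of_mem_ne (𝒢.proj_mem m x) h

lemma eventually_proj_eq_zero (x : C) : ∃ N, ∀ n ≥ N, 𝒢.proj n x = 0 := by
  induction x using 𝒢.homogeneous_induction with
  | hom m x hx => exact ⟨m + 1, fun n hn => 𝒢.proj_of_mem_ne hx (by omega)⟩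
  | zero => exact ⟨0, by simp⟩
  | add x y hx hy =>
    obtain ⟨N, hN⟩ := hx
    obtain ⟨M, hM⟩ := hy
    exact ⟨max N M, fun n hn => by
      rw [map_add, hN n (le_trans (le_max_left _ _) hn), hM n (le_trans (le_max_right _ _) hn),
        add_zero]⟩

lemma sum_proj (x : C) : ∃ N, ∀ n ≥ N, ∑ i ∈ Finset.range n, 𝒢.proj i x = x := by
  induction x using 𝒢.homogeneous_induction with
  | hom m x hx =>
    refine ⟨m + 1, fun n hn => ?_⟩
    rw [Finset.sum_eq_single m, 𝒢.proj_of_mem hx]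
    · exact fun i _ hi => 𝒢.proj_of_mem_ne hx hi.symm
    · exact fun h => absurd (Finset.mem_range.2 (by omega)) h
  | zero => exact ⟨0, by simp⟩
  | add x y hx hy =>
    obtain ⟨N, hN⟩ := hx
    obtain ⟨M, hM⟩ := hy
    exact ⟨max N M, fun n hn => by
      simp_rw [map_add]
      rw [Finset.sum_add_distrib, hN n (le_trans (le_max_left _ _) hn),
        hM n (le_trans (le_max_right _ _) hn)]⟩

lemma eq_zero_of_proj_eq_zero {x : C} (h : ∀ n, 𝒢.proj n x = 0) : x = 0 := by
  obtain ⟨N, hN⟩ := 𝒢.sum_proj x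
  rw [← hN N le_rfl]
  exact Finset.sum_eq_zero fun n _ => h n

lemma ext_proj {x y : C} (h : ∀ n, 𝒢.proj n x = 𝒢.proj n y) : x = y :=
  sub_eq_zero.1 (𝒢.eq_zero_of_proj_eq_zero fun n => by rw [map_sub, h, sub_self])

lemma mem_deg_of_proj_ne {n : ℕ} {x : C} (h : ∀ m ≠ n, 𝒢.proj m x = 0) : x ∈ 𝒢.deg n := by
  have : x = 𝒢.proj n x := 𝒢.ext_proj fun m => by
    by_cases hm : m = n
    · rw [hm, 𝒢.proj_proj]
    · rw [h m hm, 𝒢.proj_proj_ne (Ne.symm hm)]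
  rw [this]
  exact 𝒢.proj_mem n x

lemma eq_proj_zero_add_proj_one {x : C} (h : ∀ n ≥ 2, 𝒢.proj n x = 0) :
    x = 𝒢.proj 0 x + 𝒢.proj 1 x := by
  refine 𝒢.ext_proj fun n => ?_
  rw [map_add]
  match n with
  | 0 => rw [𝒢.proj_proj, 𝒢.proj_proj_ne one_ne_zero, add_zero]
  | 1 => rw [𝒢.proj_proj, 𝒢.proj_proj_ne zero_ne_one, zero_add]
  | n + 2 => rw [h _ (by omega), 𝒢.proj_proj_ne (by omega), 𝒢.proj_proj_ne (by omega), add_zero]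

section Supported

variable {M N : Type*} [AddCommGroup M] [Module k M] [AddCommGroup N] [Module k N]

/-- A linear map is concentrated in degree `n` if it vanishes on the components of any other
degree. -/
def IsConcentrated (n : ℕ) (f : C →ₗ[k] M) : Prop := ∀ x, f (𝒢.proj n x) = f x

lemma isConcentrated_proj (n : ℕ) : 𝒢.IsConcentrated n (𝒢.proj n) := 𝒢.proj_proj n

variable {𝒢}

lemma isConcentrated_iff {n : ℕ} {f : C →ₗ[k] M} :
    𝒢.IsConcentrated n f ↔ ∀ m ≠ n, ∀ x ∈ 𝒢.deg m, f x = 0 := by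
  constructor
  · intro h m hm x hx
    rw [← h x, 𝒢.proj_of_mem_ne hx hm, map_zero]
  · intro h x
    induction x using 𝒢.homogeneous_induction with
    | hom m x hx =>
      by_cases hm : m = n
      · rw [𝒢.proj_of_mem (hm ▸ hx)]
      · rw [𝒢.proj_of_mem_ne hx hm, h m hm x hx, map_zero]
    | zero => simp
    | add x y hx hy => simp only [map_add, hx, hy]

lemma IsConcentrated.eq_zero {n : ℕ} {f : C →ₗ[k] M} (hf : 𝒢.IsConcentrated n f) {m : ℕ}
    (hm : m ≠ n) {x : C} (hx : x ∈ 𝒢.deg m) : f x = 0 :=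
  isConcentrated_iff.1 hf m hm x hx

lemma IsConcentrated.comp {n : ℕ} {f : C →ₗ[k] M} (hf : 𝒢.IsConcentrated n f) (g : M →ₗ[k] N) :
    𝒢.IsConcentrated n (g ∘ₗ f) := fun x => congrArg g (hf x)

lemma IsConcentrated.map_comul_eq_zero {i j n : ℕ} {f : C →ₗ[k] M} {g : C →ₗ[k] N}
    (hf : 𝒢.IsConcentrated i f) (hg : 𝒢.IsConcentrated j g) (hn : i + j ≠ n) {x : C}
    (hx : x ∈ 𝒢.deg n) : TensorProduct.map f g (comul (R := k) x) = 0 := by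
  refine eq_on_tensorDegree (TensorProduct.map f g) 0 (fun p q hpq a ha b hb => ?_)
    (𝒢.comul_mem hx)
  rw [TensorProduct.map_tmul, LinearMap.zero_apply]
  by_cases hp : p = i
  · rw [hg.eq_zero (show q ≠ j by omega) hb, TensorProduct.tmul_zero]
  · rw [hf.eq_zero hp ha, TensorProduct.zero_tmul]

lemma IsConcentrated.map_comul {i j n : ℕ} {f : C →ₗ[k] M} {g : C →ₗ[k] N}
    (hf : 𝒢.IsConcentrated i f) (hg : 𝒢.IsConcentrated j g) (hn : i + j = n) :
    𝒢.IsConcentrated n (TensorProduct.map f g ∘ₗ comul (R := k)) :=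
  isConcentrated_iff.2 fun _ hm _ hx =>
    hf.map_comul_eq_zero hg (fun h => hm (by rw [← h, hn])) hx

lemma IsConcentrated.map_comul_proj {i j : ℕ} {f : C →ₗ[k] M} {g : C →ₗ[k] N}
    (hf : 𝒢.IsConcentrated i f) (hg : 𝒢.IsConcentrated j g) (x : C) :
    TensorProduct.map f g (comul (R := k) (𝒢.proj (i + j) x)) =
      TensorProduct.map f g (comul (R := k) x) :=
  hf.map_comul hg rfl x

/-- To compare two maps concentrated in degree `n` it suffices to do so on the component of
degree `n`. -/
lemma IsConcentrated.ext {n : ℕ} {f g : C →ₗ[k] M} (hf : 𝒢.IsConcentrated n f)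
    (hg : 𝒢.IsConcentrated n g) (h : ∀ x ∈ 𝒢.deg n, f x = g x) : f = g :=
  LinearMap.ext fun x => by rw [← hf x, ← hg x, h _ (𝒢.proj_mem n x)]

end Supported

lemma comul_eq_sum {n : ℕ} {x : C} (hx : x ∈ 𝒢.deg n) :
    comul (R := k) x = ∑ p ∈ Finset.HasAntidiagonal.antidiagonal n,
      TensorProduct.map (𝒢.proj p.1) (𝒢.proj p.2) (comul (R := k) x) := by
  rw [← LinearMap.sum_apply]
  refine eq_on_tensorDegree LinearMap.id _ (fun i j hij a ha b hb => ?_) (𝒢.comul_mem hx)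
  rw [LinearMap.sum_apply, Finset.sum_eq_single (i, j)]
  · simp [𝒢.proj_of_mem ha, 𝒢.proj_of_mem hb]
  · rintro ⟨p, q⟩ hpq hne
    rw [Finset.HasAntidiagonal.mem_antidiagonal] at hpq
    simp only at hpq
    rw [TensorProduct.map_tmul]
    by_cases hp : i = p
    · exact absurd (Prod.ext hp.symm (by simp; omega)) hne
    · simp [𝒢.proj_of_mem_ne ha hp]
  · exact fun h => absurd (Finset.HasAntidiagonal.mem_antidiagonal.2 hij) h

lemma comul_proj_zero (x : C) : comul (R := k) (𝒢.proj 0 x) =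
    TensorProduct.map (𝒢.proj 0) (𝒢.proj 0) (comul (R := k) x) := by
  rw [𝒢.comul_eq_sum (𝒢.proj_mem 0 x)]
  simpa using (𝒢.isConcentrated_proj 0).map_comul_proj (𝒢.isConcentrated_proj 0) x

lemma comul_proj_one (x : C) : comul (R := k) (𝒢.proj 1 x) =
    TensorProduct.map (𝒢.proj 0) (𝒢.proj 1) (comul (R := k) x) +
      TensorProduct.map (𝒢.proj 1) (𝒢.proj 0) (comul (R := k) x) := by
  have h : Finset.HasAntidiagonal.antidiagonal 1 = {(0, 1), (1, 0)} := rfl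
  rw [𝒢.comul_eq_sum (𝒢.proj_mem 1 x), h, Finset.sum_pair (by simp)]
  exact congrArg₂ _ ((𝒢.isConcentrated_proj 0).map_comul_proj (𝒢.isConcentrated_proj 1) x)
    ((𝒢.isConcentrated_proj 1).map_comul_proj (𝒢.isConcentrated_proj 0) x)

lemma counit_proj_zero (x : C) : counit (R := k) (𝒢.proj 0 x) = counit (R := k) x :=
  isConcentrated_iff.2 (fun _ hm _ hx => 𝒢.counit_eq_zero hx hm) x

/-- Linear maps given on the homogeneous components glue to a linear map. -/
lemma exists_linearMap_of_isConcentrated {M : Type*} [AddCommGroup M] [Module k M]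
    (f : ℕ → C →ₗ[k] M) (hf : ∀ n, 𝒢.IsConcentrated n (f n)) :
    ∃ g : C →ₗ[k] M, ∀ n, ∀ x ∈ 𝒢.deg n, g x = f n x := by
  have hfin : ∀ x, (Function.support fun n => f n x).Finite := fun x => by
    obtain ⟨N, hN⟩ := 𝒢.eventually_proj_eq_zero x
    refine (Set.finite_lt_nat N).subset fun n hn => ?_
    by_contra h
    exact hn (by simp only [← hf n x, hN n (not_lt.1 h), map_zero])
  refine ⟨{ toFun := fun x => ∑ᶠ n, f n x, map_add' := fun x y => ?_, map_smul' := fun c x => ?_ },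
    fun n x hx => ?_⟩
  · simp only [map_add]
    exact finsum_add_distrib (hfin x) (hfin y)
  · simp only [map_smul, RingHom.id_apply]
    exact (smul_finsum' c (hfin x)).symm
  · exact finsum_eq_single _ n fun m hm => (hf m).eq_zero hm.symm hx

/-- A linear map respects the gradings. -/
def IsGraded (f : C →ₗ[k] D) : Prop := ∀ n, ∀ x ∈ 𝒢.deg n, f x ∈ ℋ.deg n

variable {𝒢 ℋ}

lemma IsGraded.proj_comm {f : C →ₗ[k] D} (hf : IsGraded 𝒢 ℋ f) (n : ℕ) (x : C) :
    ℋ.proj n (f x) = f (𝒢.proj n x) := by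
  induction x using 𝒢.homogeneous_induction with
  | hom m x hx =>
    by_cases hm : m = n
    · subst hm
      rw [𝒢.proj_of_mem hx, ℋ.proj_of_mem (hf m x hx)]
    · rw [𝒢.proj_of_mem_ne hx hm, ℋ.proj_of_mem_ne (hf m x hx) hm, map_zero]
  | zero => simp
  | add x y hx hy => simp only [map_add, hx, hy]

/-- The components `Cₙ₊₁ → C₁ ⊗ Cₙ` of the comultiplication are injective. When `C₀` is the
coradical, this says that the coradical filtration is `C₀ ⊕ ⋯ ⊕ Cₙ`. -/
def IsStrict (𝒢 : CoalgebraGrading k C) : Prop :=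
  ∀ n, ∀ x ∈ 𝒢.deg (n + 1),
    TensorProduct.map (𝒢.proj 1) (𝒢.proj n) (comul (R := k) x) = 0 → x = 0

/-- A graded coalgebra map `f` out of a strictly graded coalgebra is injective as soon as it is
injective in degrees `0` and `1`: if `f` vanishes at `x` of degree `n + 1`, then `f ⊗ f` vanishes at
the component of `Δ(x)` in `C₁ ⊗ Cₙ`. -/
lemma IsStrict.injective (h𝒢 : 𝒢.IsStrict) (f : C →ₗc[k] D) (hf : IsGraded 𝒢 ℋ (f : C →ₗ[k] D))
    (h0 : ∀ x ∈ 𝒢.deg 0, f x = 0 → x = 0) (h1 : ∀ x ∈ 𝒢.deg 1, f x = 0 → x = 0) :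
    Function.Injective f := by
  have key : ∀ n, ∀ x ∈ 𝒢.deg n, f x = 0 → x = 0 := by
    have hinv : ∀ n, (∀ x ∈ 𝒢.deg n, f x = 0 → x = 0) →
        ∃ l : D →ₗ[k] C, ∀ x, l (f (𝒢.proj n x)) = 𝒢.proj n x := fun n hn =>
      exists_linearMap_comp_eq ((f : C →ₗ[k] D) ∘ₗ 𝒢.proj n) (𝒢.proj n)
        fun x hx => hn _ (𝒢.proj_mem n x) hx
    intro n
    induction n with
    | zero => exact h0
    | succ n ih =>
      intro x hx hfx
      obtain ⟨l₁, hl₁⟩ := hinv 1 h1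
      obtain ⟨l, hl⟩ := hinv n ih
      refine h𝒢 n x hx ?_
      have e₁ : 𝒢.proj 1 = l₁ ∘ₗ ℋ.proj 1 ∘ₗ (f : C →ₗ[k] D) := by
        ext y
        exact ((congrArg l₁ (hf.proj_comm 1 y)).trans (hl₁ y)).symm
      have e : 𝒢.proj n = l ∘ₗ ℋ.proj n ∘ₗ (f : C →ₗ[k] D) := by
        ext y
        exact ((congrArg l (hf.proj_comm n y)).trans (hl y)).symm
      rw [e₁, e, TensorProduct.map_comp, TensorProduct.map_comp, LinearMap.comp_apply,
        LinearMap.comp_apply, CoalgHomClass.map_comp_comul_apply, hfx]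
      simp
  refine (injective_iff_map_eq_zero f).2 fun x hx => 𝒢.eq_zero_of_proj_eq_zero fun n => ?_
  refine key n _ (𝒢.proj_mem n x) ?_
  have := hf.proj_comm n x
  rw [CoalgHom.coe_toLinearMap, hx, map_zero] at this
  exact this.symm

/-- Group-like elements of a graded coalgebra are homogeneous of degree zero: if `gₙ` is the
component of highest degree of `g`, then `gₙ ⊗ gₙ` is a component of `Δ(g₂ₙ)`. -/
lemma mem_deg_zero_of_isGroupLikeElem (𝒢 : CoalgebraGrading k C) {g : C}
    (hg : IsGroupLikeElem k g) : g ∈ 𝒢.deg 0 := by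
  have key : ∀ d n, n ≠ 0 → (∀ m ≥ n + d, 𝒢.proj m g = 0) → 𝒢.proj n g = 0 := by
    intro d
    induction d using Nat.strong_induction_on with
    | _ d ih =>
      intro n hn hd
      rcases Nat.eq_zero_or_pos d with rfl | hd0
      · exact hd n (by omega)
      · have h2 : 𝒢.proj (n + n) g = 0 :=
          ih (d - n) (by omega) (n + n) (by omega) fun m hm => hd m (by omega)
        have h := (𝒢.isConcentrated_proj n).map_comul_proj (𝒢.isConcentrated_proj n) g
        rw [h2, map_zero, map_zero, hg.comul_eq_tmul_self, TensorProduct.map_tmul] at h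
        refine (Module.forall_dual_apply_eq_zero_iff k _).1 fun φ => ?_
        have h' := congrArg (fun z => TensorProduct.lid k k (TensorProduct.map φ φ z)) h.symm
        simpa using h'
  obtain ⟨N, hN⟩ := 𝒢.eventually_proj_eq_zero g
  exact 𝒢.mem_deg_of_proj_ne fun m hm => key N m hm fun l hl => hN l (by omega)

end CoalgebraGrading

end Gradings

/-! ### Tensor products of gradings and truncated coalgebra maps -/

section Truncated

open Coalgebra

variable {k : Type*} [Field k]

namespace CoalgebraGrading

variable {C D E : Type*} [AddCommGroup C] [Module k C] [Coalgebra k C]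
  [AddCommGroup D] [Module k D] [Coalgebra k D] [AddCommGroup E] [Module k E] [Coalgebra k E]

lemma comul_mem_tensorDegree_tmul (𝒢 : CoalgebraGrading k C) (ℋ : CoalgebraGrading k D)
    {i j n : ℕ} (hn : i + j = n) {x : C} (hx : x ∈ 𝒢.deg i) {y : D} (hy : y ∈ ℋ.deg j) :
    comul (R := k) (x ⊗ₜ[k] y) ∈
      tensorDegree (tensorDegree 𝒢.deg ℋ.deg) (tensorDegree 𝒢.deg ℋ.deg) n := by
  rw [TensorProduct.comul_tmul]
  have h1 : ∀ a b c d, a + b = i → c + d = j → ∀ p ∈ 𝒢.deg a, ∀ q ∈ 𝒢.deg b, ∀ r ∈ ℋ.deg c,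
      ∀ s ∈ ℋ.deg d, TensorProduct.AlgebraTensorModule.tensorTensorTensorComm k k k k C C D D
        ((p ⊗ₜ[k] q) ⊗ₜ[k] (r ⊗ₜ[k] s)) ∈
          tensorDegree (tensorDegree 𝒢.deg ℋ.deg) (tensorDegree 𝒢.deg ℋ.deg) n := by
    intro a b c d hab hcd p hp q hq r hr s hs
    rw [TensorProduct.AlgebraTensorModule.tensorTensorTensorComm_tmul]
    exact tmul_mem_tensorDegree (i := a + c) (j := b + d) (by omega)
      (tmul_mem_tensorDegree rfl hp hr) (tmul_mem_tensorDegree rfl hq hs)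
  let T := (TensorProduct.AlgebraTensorModule.tensorTensorTensorComm k k k k C C D D).toLinearMap
  have h2 : ∀ z ∈ tensorDegree 𝒢.deg 𝒢.deg i, ∀ w ∈ tensorDegree ℋ.deg ℋ.deg j,
      T (z ⊗ₜ[k] w) ∈
        tensorDegree (tensorDegree 𝒢.deg ℋ.deg) (tensorDegree 𝒢.deg ℋ.deg) n := by
    intro z hz w hw
    have : tensorDegree 𝒢.deg 𝒢.deg i ≤ (tensorDegree (tensorDegree 𝒢.deg ℋ.deg)
        (tensorDegree 𝒢.deg ℋ.deg) n).comap (T ∘ₗ (TensorProduct.mk k _ _).flip w) := by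
      refine tensorDegree_le fun a b hab p hp q hq => ?_
      have : tensorDegree ℋ.deg ℋ.deg j ≤ (tensorDegree (tensorDegree 𝒢.deg ℋ.deg)
          (tensorDegree 𝒢.deg ℋ.deg) n).comap (T ∘ₗ TensorProduct.mk k _ _ (p ⊗ₜ[k] q)) :=
        tensorDegree_le fun c d hcd r hr s hs => h1 a b c d hab hcd p hp q hq r hr s hs
      exact this hw
    exact this hz
  exact h2 _ (𝒢.comul_mem hx) _ (ℋ.comul_mem hy)

/-- The total grading of a tensor product of graded coalgebras. -/
def tensor (𝒢 : CoalgebraGrading k C) (ℋ : CoalgebraGrading k D) :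
    CoalgebraGrading k (C ⊗[k] D) where
  deg := tensorDegree 𝒢.deg ℋ.deg
  proj n := ∑ p ∈ Finset.HasAntidiagonal.antidiagonal n,
    TensorProduct.map (𝒢.proj p.1) (ℋ.proj p.2)
  proj_mem n x := by
    induction x with
    | zero => simp
    | add x y hx hy => rw [map_add]; exact add_mem hx hy
    | tmul x y =>
      rw [LinearMap.sum_apply]
      exact sum_mem fun p hp => tmul_mem_tensorDegree
        (Finset.HasAntidiagonal.mem_antidiagonal.1 hp) (𝒢.proj_mem _ _) (ℋ.proj_mem _ _)
  proj_of_mem {n x} hx := by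
    refine eq_on_tensorDegree _ LinearMap.id (fun i j hij a ha b hb => ?_) hx
    rw [LinearMap.sum_apply, Finset.sum_eq_single (i, j)]
    · simp [𝒢.proj_of_mem ha, ℋ.proj_of_mem hb]
    · rintro ⟨p, q⟩ hpq hne
      rw [Finset.HasAntidiagonal.mem_antidiagonal] at hpq
      simp only at hpq
      rw [TensorProduct.map_tmul]
      by_cases hp : i = p
      · exact absurd (Prod.ext hp.symm (by simp; omega)) hne
      · simp [𝒢.proj_of_mem_ne ha hp]
    · exact fun h => absurd (Finset.HasAntidiagonal.mem_antidiagonal.2 hij) h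
  proj_of_mem_ne {m n x} hx hmn := by
    refine eq_on_tensorDegree _ 0 (fun i j hij a ha b hb => ?_) hx
    rw [LinearMap.sum_apply, LinearMap.zero_apply]
    refine Finset.sum_eq_zero fun p hp => ?_
    rw [Finset.HasAntidiagonal.mem_antidiagonal] at hp
    rw [TensorProduct.map_tmul]
    by_cases h : i = p.1
    · rw [ℋ.proj_of_mem_ne hb (show j ≠ p.2 by omega), TensorProduct.tmul_zero]
    · rw [𝒢.proj_of_mem_ne ha h, TensorProduct.zero_tmul]
  iSup_deg := by
    refine eq_top_iff.2 fun z _ => ?_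
    clear * -
    induction z with
    | zero => exact zero_mem _
    | add x y hx hy => exact add_mem hx hy
    | tmul x y =>
      induction x using 𝒢.homogeneous_induction with
      | zero => rw [TensorProduct.zero_tmul]; exact zero_mem _
      | add x x' hx hx' => rw [TensorProduct.add_tmul]; exact add_mem hx hx'
      | hom i x hx =>
        induction y using ℋ.homogeneous_induction with
        | zero => rw [TensorProduct.tmul_zero]; exact zero_mem _
        | add y y' hy hy' => rw [TensorProduct.tmul_add]; exact add_mem hy hy'
        | hom j y hy =>
          exact Submodule.mem_iSup_of_mem (i + j) (tmul_mem_tensorDegree rfl hx hy)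
  comul_mem {n x} hx := by
    have : tensorDegree 𝒢.deg ℋ.deg n ≤ (tensorDegree (tensorDegree 𝒢.deg ℋ.deg)
        (tensorDegree 𝒢.deg ℋ.deg) n).comap (comul (R := k) (A := C ⊗[k] D)) :=
      tensorDegree_le fun i j hij a ha b hb => comul_mem_tensorDegree_tmul 𝒢 ℋ hij ha hb
    exact this hx
  counit_eq_zero {n x} hx hn := by
    refine eq_on_tensorDegree (counit (R := k) (A := C ⊗[k] D)) 0
      (fun i j hij a ha b hb => ?_) hx
    rw [TensorProduct.counit_tmul, LinearMap.zero_apply]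
    by_cases h : i = 0
    · rw [ℋ.counit_eq_zero hb (show j ≠ 0 by omega), zero_smul]
    · rw [𝒢.counit_eq_zero ha h, smul_zero]

lemma tmul_mem_tensor (𝒢 : CoalgebraGrading k C) (ℋ : CoalgebraGrading k D) {i j n : ℕ}
    (h : i + j = n) {x : C} (hx : x ∈ 𝒢.deg i) {y : D} (hy : y ∈ ℋ.deg j) :
    x ⊗ₜ[k] y ∈ (𝒢.tensor ℋ).deg n :=
  tmul_mem_tensorDegree h hx hy

lemma tensor_proj_zero_tmul (𝒢 : CoalgebraGrading k C) (ℋ : CoalgebraGrading k D) (x : C) (y : D) :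
    (𝒢.tensor ℋ).proj 0 (x ⊗ₜ[k] y) = 𝒢.proj 0 x ⊗ₜ[k] ℋ.proj 0 y := by
  simp [tensor]

lemma tensor_proj_one_tmul (𝒢 : CoalgebraGrading k C) (ℋ : CoalgebraGrading k D) (x : C) (y : D) :
    (𝒢.tensor ℋ).proj 1 (x ⊗ₜ[k] y) =
      𝒢.proj 0 x ⊗ₜ[k] ℋ.proj 1 y + 𝒢.proj 1 x ⊗ₜ[k] ℋ.proj 0 y := by
  have h : Finset.HasAntidiagonal.antidiagonal 1 = {(0, 1), (1, 0)} := rfl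
  simp [tensor, h]

/-- A pair of linear maps `f₀ : C₀ → D₀`, `f₁ : C₁ → D₁` (extended by zero to all of `C`) which
satisfies the identities of the components of degrees `0` and `1` of a graded coalgebra map. -/
structure IsTruncatedHom (𝒢 : CoalgebraGrading k C) (ℋ : CoalgebraGrading k D)
    (f₀ f₁ : C →ₗ[k] D) : Prop where
  conc_zero : 𝒢.IsConcentrated 0 f₀
  conc_one : 𝒢.IsConcentrated 1 f₁
  mem_zero : ∀ x, f₀ x ∈ ℋ.deg 0
  mem_one : ∀ x, f₁ x ∈ ℋ.deg 1
  counit_zero : ∀ x, counit (R := k) (f₀ x) = counit (R := k) x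
  comul_zero : ∀ x, comul (R := k) (f₀ x) = TensorProduct.map f₀ f₀ (comul (R := k) x)
  comul_one : ∀ x, comul (R := k) (f₁ x) = TensorProduct.map f₀ f₁ (comul (R := k) x) +
    TensorProduct.map f₁ f₀ (comul (R := k) x)

namespace IsTruncatedHom

variable {𝒢 : CoalgebraGrading k C} {ℋ : CoalgebraGrading k D} {𝒦 : CoalgebraGrading k E}
  {f₀ f₁ : C →ₗ[k] D}

lemma of_isGraded {f : C →ₗc[k] D} (hf : IsGraded 𝒢 ℋ (f : C →ₗ[k] D)) :
    IsTruncatedHom 𝒢 ℋ ((f : C →ₗ[k] D) ∘ₗ 𝒢.proj 0) ((f : C →ₗ[k] D) ∘ₗ 𝒢.proj 1) where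
  conc_zero := (𝒢.isConcentrated_proj 0).comp _
  conc_one := (𝒢.isConcentrated_proj 1).comp _
  mem_zero x := hf 0 _ (𝒢.proj_mem 0 x)
  mem_one x := hf 1 _ (𝒢.proj_mem 1 x)
  counit_zero x := (CoalgHomClass.counit_comp_apply f _).trans (𝒢.counit_proj_zero x)
  comul_zero x := by
    rw [← TensorProduct.map_map, ← 𝒢.comul_proj_zero]
    exact (CoalgHomClass.map_comp_comul_apply f _).symm
  comul_one x := by
    rw [← TensorProduct.map_map, ← TensorProduct.map_map, ← map_add, ← 𝒢.comul_proj_one]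
    exact (CoalgHomClass.map_comp_comul_apply f _).symm

lemma comp {g₀ g₁ : D →ₗ[k] E} (hg : IsTruncatedHom ℋ 𝒦 g₀ g₁) (hf : IsTruncatedHom 𝒢 ℋ f₀ f₁) :
    IsTruncatedHom 𝒢 𝒦 (g₀ ∘ₗ f₀) (g₁ ∘ₗ f₁) where
  conc_zero := hf.conc_zero.comp _
  conc_one := hf.conc_one.comp _
  mem_zero x := hg.mem_zero _
  mem_one x := hg.mem_one _
  counit_zero x := (hg.counit_zero _).trans (hf.counit_zero x)
  comul_zero x := by
    rw [LinearMap.comp_apply, hg.comul_zero, hf.comul_zero, TensorProduct.map_map]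
  comul_one x := by
    have h₀₁ : g₀ ∘ₗ f₁ = 0 :=
      LinearMap.ext fun y => hg.conc_zero.eq_zero one_ne_zero (hf.mem_one y)
    have h₁₀ : g₁ ∘ₗ f₀ = 0 :=
      LinearMap.ext fun y => hg.conc_one.eq_zero zero_ne_one (hf.mem_zero y)
    rw [LinearMap.comp_apply, hg.comul_one, hf.comul_one, map_add, map_add]
    simp [TensorProduct.map_map, h₀₁, h₁₀]

/-- The inverse of a truncated coalgebra map which is bijective in degrees `0` and `1`. -/
lemma inverse (hf : IsTruncatedHom 𝒢 ℋ f₀ f₁) {g₀ g₁ : D →ₗ[k] C}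
    (hg₀ : ℋ.IsConcentrated 0 g₀) (hg₁ : ℋ.IsConcentrated 1 g₁)
    (hm₀ : ∀ y, g₀ y ∈ 𝒢.deg 0) (hm₁ : ∀ y, g₁ y ∈ 𝒢.deg 1)
    (hgf₀ : ∀ x, g₀ (f₀ x) = 𝒢.proj 0 x) (hgf₁ : ∀ x, g₁ (f₁ x) = 𝒢.proj 1 x)
    (hfg₀ : ∀ y, f₀ (g₀ y) = ℋ.proj 0 y) (hfg₁ : ∀ y, f₁ (g₁ y) = ℋ.proj 1 y) :
    IsTruncatedHom ℋ 𝒢 g₀ g₁ where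
  conc_zero := hg₀
  conc_one := hg₁
  mem_zero := hm₀
  mem_one := hm₁
  counit_zero y := by rw [← hf.counit_zero, hfg₀, ℋ.counit_proj_zero]
  comul_zero y := by
    have h : g₀ ∘ₗ f₀ = 𝒢.proj 0 := LinearMap.ext hgf₀
    rw [← hg₀.map_comul_proj hg₀, ← hfg₀, hf.comul_zero, TensorProduct.map_map, h,
      ← 𝒢.comul_proj_zero, 𝒢.proj_of_mem (hm₀ y)]
  comul_one y := by
    have h₀ : g₀ ∘ₗ f₀ = 𝒢.proj 0 := LinearMap.ext hgf₀
    have h₁ : g₁ ∘ₗ f₁ = 𝒢.proj 1 := LinearMap.ext hgf₁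
    have h₀₁ : g₀ ∘ₗ f₁ = 0 :=
      LinearMap.ext fun y => hg₀.eq_zero one_ne_zero (hf.mem_one y)
    have h₁₀ : g₁ ∘ₗ f₀ = 0 :=
      LinearMap.ext fun y => hg₁.eq_zero zero_ne_one (hf.mem_zero y)
    rw [← hg₀.map_comul_proj hg₁, ← hg₁.map_comul_proj hg₀]
    simp only [Nat.add_zero, Nat.zero_add]
    rw [← hfg₁, hf.comul_one, map_add, map_add]
    simp only [TensorProduct.map_map, h₀, h₁, h₀₁, h₁₀,
      TensorProduct.map_zero_right, LinearMap.zero_apply, add_zero, zero_add]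
    rw [← 𝒢.comul_proj_one, 𝒢.proj_of_mem (hm₁ y)]

end IsTruncatedHom

lemma tensorTensorTensorComm_map {C₁ C₂ C₃ C₄ D₁ D₂ D₃ D₄ : Type*}
    [AddCommGroup C₁] [Module k C₁] [AddCommGroup C₂] [Module k C₂]
    [AddCommGroup C₃] [Module k C₃] [AddCommGroup C₄] [Module k C₄]
    [AddCommGroup D₁] [Module k D₁] [AddCommGroup D₂] [Module k D₂]
    [AddCommGroup D₃] [Module k D₃] [AddCommGroup D₄] [Module k D₄]
    (a : C₁ →ₗ[k] D₁) (b : C₂ →ₗ[k] D₂) (c : C₃ →ₗ[k] D₃) (d : C₄ →ₗ[k] D₄)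
    (z : C₁ ⊗[k] C₂) (w : C₃ ⊗[k] C₄) :
    TensorProduct.AlgebraTensorModule.tensorTensorTensorComm k k k k D₁ D₂ D₃ D₄
        (TensorProduct.map a b z ⊗ₜ[k] TensorProduct.map c d w) =
      TensorProduct.map (TensorProduct.map a c) (TensorProduct.map b d)
        (TensorProduct.AlgebraTensorModule.tensorTensorTensorComm k k k k C₁ C₂ C₃ C₄
          (z ⊗ₜ[k] w)) := by
  induction z with
  | zero => simp
  | add z z' hz hz' => simp only [map_add, TensorProduct.add_tmul, hz, hz']
  | tmul x y =>
    induction w with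
    | zero => simp
    | add w w' hw hw' => simp only [map_add, TensorProduct.tmul_add, hw, hw']
    | tmul x' y' => simp

lemma IsTruncatedHom.tensor {C' D' : Type*} [AddCommGroup C'] [Module k C'] [Coalgebra k C']
    [AddCommGroup D'] [Module k D'] [Coalgebra k D']
    {𝒢 : CoalgebraGrading k C} {ℋ : CoalgebraGrading k D}
    {𝒢' : CoalgebraGrading k C'} {ℋ' : CoalgebraGrading k D'} {f₀ f₁ : C →ₗ[k] D}
    {g₀ g₁ : C' →ₗ[k] D'} (hf : IsTruncatedHom 𝒢 ℋ f₀ f₁) (hg : IsTruncatedHom 𝒢' ℋ' g₀ g₁) :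
    IsTruncatedHom (𝒢.tensor 𝒢') (ℋ.tensor ℋ') (TensorProduct.map f₀ g₀)
      (TensorProduct.map f₀ g₁ + TensorProduct.map f₁ g₀) where
  conc_zero z := by
    induction z with
    | zero => simp
    | add x y hx hy => simp only [map_add, hx, hy]
    | tmul x y =>
      rw [tensor_proj_zero_tmul, TensorProduct.map_tmul, hf.conc_zero, hg.conc_zero,
        TensorProduct.map_tmul]
  conc_one z := by
    induction z with
    | zero => simp
    | add x y hx hy => simp only [map_add, hx, hy]
    | tmul x y =>
      rw [tensor_proj_one_tmul]
      simp only [LinearMap.add_apply, map_add, TensorProduct.map_tmul, hf.conc_zero _,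
        hg.conc_zero _, hf.conc_one _, hg.conc_one _,
        hf.conc_zero.eq_zero one_ne_zero (𝒢.proj_mem 1 x),
        hg.conc_zero.eq_zero one_ne_zero (𝒢'.proj_mem 1 y), TensorProduct.zero_tmul,
        TensorProduct.tmul_zero, add_zero, zero_add]
  mem_zero z := by
    induction z with
    | zero => simp
    | add x y hx hy => rw [map_add]; exact add_mem hx hy
    | tmul x y => exact tmul_mem_tensor ℋ ℋ' (add_zero 0) (hf.mem_zero x) (hg.mem_zero y)
  mem_one z := by
    induction z with
    | zero => simp
    | add x y hx hy => rw [map_add]; exact add_mem hx hy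
    | tmul x y =>
      rw [LinearMap.add_apply, TensorProduct.map_tmul, TensorProduct.map_tmul]
      exact add_mem (tmul_mem_tensor ℋ ℋ' (zero_add 1) (hf.mem_zero x) (hg.mem_one y))
        (tmul_mem_tensor ℋ ℋ' (add_zero 1) (hf.mem_one x) (hg.mem_zero y))
  counit_zero z := by
    induction z with
    | zero => simp
    | add x y hx hy => simp only [map_add, hx, hy]
    | tmul x y =>
      rw [TensorProduct.map_tmul, TensorProduct.counit_tmul, TensorProduct.counit_tmul,
        hf.counit_zero, hg.counit_zero]
  comul_zero z := by
    induction z with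
    | zero => simp
    | add x y hx hy => simp only [map_add, hx, hy]
    | tmul x y =>
      rw [TensorProduct.map_tmul, TensorProduct.comul_tmul, TensorProduct.comul_tmul,
        hf.comul_zero, hg.comul_zero, tensorTensorTensorComm_map]
  comul_one z := by
    induction z with
    | zero => simp
    | add x y hx hy => simp only [map_add, hx, hy]; abel
    | tmul x y =>
      simp only [LinearMap.add_apply, TensorProduct.map_tmul, map_add, TensorProduct.comul_tmul,
        hf.comul_zero, hg.comul_zero, hf.comul_one, hg.comul_one, TensorProduct.add_tmul,
        TensorProduct.tmul_add, tensorTensorTensorComm_map, TensorProduct.map_add_left,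
        TensorProduct.map_add_right]
      abel

/-- A linear map which is bijective between the components of degree `n` has an inverse there. -/
lemma exists_inverse_of_bijective (𝒢 : CoalgebraGrading k C) (ℋ : CoalgebraGrading k D) (n : ℕ)
    (f : C →ₗ[k] D) (hinj : ∀ x ∈ 𝒢.deg n, f x = 0 → x = 0)
    (hsurj : ∀ y ∈ ℋ.deg n, ∃ x ∈ 𝒢.deg n, f x = y) :
    ∃ g : D →ₗ[k] C, ℋ.IsConcentrated n g ∧ (∀ y, g y ∈ 𝒢.deg n) ∧
      (∀ x ∈ 𝒢.deg n, f x ∈ ℋ.deg n → g (f x) = x) ∧ ∀ y, f (g y) = ℋ.proj n y := by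
  obtain ⟨l, hl⟩ := exists_linearMap_comp_eq (f ∘ₗ 𝒢.proj n) (𝒢.proj n)
    fun x hx => hinj _ (𝒢.proj_mem n x) hx
  have hl' : ∀ x ∈ 𝒢.deg n, l (f x) = x := fun x hx => by
    have := hl x
    rwa [LinearMap.comp_apply, 𝒢.proj_of_mem hx] at this
  refine ⟨l ∘ₗ ℋ.proj n, (ℋ.isConcentrated_proj n).comp l, fun y => ?_, fun x hx hfx => ?_,
    fun y => ?_⟩
  · obtain ⟨x, hx, hxy⟩ := hsurj _ (ℋ.proj_mem n y)
    rw [LinearMap.comp_apply, ← hxy, hl' x hx]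
    exact hx
  · rw [LinearMap.comp_apply, ℋ.proj_of_mem hfx, hl' x hx]
  · obtain ⟨x, hx, hxy⟩ := hsurj _ (ℋ.proj_mem n y)
    rw [LinearMap.comp_apply, ← hxy, hl' x hx]

end CoalgebraGrading

end Truncated

/-! ### The length grading and concatenation of paths -/

namespace PathCoalgebra

open Coalgebra CoalgebraGrading

variable (k : Type u) [Field k] {V : Type w₁} [Quiver.{w₂} V]

lemma length_add_length_of_mem_pathSplits {a b : V} (p : Quiver.Path a b) :
    ∀ s ∈ pathSplits p, s.2.1.length + s.2.2.length = p.length := by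
  induction p with
  | nil => simp [pathSplits]
  | cons p e ih =>
    simp only [pathSplits, List.mem_cons, List.mem_map]
    rintro s (rfl | ⟨t, ht, rfl⟩)
    · simp
    · simp only [Quiver.Path.length_cons]
      have := ih t ht
      omega

variable {k} in
/-- A subspace which contains all paths is everything. -/
lemma mem_of_forall_ofPath {S : Submodule k (PathCoalgebra k V)}
    (h : ∀ (a b : V) (p : Quiver.Path a b), ofPath k p ∈ S) (x : PathCoalgebra k V) : x ∈ S := by
  have : Submodule.span k (Set.range (basis k V)) ≤ S :=
    Submodule.span_le.2 (by rintro _ ⟨p, rfl⟩; exact h p.src p.tgt p.path)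
  rw [(basis k V).span_eq] at this
  exact this trivial

lemma ofPath_mem_degree {a b : V} (p : Quiver.Path a b) : ofPath k p ∈ degree k V p.length :=
  Submodule.subset_span ⟨a, b, p, rfl, rfl⟩

variable (V) in
/-- The projection onto the span of the paths of length `n`. -/
def degreeProj (n : ℕ) : PathCoalgebra k V →ₗ[k] PathCoalgebra k V :=
  (basis k V).constr k fun p => if p.path.length = n then ofPath k p.path else 0

lemma degreeProj_ofPath (n : ℕ) {a b : V} (p : Quiver.Path a b) :
    degreeProj k V n (ofPath k p) = if p.length = n then ofPath k p else 0 :=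
  (basis k V).constr_basis k _ _

variable {k} in
lemma eq_on_degree {M : Type*} [AddCommGroup M] [Module k M] {n : ℕ}
    {f g : PathCoalgebra k V →ₗ[k] M}
    (h : ∀ (a b : V) (p : Quiver.Path a b), p.length = n → f (ofPath k p) = g (ofPath k p))
    {x : PathCoalgebra k V} (hx : x ∈ degree k V n) : f x = g x := by
  have : degree k V n ≤ LinearMap.eqLocus f g :=
    Submodule.span_le.2 (by rintro _ ⟨a, b, p, hp, rfl⟩; exact h a b p hp)
  exact this hx

variable (V) in
/-- The grading of the path coalgebra by the length of paths. -/
def lengthGrading : CoalgebraGrading k (PathCoalgebra k V) where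
  deg := degree k V
  proj := degreeProj k V
  proj_mem n x := by
    refine mem_of_forall_ofPath (S := (degree k V n).comap (degreeProj k V n))
      (fun a b p => ?_) x
    rw [Submodule.mem_comap, degreeProj_ofPath]
    split_ifs with h
    · exact h ▸ ofPath_mem_degree k p
    · exact zero_mem _
  proj_of_mem {n x} hx := eq_on_degree (f := degreeProj k V n) (g := LinearMap.id)
    (fun a b p hp => by rw [degreeProj_ofPath, if_pos hp, LinearMap.id_apply]) hx
  proj_of_mem_ne {m n x} hx hmn := eq_on_degree (f := degreeProj k V n) (g := 0)
    (fun a b p hp => by rw [degreeProj_ofPath, if_neg (hp ▸ hmn), LinearMap.zero_apply]) hx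
  iSup_deg := eq_top_iff.2 fun x _ => mem_of_forall_ofPath
    (fun _ _ p => Submodule.mem_iSup_of_mem _ (ofPath_mem_degree k p)) x
  comul_mem {n x} hx := by
    have : degree k V n ≤ (tensorDegree (degree k V) (degree k V) n).comap
        (comul (R := k) (A := PathCoalgebra k V)) := by
      refine Submodule.span_le.2 ?_
      rintro _ ⟨a, b, p, hp, rfl⟩
      rw [SetLike.mem_coe, Submodule.mem_comap, comul_ofPath]
      refine list_sum_mem fun z hz => ?_
      obtain ⟨s, hs, rfl⟩ := List.mem_map.1 hz
      exact tmul_mem_tensorDegree (hp ▸ length_add_length_of_mem_pathSplits p s hs)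
        (ofPath_mem_degree k _) (ofPath_mem_degree k _)
    exact this hx
  counit_eq_zero {n x} hx hn := eq_on_degree (f := counit (R := k)) (g := 0)
    (fun a b p hp => by rw [counit_ofPath, if_neg (hp ▸ hn), LinearMap.zero_apply]) hx

lemma lengthGrading_deg (n : ℕ) : (lengthGrading k V).deg n = degree k V n := rfl

lemma lengthGrading_proj_ofPath (n : ℕ) {a b : V} (p : Quiver.Path a b) :
    (lengthGrading k V).proj n (ofPath k p) = if p.length = n then ofPath k p else 0 :=
  degreeProj_ofPath k n p

open Classical in
/-- The concatenation of two paths as an element of the path coalgebra, zero if the second path does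
not end where the first one starts. -/
def concatPath (r q : QuiverPath V) : PathCoalgebra k V :=
  if h : q.tgt = r.src then
    ofPath k ((h ▸ q.path : Quiver.Path q.src r.src).comp r.path)
  else 0

variable (V) in
/-- The multiplication of the path algebra, `r ⊗ q ↦ rq`, on the space underlying the path
coalgebra. -/
def concat : PathCoalgebra k V ⊗[k] PathCoalgebra k V →ₗ[k] PathCoalgebra k V :=
  TensorProduct.lift
    ((basis k V).constr k fun r => (basis k V).constr k fun q => concatPath k r q)

lemma concat_ofPath {a b c d : V} (r : Quiver.Path c d) (q : Quiver.Path a b) :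
    concat k V (ofPath k r ⊗ₜ ofPath k q) = concatPath k ⟨c, d, r⟩ ⟨a, b, q⟩ := by
  rw [concat, TensorProduct.lift.tmul, ofPath, Module.Basis.constr_basis, ofPath,
    Module.Basis.constr_basis]

lemma concat_ofPath_comp {a b c : V} (r : Quiver.Path b c) (q : Quiver.Path a b) :
    concat k V (ofPath k r ⊗ₜ ofPath k q) = ofPath k (q.comp r) := by
  rw [concat_ofPath, concatPath, dif_pos rfl]

lemma concat_ofPath_of_ne {a b c d : V} (r : Quiver.Path c d) (q : Quiver.Path a b) (h : b ≠ c) :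
    concat k V (ofPath k r ⊗ₜ ofPath k q) = 0 := by
  rw [concat_ofPath, concatPath, dif_neg h]

lemma concat_mem_degree {m n : ℕ} {x y : PathCoalgebra k V} (hx : x ∈ degree k V m)
    (hy : y ∈ degree k V n) : concat k V (x ⊗ₜ y) ∈ degree k V (n + m) := by
  have : Submodule.map₂ (TensorProduct.mk k _ _) (degree k V m) (degree k V n) ≤
      (degree k V (n + m)).comap (concat k V) := by
    rw [degree, degree, Submodule.map₂_span_span]
    refine Submodule.span_le.2 ?_
    rintro _ ⟨_, ⟨c, d, r, hr, rfl⟩, _, ⟨a, b, q, hq, rfl⟩, rfl⟩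
    simp only [TensorProduct.mk_apply, SetLike.mem_coe, Submodule.mem_comap]
    by_cases h : b = c
    · subst h
      rw [concat_ofPath_comp, ← hr, ← hq, ← Quiver.Path.length_comp]
      exact ofPath_mem_degree k _
    · rw [concat_ofPath_of_ne k r q h]
      exact zero_mem _
  exact this (Submodule.apply_mem_map₂ _ hx hy)

/-- Splitting off the last arrow of a path and concatenating again. This makes the component
`kQₙ₊₁ → kQ₁ ⊗ kQₙ` of the comultiplication injective. -/
lemma concat_proj_comul (n : ℕ) (x : PathCoalgebra k V) :
    concat k V (TensorProduct.map ((lengthGrading k V).proj 1) ((lengthGrading k V).proj n)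
      (comul (R := k) x)) = (lengthGrading k V).proj (n + 1) x := by
  rw [← LinearMap.comp_apply, ← LinearMap.comp_apply]
  revert x
  rw [← LinearMap.ext_iff]
  refine hom_ext k fun a b p => ?_
  have hzero : ∀ (l : List (Σ d : V, Quiver.Path d b × Quiver.Path a d)),
      (∀ s ∈ l, s.2.1.length ≠ 1) →
      (l.map fun s => concat k V ((lengthGrading k V).proj 1 (ofPath k s.2.1) ⊗ₜ
        (lengthGrading k V).proj n (ofPath k s.2.2))).sum = 0 := by
    intro l hl
    refine List.sum_eq_zero fun z hz => ?_
    obtain ⟨s, hs, rfl⟩ := List.mem_map.1 hz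
    rw [lengthGrading_proj_ofPath, if_neg (hl s hs), TensorProduct.zero_tmul, map_zero]
  simp only [LinearMap.comp_apply, comul_ofPath, map_list_sum, List.map_map, Function.comp_def,
    TensorProduct.map_tmul]
  cases p with
  | nil =>
    rw [hzero _ (by simp [pathSplits]), lengthGrading_proj_ofPath, if_neg (by simp)]
  | @cons c _ p e =>
    rw [pathSplits, List.map_cons, List.sum_cons, lengthGrading_proj_ofPath, if_neg (by simp),
      TensorProduct.zero_tmul, map_zero, zero_add]
    cases p with
    | nil =>
      simp only [pathSplits, List.map_cons, List.map_nil, List.sum_cons, List.sum_nil, add_zero,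
        lengthGrading_proj_ofPath]
      rcases n with _ | n
      · rw [if_pos (by simp), if_pos (by simp)]
        exact concat_ofPath_comp k _ _
      · rw [if_neg (show ¬ (Quiver.Path.nil : Quiver.Path a a).length = n + 1 by simp),
          TensorProduct.tmul_zero, map_zero, if_neg (by simp)]
    | cons p f =>
      have hl : ∀ s ∈ ((pathSplits p).map fun s => (⟨s.1, s.2.1.cons f, s.2.2⟩ :
          Σ d : V, Quiver.Path d c × Quiver.Path a d)).map fun s => (⟨s.1, s.2.1.cons e, s.2.2⟩ :
          Σ d : V, Quiver.Path d _ × Quiver.Path a d), s.2.1.length ≠ 1 := by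
        intro s hs
        simp only [List.mem_map] at hs
        obtain ⟨_, ⟨t, -, rfl⟩, rfl⟩ := hs
        simp
      rw [pathSplits, List.map_cons, List.map_cons, List.sum_cons, hzero _ hl, add_zero]
      change concat k V ((lengthGrading k V).proj 1 (ofPath k (Quiver.Path.nil.cons e)) ⊗ₜ
        (lengthGrading k V).proj n (ofPath k (p.cons f))) = _
      rw [lengthGrading_proj_ofPath, lengthGrading_proj_ofPath, lengthGrading_proj_ofPath,
        if_pos (by simp), Quiver.Path.length_cons _ _ _ (p.cons f)]
      simp only [add_left_inj]
      split_ifs with h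
      · exact concat_ofPath_comp k _ _
      · rw [TensorProduct.tmul_zero, map_zero]

/-- The comultiplication of a path from which the last arrow has been split off: for an arrow `e`
with target `b` and a path `q`, `Δ(eq) = b ⊗ eq + (e ⊗ 1) Δ(q)`. -/
lemma comul_concat (x y : PathCoalgebra k V) :
    comul (R := k) (concat k V ((lengthGrading k V).proj 1 x ⊗ₜ y)) =
      TensorProduct.map LinearMap.id (concat k V) (TensorProduct.assoc k _ _ _
        (TensorProduct.map ((lengthGrading k V).proj 0) ((lengthGrading k V).proj 1)
          (comul (R := k) ((lengthGrading k V).proj 1 x)) ⊗ₜ y)) +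
      TensorProduct.map (concat k V) LinearMap.id ((TensorProduct.assoc k _ _ _).symm
        ((lengthGrading k V).proj 1 x ⊗ₜ comul (R := k) y)) := by
  let π := (lengthGrading k V).proj
  -- Both sides are bilinear in `x` and `y`, so that it suffices to compare them on paths.
  let F : PathCoalgebra k V →ₗ[k] PathCoalgebra k V →ₗ[k]
      PathCoalgebra k V ⊗[k] PathCoalgebra k V :=
    ((TensorProduct.mk k (PathCoalgebra k V) (PathCoalgebra k V)).compr₂
      (comul (R := k) ∘ₗ concat k V)) ∘ₗ π 1
  let G₁ : PathCoalgebra k V →ₗ[k] PathCoalgebra k V →ₗ[k]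
      PathCoalgebra k V ⊗[k] PathCoalgebra k V :=
    ((TensorProduct.mk k (PathCoalgebra k V ⊗[k] PathCoalgebra k V) (PathCoalgebra k V)).compr₂
      (TensorProduct.map LinearMap.id (concat k V) ∘ₗ
        (TensorProduct.assoc k _ _ _).toLinearMap)) ∘ₗ
      (TensorProduct.map (π 0) (π 1) ∘ₗ comul (R := k) ∘ₗ π 1)
  let G₂ : PathCoalgebra k V →ₗ[k] PathCoalgebra k V →ₗ[k]
      PathCoalgebra k V ⊗[k] PathCoalgebra k V :=
    ((TensorProduct.mk k (PathCoalgebra k V) (PathCoalgebra k V ⊗[k] PathCoalgebra k V)).compr₂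
      (TensorProduct.map (concat k V) LinearMap.id ∘ₗ
        (TensorProduct.assoc k _ _ _).symm.toLinearMap)).compl₂ (comul (R := k)) ∘ₗ π 1
  suffices h : F = G₁ + G₂ from LinearMap.congr_fun (LinearMap.congr_fun h x) y
  refine hom_ext k fun a b r => hom_ext k fun c d q => ?_
  change comul (R := k) (concat k V (π 1 (ofPath k r) ⊗ₜ ofPath k q)) =
    TensorProduct.map LinearMap.id (concat k V) (TensorProduct.assoc k _ _ _
        (TensorProduct.map (π 0) (π 1) (comul (R := k) (π 1 (ofPath k r))) ⊗ₜ ofPath k q)) +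
      TensorProduct.map (concat k V) LinearMap.id ((TensorProduct.assoc k _ _ _).symm
        (π 1 (ofPath k r) ⊗ₜ comul (R := k) (ofPath k q)))
  have hπ : ∀ (n : ℕ) {a b : V} (p : Quiver.Path a b),
    π n (ofPath k p) = if p.length = n then ofPath k p else 0 := lengthGrading_proj_ofPath k
  by_cases hr : r.length = 1
  · rw [hπ 1 r, if_pos hr]
    obtain ⟨b', r, e, rfl⟩ : ∃ (b' : V) (r' : Quiver.Path a b') (e : b' ⟶ b), r = r'.cons e := by
      cases r with
      | nil => simp at hr
      | cons r e => exact ⟨_, r, e, rfl⟩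
    obtain rfl : a = b' := Quiver.Path.eq_of_length_zero r (by simpa using hr)
    obtain rfl := Quiver.Path.eq_nil_of_length_zero r (by simpa using hr)
    have hΔ : TensorProduct.map (π 0) (π 1)
        (comul (R := k) (ofPath k ((Quiver.Path.nil : Quiver.Path a a).cons e))) =
        ofPath k (Quiver.Path.nil : Quiver.Path b b) ⊗ₜ
          ofPath k ((Quiver.Path.nil : Quiver.Path a a).cons e) := by
      rw [comul_ofPath]
      simp [pathSplits, hπ]
    rw [hΔ, TensorProduct.assoc_tmul, TensorProduct.map_tmul, LinearMap.id_apply, comul_ofPath k q]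
    have hsum : ∀ (l : List (PathCoalgebra k V ⊗[k] PathCoalgebra k V)) (y : PathCoalgebra k V),
        y ⊗ₜ[k] l.sum = (l.map (y ⊗ₜ[k] ·)).sum :=
      fun l y => map_list_sum (TensorProduct.mk k _ _ y) l
    rw [hsum, map_list_sum, map_list_sum]
    simp only [List.map_map, Function.comp_def, TensorProduct.assoc_symm_tmul,
      TensorProduct.map_tmul, LinearMap.id_apply]
    by_cases hd : d = a
    · subst hd
      simp only [concat_ofPath_comp]
      rw [comul_ofPath k (q.comp _)]
      change ((pathSplits (q.cons e)).map _).sum = _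
      rw [pathSplits, List.map_cons, List.sum_cons, List.map_map]
      rfl
    · simp only [concat_ofPath_of_ne k _ _ hd, map_zero, TensorProduct.tmul_zero, zero_add,
        TensorProduct.zero_tmul]
      simp
  · rw [hπ 1 r, if_neg hr]
    simp only [TensorProduct.zero_tmul, map_zero, add_zero]

lemma lengthGrading_isStrict : (lengthGrading k V).IsStrict := by
  intro n x hx h
  rw [← (lengthGrading k V).proj_of_mem hx, ← concat_proj_comul, h, map_zero]

/-! ### Coalgebra maps into a path coalgebra -/

variable {k}
variable {C : Type*} [AddCommGroup C] [Module k C] [Coalgebra k C]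

/-- A coalgebra map into a path coalgebra is determined by its components of length `0` and `1`,
because the component of length `n + 1` is recovered from those of length `1` and `n`. -/
lemma coalgHom_ext_proj {f g : C →ₗc[k] PathCoalgebra k V}
    (h₀ : ∀ x, (lengthGrading k V).proj 0 (f x) = (lengthGrading k V).proj 0 (g x))
    (h₁ : ∀ x, (lengthGrading k V).proj 1 (f x) = (lengthGrading k V).proj 1 (g x)) : f = g := by
  have key : ∀ n x, (lengthGrading k V).proj n (f x) = (lengthGrading k V).proj n (g x) := by
    intro n
    induction n with
    | zero => exact h₀
    | succ n ih =>
      intro x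
      have e₁ : (lengthGrading k V).proj 1 ∘ₗ (f : C →ₗ[k] PathCoalgebra k V) =
        (lengthGrading k V).proj 1 ∘ₗ (g : C →ₗ[k] PathCoalgebra k V) := LinearMap.ext h₁
      have e : (lengthGrading k V).proj n ∘ₗ (f : C →ₗ[k] PathCoalgebra k V) =
        (lengthGrading k V).proj n ∘ₗ (g : C →ₗ[k] PathCoalgebra k V) := LinearMap.ext ih
      rw [← concat_proj_comul, ← concat_proj_comul, ← CoalgHomClass.map_comp_comul_apply,
        ← CoalgHomClass.map_comp_comul_apply, TensorProduct.map_map, TensorProduct.map_map, e₁, e]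
  exact CoalgHom.ext fun x => (lengthGrading k V).ext_proj fun n => key n x

/-- A graded coalgebra map into a path coalgebra is determined by its restriction to the components
of degrees `0` and `1`. -/
lemma coalgHom_ext {𝒢 : CoalgebraGrading k C} {f g : C →ₗc[k] PathCoalgebra k V}
    (hf : IsGraded 𝒢 (lengthGrading k V) (f : C →ₗ[k] PathCoalgebra k V))
    (hg : IsGraded 𝒢 (lengthGrading k V) (g : C →ₗ[k] PathCoalgebra k V))
    (h₀ : ∀ x ∈ 𝒢.deg 0, f x = g x) (h₁ : ∀ x ∈ 𝒢.deg 1, f x = g x) : f = g :=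
  coalgHom_ext_proj
    (fun x => (hf.proj_comm 0 x).trans ((h₀ _ (𝒢.proj_mem 0 x)).trans (hg.proj_comm 0 x).symm))
    (fun x => (hf.proj_comm 1 x).trans ((h₁ _ (𝒢.proj_mem 1 x)).trans (hg.proj_comm 1 x).symm))

/-- The components of the extension of a pair `(f₀, f₁)` to a coalgebra map: the component of
degree `n + 1` splits off an arrow by `f₁`. In degree `1` this gives back `f₁`, but only for a
truncated coalgebra map. -/
def extendComponent (f₀ f₁ : C →ₗ[k] PathCoalgebra k V) : ℕ → C →ₗ[k] PathCoalgebra k V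
  | 0 => f₀
  | n + 1 => concat k V ∘ₗ TensorProduct.map f₁ (extendComponent f₀ f₁ n) ∘ₗ comul (R := k)

section Extend

variable {𝒢 : CoalgebraGrading k C} {f₀ f₁ : C →ₗ[k] PathCoalgebra k V}

lemma extendComponent_one (hf : IsTruncatedHom 𝒢 (lengthGrading k V) f₀ f₁) :
    extendComponent f₀ f₁ 1 = f₁ := by
  ext x
  have h₁ : f₁ = (lengthGrading k V).proj 1 ∘ₗ f₁ :=
    LinearMap.ext fun y => ((lengthGrading k V).proj_of_mem (hf.mem_one y)).symm
  have h₀ : f₀ = (lengthGrading k V).proj 0 ∘ₗ f₀ :=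
    LinearMap.ext fun y => ((lengthGrading k V).proj_of_mem (hf.mem_zero y)).symm
  have h₁₀ : (lengthGrading k V).proj 1 ∘ₗ f₀ = 0 := LinearMap.ext fun y =>
    (lengthGrading k V).proj_of_mem_ne (hf.mem_zero y) zero_ne_one
  have key : TensorProduct.map f₁ f₀ (comul (R := k) x) =
      TensorProduct.map ((lengthGrading k V).proj 1) ((lengthGrading k V).proj 0)
        (comul (R := k) (f₁ x)) := by
    rw [hf.comul_one, map_add, TensorProduct.map_map, TensorProduct.map_map, h₁₀, ← h₁, ← h₀]
    simp
  change concat k V (TensorProduct.map f₁ f₀ (comul (R := k) x)) = f₁ x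
  rw [key, concat_proj_comul, (lengthGrading k V).proj_of_mem (hf.mem_one x)]

lemma extendComponent_mem (hf : IsTruncatedHom 𝒢 (lengthGrading k V) f₀ f₁) (n : ℕ) (x : C) :
    extendComponent f₀ f₁ n x ∈ degree k V n := by
  induction n generalizing x with
  | zero => exact hf.mem_zero x
  | succ n ih =>
    have : ∀ z : C ⊗[k] C, concat k V (TensorProduct.map f₁ (extendComponent f₀ f₁ n) z) ∈
        degree k V (n + 1) := by
      intro z
      induction z with
      | zero => simp
      | add x y hx hy => rw [map_add, map_add]; exact add_mem hx hy
      | tmul x y => exact concat_mem_degree k (hf.mem_one x) (ih y)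
    exact this _

lemma extendComponent_isConcentrated (hf : IsTruncatedHom 𝒢 (lengthGrading k V) f₀ f₁) (n : ℕ) :
    𝒢.IsConcentrated n (extendComponent f₀ f₁ n) := by
  induction n with
  | zero => exact hf.conc_zero
  | succ n ih => exact (hf.conc_one.map_comul ih (add_comm 1 n)).comp _

/-- The components of the extension satisfy the identities of the components of a coalgebra map. -/
lemma comul_extendComponent (hf : IsTruncatedHom 𝒢 (lengthGrading k V) f₀ f₁) (n : ℕ) (x : C) :
    comul (R := k) (extendComponent f₀ f₁ n x) =
      ∑ p ∈ Finset.HasAntidiagonal.antidiagonal n,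
        TensorProduct.map (extendComponent f₀ f₁ p.1) (extendComponent f₀ f₁ p.2)
          (comul (R := k) x) := by
  induction n generalizing x with
  | zero => simpa [extendComponent] using hf.comul_zero x
  | succ n ih =>
    have hsplit : ∀ z : C ⊗[k] C,
        comul (R := k) (concat k V (TensorProduct.map f₁ (extendComponent f₀ f₁ n) z)) =
          TensorProduct.map LinearMap.id (concat k V) (TensorProduct.assoc k _ _ _
            (TensorProduct.map (TensorProduct.map f₀ f₁ ∘ₗ comul (R := k))
              (extendComponent f₀ f₁ n) z)) +
          TensorProduct.map (concat k V) LinearMap.id ((TensorProduct.assoc k _ _ _).symm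
            (TensorProduct.map f₁ (comul (R := k) ∘ₗ extendComponent f₀ f₁ n) z)) := by
      intro z
      induction z with
      | zero => simp
      | add x y hx hy => simp only [map_add, hx, hy]; abel
      | tmul x y =>
        have hm : (lengthGrading k V).proj 1 (f₁ x) = f₁ x :=
          (lengthGrading k V).proj_of_mem (hf.mem_one x)
        have h₀ : (lengthGrading k V).proj 0 ∘ₗ f₀ = f₀ :=
          LinearMap.ext fun y => (lengthGrading k V).proj_of_mem (hf.mem_zero y)
        have h₁ : (lengthGrading k V).proj 1 ∘ₗ f₁ = f₁ :=
          LinearMap.ext fun y => (lengthGrading k V).proj_of_mem (hf.mem_one y)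
        have h₁₀ : (lengthGrading k V).proj 1 ∘ₗ f₀ = 0 := LinearMap.ext fun y =>
          (lengthGrading k V).proj_of_mem_ne (hf.mem_zero y) zero_ne_one
        have := comul_concat k (f₁ x) (extendComponent f₀ f₁ n y)
        rw [hm, hf.comul_one, map_add, TensorProduct.map_map, TensorProduct.map_map, h₀, h₁, h₁₀,
          TensorProduct.map_zero_right, LinearMap.zero_apply, add_zero] at this
        simpa only [TensorProduct.map_tmul, LinearMap.comp_apply] using this
    have hΔ : comul (R := k) ∘ₗ extendComponent f₀ f₁ n =
        ∑ p ∈ Finset.HasAntidiagonal.antidiagonal n,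
          TensorProduct.map (extendComponent f₀ f₁ p.1) (extendComponent f₀ f₁ p.2) ∘ₗ
            comul (R := k) := by
      ext y
      rw [LinearMap.comp_apply, ih, LinearMap.sum_apply]
      rfl
    have hsum : TensorProduct.map f₁ (comul (R := k) ∘ₗ extendComponent f₀ f₁ n) =
        ∑ p ∈ Finset.HasAntidiagonal.antidiagonal n, TensorProduct.map f₁
          (TensorProduct.map (extendComponent f₀ f₁ p.1) (extendComponent f₀ f₁ p.2) ∘ₗ
            comul (R := k)) := by
      rw [hΔ, ← TensorProduct.mapBilinear_apply, map_sum]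
      rfl
    change comul (R := k) (concat k V (TensorProduct.map f₁ (extendComponent f₀ f₁ n)
      (comul (R := k) x))) = _
    rw [hsplit, ← map_map_comul, hsum, LinearMap.sum_apply, map_sum, map_sum,
      Finset.Nat.antidiagonal_succ, Finset.sum_cons, Finset.sum_map]
    refine congrArg₂ _ ?_ (Finset.sum_congr rfl fun p _ => ?_)
    · rw [TensorProduct.map_map]
      rfl
    · rw [map_map_comul, LinearEquiv.symm_apply_apply, TensorProduct.map_map]
      rfl

/-- The universal property of path coalgebras: a truncated coalgebra map into a path coalgebra
extends to a graded coalgebra map. -/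
lemma exists_coalgHom_extending (hf : IsTruncatedHom 𝒢 (lengthGrading k V) f₀ f₁) :
    ∃ f : C →ₗc[k] PathCoalgebra k V,
    IsGraded 𝒢 (lengthGrading k V) (f : C →ₗ[k] PathCoalgebra k V) ∧
    (∀ x ∈ 𝒢.deg 0, f x = f₀ x) ∧ ∀ x ∈ 𝒢.deg 1, f x = f₁ x := by
  obtain ⟨f, hfn⟩ := 𝒢.exists_linearMap_of_isConcentrated _ (extendComponent_isConcentrated hf)
  have hproj : ∀ n, f ∘ₗ 𝒢.proj n = extendComponent f₀ f₁ n := fun n => LinearMap.ext fun x =>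
    (hfn n _ (𝒢.proj_mem n x)).trans (extendComponent_isConcentrated hf n x)
  refine ⟨{ f with counit_comp := ?_, map_comp_comul := ?_ }, ?_, hfn 0, ?_⟩
  · refine 𝒢.linearMap_ext fun n x hx => ?_
    change counit (R := k) (f x) = _
    rw [hfn n x hx]
    rcases n with _ | n
    · exact hf.counit_zero x
    · rw [(lengthGrading k V).counit_eq_zero (extendComponent_mem hf (n + 1) x) n.succ_ne_zero,
        𝒢.counit_eq_zero hx n.succ_ne_zero]
  · refine 𝒢.linearMap_ext fun n x hx => ?_
    change TensorProduct.map f f (comul (R := k) x) = comul (R := k) (f x)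
    rw [hfn n x hx, comul_extendComponent hf, 𝒢.comul_eq_sum hx, map_sum]
    simp only [TensorProduct.map_map, hproj]
    simp only [← 𝒢.comul_eq_sum hx]
  · exact fun n x hx => (congrArg (· ∈ degree k V n) (hfn n x hx)).mpr
      (extendComponent_mem hf n x)
  · exact fun x hx => (hfn 1 x hx).trans (LinearMap.congr_fun (extendComponent_one hf) x)

end Extend

end PathCoalgebra

/-! ### The grading of an associated graded bialgebra -/

namespace BialgebraFiltration

open Coalgebra

variable {k : Type u} {B : Type v} [Field k] [Ring B] [Bialgebra k B]
  (𝓕 : BialgebraFiltration k B)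

lemma symbol_mem_degree (n : ℕ) (x : 𝓕.F n) : 𝓕.symbol n x ∈ 𝓕.degree n :=
  ⟨𝓕.toPiece n x, rfl⟩

lemma exists_symbol_eq {n : ℕ} {x : 𝓕.Gr} (hx : x ∈ 𝓕.degree n) : ∃ y, 𝓕.symbol n y = x := by
  obtain ⟨z, rfl⟩ := hx
  obtain ⟨y, rfl⟩ := 𝓕.toPiece_surjective n z
  exact ⟨y, rfl⟩

lemma mem_prev_of_symbol_eq_zero {n : ℕ} {x : 𝓕.F n} (h : 𝓕.symbol n x = 0) :
    (x : B) ∈ 𝓕.prev n := by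
  have h' : 𝓕.toPiece n x = 0 := DirectSum.of_injective (β := 𝓕.Piece) n (by
    rw [map_zero]; exact h)
  exact (Submodule.Quotient.mk_eq_zero ((𝓕.prev n).submoduleOf (𝓕.F n))).1 h'

/-- The projection of `gr B` onto its homogeneous component of degree `n`. -/
def degreeProj (n : ℕ) : 𝓕.Gr →ₗ[k] 𝓕.Gr :=
  𝓕.ofPiece n ∘ₗ (DirectSum.component k ℕ 𝓕.Piece n : DirectSum ℕ 𝓕.Piece →ₗ[k] 𝓕.Piece n)

lemma tensorSymbol_mem_tensorDegree {n : ℕ} {z : B ⊗[k] B} (hz : z ∈ 𝓕.tensorF n) :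
    𝓕.tensorSymbol n z ∈ tensorDegree 𝓕.degree 𝓕.degree n := by
  have : 𝓕.tensorF n ≤ (tensorDegree 𝓕.degree 𝓕.degree n).comap (𝓕.tensorSymbol n) := by
    refine 𝓕.tensorF_le fun i j hij a ha b hb => ?_
    rw [Submodule.mem_comap, 𝓕.tensorSymbol_tmul hij ha hb]
    exact tmul_mem_tensorDegree hij (𝓕.symbol_mem_degree _ _) (𝓕.symbol_mem_degree _ _)
  exact this hz

/-- The grading of the associated graded bialgebra. -/
def grGrading : CoalgebraGrading k 𝓕.Gr where
  deg := 𝓕.degree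
  proj := 𝓕.degreeProj
  proj_mem n x := ⟨_, rfl⟩
  proj_of_mem {n x} hx := by
    obtain ⟨y, rfl⟩ := hx
    exact congrArg (𝓕.ofPiece n) (DirectSum.component.lof_self k n y)
  proj_of_mem_ne {m n x} hx hmn := by
    obtain ⟨y, rfl⟩ := hx
    exact (congrArg (𝓕.ofPiece n) (DirectSum.component.of (R := k) (M := 𝓕.Piece) n m y |>.trans
      (dif_neg hmn))).trans (map_zero _)
  iSup_deg := by
    refine eq_top_iff.2 fun x _ => ?_
    induction x using 𝓕.gr_induction with
    | h0 => exact zero_mem _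
    | hs n x => exact Submodule.mem_iSup_of_mem n (𝓕.symbol_mem_degree n x)
    | ha x y hx hy => exact add_mem (hx trivial) (hy trivial)
  comul_mem {n x} hx := by
    obtain ⟨y, rfl⟩ := 𝓕.exists_symbol_eq hx
    change 𝓕.grComul (𝓕.symbol n y) ∈ _
    rw [grComul_symbol]
    exact 𝓕.tensorSymbol_mem_tensorDegree (𝓕.comul_mem y.2)
  counit_eq_zero {n x} hx hn := by
    obtain ⟨y, rfl⟩ := 𝓕.exists_symbol_eq hx
    exact 𝓕.grCounit_symbol_of_pos (Nat.pos_of_ne_zero hn) y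

lemma one_mem_degree : (1 : 𝓕.Gr) ∈ 𝓕.degree 0 := 𝓕.symbol_mem_degree 0 _

lemma mul_mem_degree {m n : ℕ} {x y : 𝓕.Gr} (hx : x ∈ 𝓕.degree m) (hy : y ∈ 𝓕.degree n) :
    x * y ∈ 𝓕.degree (m + n) := by
  obtain ⟨x, rfl⟩ := 𝓕.exists_symbol_eq hx
  obtain ⟨y, rfl⟩ := 𝓕.exists_symbol_eq hy
  rw [symbol_mul_symbol]
  exact 𝓕.symbol_mem_degree _ _

lemma isGroupLikeElem_symbol {g : B} (hg : IsGroupLikeElem k g) (h : g ∈ 𝓕.F 0) :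
    IsGroupLikeElem k (𝓕.symbol 0 ⟨g, h⟩) where
  counit_eq_one := (𝓕.grCounit_symbol_zero _).trans hg.counit_eq_one
  comul_eq_tmul_self := (𝓕.grComul_symbol _).trans (by
    rw [hg.comul_eq_tmul_self, 𝓕.tensorSymbol_tmul (add_zero 0) h h])

end BialgebraFiltration

section CoradicallyGraded

open Coalgebra

variable {k : Type u} {B : Type v} [Field k] [Ring B] [Bialgebra k B]

variable (hB : IsPointedCoalgebra k B)

lemma degree_zero_le_span_isGroupLikeElem :
    (coradicalBialgebraFiltration hB).degree 0 ≤
      Submodule.span k {g : CoradicalGr hB | IsGroupLikeElem k g} := by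
  intro x hx
  obtain ⟨⟨y, hy⟩, rfl⟩ := BialgebraFiltration.exists_symbol_eq _ hx
  -- The linear extension `ext 0` of the symbol map is used to avoid an induction over elements
  -- of a subtype.
  rw [← BialgebraFiltration.ext_apply]
  have : coradical k B ≤ (Submodule.span k {g : CoradicalGr hB | IsGroupLikeElem k g}).comap
      ((coradicalBialgebraFiltration hB).ext 0) := by
    refine sSup_le fun D hD => ?_
    obtain ⟨g, hg, rfl⟩ := exists_isGroupLikeElem_of_isPointed hB hD
    rw [Submodule.span_singleton_le_iff_mem, Submodule.mem_comap]
    have hmem : g ∈ (coradicalBialgebraFiltration hB).F 0 :=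
      (le_sSup (a := Submodule.span k {g}) hD) (Submodule.mem_span_singleton_self g)
    rw [BialgebraFiltration.ext_apply _ hmem]
    exact Submodule.subset_span (BialgebraFiltration.isGroupLikeElem_symbol _ hg hmem)
  exact this hy

lemma coradicalShift_eq_prev (n : ℕ) :
    coradicalShift k B n = (coradicalBialgebraFiltration hB).prev n := by
  cases n <;> rfl

/-- The associated graded bialgebra of the coradical filtration is coradically graded: if the
component of `Δ(x)` in `B₁/B₀ ⊗ Bₙ/Bₙ₋₁` vanishes for `x ∈ Bₙ₊₁`, then
`Δ(x) ∈ B₀ ⊗ B + B ⊗ Bₙ₋₁`, that is, `x ∈ Bₙ`. -/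
lemma coradicalGr_isStrict : (coradicalBialgebraFiltration hB).grGrading.IsStrict := by
  intro n x hx h
  set 𝓕 := coradicalBialgebraFiltration hB with h𝓕
  obtain ⟨⟨b, hb⟩, rfl⟩ := 𝓕.exists_symbol_eq hx
  refine 𝓕.symbol_eq_zero ?_
  change b ∈ coradicalShift k B (n + 1)
  rw [mem_coradicalShift_succ]
  obtain ⟨c₁, hc₁, hc₁'⟩ := exists_linearMap_ker_eq (coradicalShift k B 1)
  obtain ⟨c, hc, hc'⟩ := exists_linearMap_ker_eq (coradicalShift k B n)
  refine mem_of_map_eq_zero hc₁' hc' ?_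
  obtain ⟨l₁, hl₁⟩ := exists_linearMap_comp_eq (𝓕.symbol 1) (c₁ ∘ₗ (𝓕.F 1).subtype)
    fun x hx => (hc₁ _).2 (𝓕.mem_prev_of_symbol_eq_zero hx)
  obtain ⟨l, hl⟩ := exists_linearMap_comp_eq (𝓕.symbol n) (c ∘ₗ (𝓕.F n).subtype)
    fun x hx => (hc _).2 (by
      rw [coradicalShift_eq_prev hB]; exact 𝓕.mem_prev_of_symbol_eq_zero hx)
  have key := 𝓕.eq_on_tensorF (n := n + 1)
    (TensorProduct.map l₁ l ∘ₗ TensorProduct.map (𝓕.degreeProj 1) (𝓕.degreeProj n) ∘ₗ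
      𝓕.tensorSymbol (n + 1)) (TensorProduct.map c₁ c) (fun i j hij a ha d hd => by
        rw [LinearMap.comp_apply, LinearMap.comp_apply, 𝓕.tensorSymbol_tmul hij ha hd,
          TensorProduct.map_tmul, TensorProduct.map_tmul, TensorProduct.map_tmul]
        by_cases hi : i = 1
        · subst hi
          obtain rfl : j = n := by omega
          have e₁ : 𝓕.degreeProj 1 (𝓕.symbol 1 ⟨a, ha⟩) = 𝓕.symbol 1 ⟨a, ha⟩ :=
            𝓕.grGrading.proj_of_mem (𝓕.symbol_mem_degree _ _)
          have e : 𝓕.degreeProj j (𝓕.symbol j ⟨d, hd⟩) = 𝓕.symbol j ⟨d, hd⟩ :=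
            𝓕.grGrading.proj_of_mem (𝓕.symbol_mem_degree _ _)
          rw [e₁, e, hl₁, hl]
          rfl
        · have e₁ : 𝓕.degreeProj 1 (𝓕.symbol i ⟨a, ha⟩) = 0 :=
            𝓕.grGrading.proj_of_mem_ne (𝓕.symbol_mem_degree _ _) hi
          rw [e₁, map_zero, TensorProduct.zero_tmul]
          rcases Nat.eq_zero_or_pos i with rfl | hpos
          · rw [(hc₁ a).2 ha, TensorProduct.zero_tmul]
          · rw [(hc d).2 (by
              rw [coradicalShift_eq_prev hB]; exact 𝓕.le_prev (show j < n by omega) hd),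
              TensorProduct.tmul_zero]) (𝓕.comul_mem hb)
  rw [← key, LinearMap.comp_apply, LinearMap.comp_apply]
  have h2 : TensorProduct.map (𝓕.degreeProj 1) (𝓕.degreeProj n)
      (𝓕.grComul (𝓕.symbol (n + 1) ⟨b, hb⟩)) = 0 := h
  rw [𝓕.grComul_symbol] at h2
  rw [h2, map_zero]

end CoradicallyGraded

/-! ### The quiver of a pointed graded coalgebra -/

namespace CoalgebraGrading

open Coalgebra

variable {k : Type*} [Field k]

section TruncatedIso

variable {C D E : Type*} [AddCommGroup C] [Module k C] [Coalgebra k C]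
  [AddCommGroup D] [Module k D] [Coalgebra k D] [AddCommGroup E] [Module k E] [Coalgebra k E]

/-- A truncated coalgebra map which is bijective in degrees `0` and `1`, together with its
inverse. -/
structure TruncatedIso (𝒢 : CoalgebraGrading k C) (ℋ : CoalgebraGrading k D) where
  /-- the map in degree `0` -/
  f₀ : C →ₗ[k] D
  /-- the map in degree `1` -/
  f₁ : C →ₗ[k] D
  /-- the inverse in degree `0` -/
  g₀ : D →ₗ[k] C
  /-- the inverse in degree `1` -/
  g₁ : D →ₗ[k] C
  hom : IsTruncatedHom 𝒢 ℋ f₀ f₁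
  inv : IsTruncatedHom ℋ 𝒢 g₀ g₁
  left_inv_zero : ∀ x ∈ 𝒢.deg 0, g₀ (f₀ x) = x
  left_inv_one : ∀ x ∈ 𝒢.deg 1, g₁ (f₁ x) = x
  right_inv_zero : ∀ y ∈ ℋ.deg 0, f₀ (g₀ y) = y
  right_inv_one : ∀ y ∈ ℋ.deg 1, f₁ (g₁ y) = y

namespace TruncatedIso

variable {𝒢 : CoalgebraGrading k C} {ℋ : CoalgebraGrading k D} {𝒦 : CoalgebraGrading k E}

/-- The inverse of a truncated isomorphism. -/
def symm (e : TruncatedIso 𝒢 ℋ) : TruncatedIso ℋ 𝒢 where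
  f₀ := e.g₀
  f₁ := e.g₁
  g₀ := e.f₀
  g₁ := e.f₁
  hom := e.inv
  inv := e.hom
  left_inv_zero := e.right_inv_zero
  left_inv_one := e.right_inv_one
  right_inv_zero := e.left_inv_zero
  right_inv_one := e.left_inv_one

/-- The composition of truncated isomorphisms. -/
def trans (e : TruncatedIso 𝒢 ℋ) (e' : TruncatedIso ℋ 𝒦) : TruncatedIso 𝒢 𝒦 where
  f₀ := e'.f₀ ∘ₗ e.f₀
  f₁ := e'.f₁ ∘ₗ e.f₁
  g₀ := e.g₀ ∘ₗ e'.g₀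
  g₁ := e.g₁ ∘ₗ e'.g₁
  hom := e'.hom.comp e.hom
  inv := e.inv.comp e'.inv
  left_inv_zero x hx := (congrArg e.g₀ (e'.left_inv_zero _ (e.hom.mem_zero x))).trans
    (e.left_inv_zero x hx)
  left_inv_one x hx := (congrArg e.g₁ (e'.left_inv_one _ (e.hom.mem_one x))).trans
    (e.left_inv_one x hx)
  right_inv_zero x hx := (congrArg e'.f₀ (e.right_inv_zero _ (e'.inv.mem_zero x))).trans
    (e'.right_inv_zero x hx)
  right_inv_one x hx := (congrArg e'.f₁ (e.right_inv_one _ (e'.inv.mem_one x))).trans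
    (e'.right_inv_one x hx)

lemma exists_of_bijective {f₀ f₁ : C →ₗ[k] D} (hf : IsTruncatedHom 𝒢 ℋ f₀ f₁)
    (hinj₀ : ∀ x ∈ 𝒢.deg 0, f₀ x = 0 → x = 0) (hinj₁ : ∀ x ∈ 𝒢.deg 1, f₁ x = 0 → x = 0)
    (hsurj₀ : ∀ y ∈ ℋ.deg 0, ∃ x ∈ 𝒢.deg 0, f₀ x = y)
    (hsurj₁ : ∀ y ∈ ℋ.deg 1, ∃ x ∈ 𝒢.deg 1, f₁ x = y) :
    ∃ e : TruncatedIso 𝒢 ℋ, e.f₀ = f₀ ∧ e.f₁ = f₁ := by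
  obtain ⟨g₀, hc₀, hm₀, hl₀, hr₀⟩ := exists_inverse_of_bijective 𝒢 ℋ 0 f₀ hinj₀ hsurj₀
  obtain ⟨g₁, hc₁, hm₁, hl₁, hr₁⟩ := exists_inverse_of_bijective 𝒢 ℋ 1 f₁ hinj₁ hsurj₁
  refine ⟨⟨f₀, f₁, g₀, g₁, hf, hf.inverse hc₀ hc₁ hm₀ hm₁ (fun x => ?_) (fun x => ?_) hr₀ hr₁,
    fun x hx => hl₀ x hx (hf.mem_zero x), fun x hx => hl₁ x hx (hf.mem_one x),
    fun y hy => by rw [hr₀, ℋ.proj_of_mem hy], fun y hy => by rw [hr₁, ℋ.proj_of_mem hy]⟩,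
    rfl, rfl⟩
  · rw [← hf.conc_zero, hl₀ _ (𝒢.proj_mem 0 x) (hf.mem_zero _)]
  · rw [← hf.conc_one, hl₁ _ (𝒢.proj_mem 1 x) (hf.mem_one _)]

end TruncatedIso

end TruncatedIso

section SkewPrimitive

variable {C : Type*} [AddCommGroup C] [Module k C] [Coalgebra k C]

/-- An element `x` is `(g, h)`-skew-primitive if `Δ(x) = g ⊗ x + x ⊗ h`. -/
def IsSkewPrimitive (g h x : C) : Prop := comul (R := k) x = g ⊗ₜ[k] x + x ⊗ₜ[k] h

/-- The coefficient functionals of the group-like elements, extended by zero to the components of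
positive degree. -/
lemma exists_groupLike_coeff (𝒢 : CoalgebraGrading k C) :
    ∃ φ : C →ₗ[k] (GroupLike k C →₀ k), 𝒢.IsConcentrated 0 φ ∧
      ∀ g : GroupLike k C, φ g.val = Finsupp.single g 1 := by
  have hli := linearIndep_groupLikeVal (R := k) (A := C)
  obtain ⟨ψ, hψ⟩ := LinearMap.exists_extend hli.repr
  refine ⟨ψ ∘ₗ 𝒢.proj 0, (𝒢.isConcentrated_proj 0).comp ψ, fun g => ?_⟩
  rw [LinearMap.comp_apply, 𝒢.proj_of_mem (𝒢.mem_deg_zero_of_isGroupLikeElem g.2)]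
  have hg : g.val ∈ Submodule.span k (Set.range (GroupLike.val (R := k) (A := C))) :=
    Submodule.subset_span ⟨g, rfl⟩
  exact (LinearMap.congr_fun hψ ⟨g.val, hg⟩).trans
    (hli.repr_eq_single g ⟨g.val, hg⟩ rfl)

/-- The left translate `x ↦ e(x₍₁₎) x₍₂₎` by a functional `e`. -/
def leftTranslate (e : C →ₗ[k] k) : C →ₗ[k] C :=
  (TensorProduct.lid k C).toLinearMap ∘ₗ TensorProduct.map e LinearMap.id ∘ₗ comul (R := k)

/-- The right translate `x ↦ x₍₁₎ e(x₍₂₎)` by a functional `e`. -/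
def rightTranslate (e : C →ₗ[k] k) : C →ₗ[k] C :=
  (TensorProduct.rid k C).toLinearMap ∘ₗ TensorProduct.map LinearMap.id e ∘ₗ comul (R := k)

lemma comul_leftTranslate (e : C →ₗ[k] k) (x : C) : comul (R := k) (leftTranslate e x) =
    TensorProduct.map (leftTranslate e) LinearMap.id (comul (R := k) x) := by
  have h := congrArg (TensorProduct.lid k (C ⊗[k] C))
    (map_map_comul e (LinearMap.id : C →ₗ[k] C) (LinearMap.id : C →ₗ[k] C) x)
  rw [TensorProduct.map_id, LinearMap.id_comp] at h
  have h₁ : ∀ z : C ⊗[k] C, TensorProduct.lid k (C ⊗[k] C) (TensorProduct.map e (comul (R := k)) z)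
      = comul (R := k) (TensorProduct.lid k C (TensorProduct.map e LinearMap.id z)) := by
    intro z
    induction z with
    | zero => simp
    | add x y hx hy => simp only [map_add, hx, hy]
    | tmul x y => simp
  have h₂ : ∀ z : (k ⊗[k] C) ⊗[k] C, TensorProduct.lid k (C ⊗[k] C)
      (TensorProduct.assoc k k C C z) =
        TensorProduct.map (TensorProduct.lid k C).toLinearMap LinearMap.id z := by
    intro z
    induction z with
    | zero => simp
    | add x y hx hy => simp only [map_add, hx, hy]
    | tmul x y =>
      induction x with
      | zero => simp
      | add x x' hx hx' => simp only [map_add, TensorProduct.add_tmul, hx, hx']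
      | tmul a b => simp [TensorProduct.smul_tmul']
  rw [h₁, h₂, TensorProduct.map_map] at h
  exact h

lemma comul_rightTranslate (e : C →ₗ[k] k) (x : C) : comul (R := k) (rightTranslate e x) =
    TensorProduct.map LinearMap.id (rightTranslate e) (comul (R := k) x) := by
  have h := congrArg
    (fun z => TensorProduct.rid k (C ⊗[k] C) ((TensorProduct.assoc k C C k).symm z))
    (map_map_comul (LinearMap.id : C →ₗ[k] C) (LinearMap.id : C →ₗ[k] C) e x)
  simp only [LinearEquiv.symm_apply_apply] at h
  rw [TensorProduct.map_id, LinearMap.id_comp] at h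
  have h₁ : ∀ z : C ⊗[k] C, TensorProduct.rid k (C ⊗[k] C) (TensorProduct.map (comul (R := k)) e z)
      = comul (R := k) (TensorProduct.rid k C (TensorProduct.map LinearMap.id e z)) := by
    intro z
    induction z with
    | zero => simp
    | add x y hx hy => simp only [map_add, hx, hy]
    | tmul x y => simp
  have h₂ : ∀ z : C ⊗[k] (C ⊗[k] k), TensorProduct.rid k (C ⊗[k] C)
      ((TensorProduct.assoc k C C k).symm z) =
        TensorProduct.map LinearMap.id (TensorProduct.rid k C).toLinearMap z := by
    intro z
    induction z with
    | zero => simp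
    | add x y hx hy => simp only [map_add, hx, hy]
    | tmul x y =>
      induction y with
      | zero => simp
      | add y y' hy hy' => simp only [map_add, TensorProduct.tmul_add, hy, hy']
      | tmul a b => simp
  rw [h₁, h₂, TensorProduct.map_map] at h
  exact h.symm

lemma leftTranslate_mem {𝒢 : CoalgebraGrading k C} {e : C →ₗ[k] k} (he : 𝒢.IsConcentrated 0 e)
    {n : ℕ} {x : C} (hx : x ∈ 𝒢.deg n) : leftTranslate e x ∈ 𝒢.deg n := by
  have : tensorDegree 𝒢.deg 𝒢.deg n ≤ (𝒢.deg n).comap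
      ((TensorProduct.lid k C).toLinearMap ∘ₗ TensorProduct.map e LinearMap.id) := by
    refine tensorDegree_le fun i j hij a ha b hb => ?_
    rw [Submodule.mem_comap]
    simp only [LinearMap.comp_apply, TensorProduct.map_tmul, LinearEquiv.coe_coe,
      TensorProduct.lid_tmul, LinearMap.id_apply]
    by_cases hi : i = 0
    · obtain rfl : j = n := by omega
      exact Submodule.smul_mem _ _ hb
    · rw [he.eq_zero hi ha, zero_smul]
      exact zero_mem _
  exact this (𝒢.comul_mem hx)

lemma rightTranslate_mem {𝒢 : CoalgebraGrading k C} {e : C →ₗ[k] k} (he : 𝒢.IsConcentrated 0 e)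
    {n : ℕ} {x : C} (hx : x ∈ 𝒢.deg n) : rightTranslate e x ∈ 𝒢.deg n := by
  have : tensorDegree 𝒢.deg 𝒢.deg n ≤ (𝒢.deg n).comap
      ((TensorProduct.rid k C).toLinearMap ∘ₗ TensorProduct.map LinearMap.id e) := by
    refine tensorDegree_le fun i j hij a ha b hb => ?_
    rw [Submodule.mem_comap]
    simp only [LinearMap.comp_apply, TensorProduct.map_tmul, LinearEquiv.coe_coe,
      TensorProduct.rid_tmul, LinearMap.id_apply]
    by_cases hj : j = 0
    · obtain rfl : i = n := by omega
      exact Submodule.smul_mem _ _ ha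
    · rw [he.eq_zero hj hb, zero_smul]
      exact zero_mem _
  exact this (𝒢.comul_mem hx)

variable {𝒢 : CoalgebraGrading k C} {φ : C →ₗ[k] (GroupLike k C →₀ k)}

/-- The coefficient functional of a group-like element. -/
abbrev groupLikeCoeff (φ : C →ₗ[k] (GroupLike k C →₀ k)) (g : GroupLike k C) : C →ₗ[k] k :=
  Finsupp.lapply g ∘ₗ φ

lemma sum_groupLikeCoeff (h𝒢 : 𝒢.deg 0 ≤ Submodule.span k {g : C | IsGroupLikeElem k g})
    (hc : 𝒢.IsConcentrated 0 φ) (hφ : ∀ g : GroupLike k C, φ g.val = Finsupp.single g 1) (x : C) :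
    Finsupp.linearCombination k (fun _ => (1 : k)) (φ x) = counit (R := k) x := by
  rw [← LinearMap.comp_apply]
  revert x
  rw [← LinearMap.ext_iff]
  refine (hc.comp _).ext 𝒢.counit_proj_zero fun x hx => ?_
  have : Submodule.span k {g : C | IsGroupLikeElem k g} ≤
      LinearMap.eqLocus (Finsupp.linearCombination k (fun _ => (1 : k)) ∘ₗ φ)
        (counit (R := k)) := by
    refine Submodule.span_le.2 fun g hg => ?_
    have h₁ : counit (R := k) g = 1 := IsGroupLikeElem.counit_eq_one hg
    have h₂ : φ g = Finsupp.single ⟨g, hg⟩ 1 := hφ ⟨g, hg⟩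
    simp [h₁, h₂]
  exact this (h𝒢 hx)

/-- The coefficient functionals of the group-like elements sum up to the counit, so that the left
translates of `x` by them, almost all of which vanish, sum up to `x`. -/
lemma mem_span_leftTranslate (h𝒢 : 𝒢.deg 0 ≤ Submodule.span k {g : C | IsGroupLikeElem k g})
    (hc : 𝒢.IsConcentrated 0 φ) (hφ : ∀ g : GroupLike k C, φ g.val = Finsupp.single g 1) (x : C) :
    x ∈ Submodule.span k (Set.range fun g => leftTranslate (groupLikeCoeff φ g) x) := by
  have key : ∀ z : C ⊗[k] C, ∃ s : Finset (GroupLike k C), ∀ t, s ⊆ t →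
      ∑ g ∈ t, TensorProduct.lid k C (TensorProduct.map (groupLikeCoeff φ g) LinearMap.id z) =
        TensorProduct.lid k C ((counit (R := k)).rTensor C z) := by
    intro z
    classical
    induction z with
    | zero => exact ⟨∅, by simp⟩
    | add x y hx hy =>
      obtain ⟨s, hs⟩ := hx
      obtain ⟨s', hs'⟩ := hy
      refine ⟨s ∪ s', fun t ht => ?_⟩
      simp only [map_add]
      rw [Finset.sum_add_distrib, hs t (Finset.union_subset_left ht),
        hs' t (Finset.union_subset_right ht)]
    | tmul x y =>
      refine ⟨(φ x).support, fun t ht => ?_⟩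
      have h : ∑ g ∈ t, φ x g = counit (R := k) x := by
        rw [← sum_groupLikeCoeff h𝒢 hc hφ x]
        simp only [Finsupp.linearCombination_apply, smul_eq_mul, mul_one]
        exact (Finsupp.sum_of_support_subset _ ht (fun _ c => c) fun _ _ => rfl).symm
      simp [← h, Finset.sum_smul]
  obtain ⟨s, hs⟩ := key (comul (R := k) x)
  have h := hs s subset_rfl
  rw [rTensor_counit_comul, TensorProduct.lid_tmul, one_smul] at h
  have hx : x = ∑ g ∈ s, leftTranslate (groupLikeCoeff φ g) x := h.symm
  have hmem : ∑ g ∈ s, leftTranslate (groupLikeCoeff φ g) x ∈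
      Submodule.span k (Set.range fun g => leftTranslate (groupLikeCoeff φ g) x) :=
    sum_mem fun g _ => Submodule.subset_span ⟨g, rfl⟩
  rwa [← hx] at hmem

lemma mem_span_rightTranslate (h𝒢 : 𝒢.deg 0 ≤ Submodule.span k {g : C | IsGroupLikeElem k g})
    (hc : 𝒢.IsConcentrated 0 φ) (hφ : ∀ g : GroupLike k C, φ g.val = Finsupp.single g 1) (x : C) :
    x ∈ Submodule.span k (Set.range fun g => rightTranslate (groupLikeCoeff φ g) x) := by
  have key : ∀ z : C ⊗[k] C, ∃ s : Finset (GroupLike k C), ∀ t, s ⊆ t →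
      ∑ g ∈ t, TensorProduct.rid k C (TensorProduct.map LinearMap.id (groupLikeCoeff φ g) z) =
        TensorProduct.rid k C ((counit (R := k)).lTensor C z) := by
    intro z
    classical
    induction z with
    | zero => exact ⟨∅, by simp⟩
    | add x y hx hy =>
      obtain ⟨s, hs⟩ := hx
      obtain ⟨s', hs'⟩ := hy
      refine ⟨s ∪ s', fun t ht => ?_⟩
      simp only [map_add]
      rw [Finset.sum_add_distrib, hs t (Finset.union_subset_left ht),
        hs' t (Finset.union_subset_right ht)]
    | tmul x y =>
      refine ⟨(φ y).support, fun t ht => ?_⟩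
      have h : ∑ g ∈ t, φ y g = counit (R := k) y := by
        rw [← sum_groupLikeCoeff h𝒢 hc hφ y]
        simp only [Finsupp.linearCombination_apply, smul_eq_mul, mul_one]
        exact (Finsupp.sum_of_support_subset _ ht (fun _ c => c) fun _ _ => rfl).symm
      simp [← h, Finset.sum_smul]
  obtain ⟨s, hs⟩ := key (comul (R := k) x)
  have h := hs s subset_rfl
  rw [lTensor_counit_comul, TensorProduct.rid_tmul, one_smul] at h
  have hx : x = ∑ g ∈ s, rightTranslate (groupLikeCoeff φ g) x := h.symm
  have hmem : ∑ g ∈ s, rightTranslate (groupLikeCoeff φ g) x ∈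
      Submodule.span k (Set.range fun g => rightTranslate (groupLikeCoeff φ g) x) :=
    sum_mem fun g _ => Submodule.subset_span ⟨g, rfl⟩
  rwa [← hx] at hmem

lemma leftTranslate_eq_smul (h𝒢 : 𝒢.deg 0 ≤ Submodule.span k {g : C | IsGroupLikeElem k g})
    (hφ : ∀ g : GroupLike k C, φ g.val = Finsupp.single g 1) (g : GroupLike k C) {x : C}
    (hx : x ∈ 𝒢.deg 0) :
    leftTranslate (groupLikeCoeff φ g) x = groupLikeCoeff φ g x • g.val := by
  have : Submodule.span k {g : C | IsGroupLikeElem k g} ≤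
      LinearMap.eqLocus (leftTranslate (groupLikeCoeff φ g))
        ((groupLikeCoeff φ g).smulRight g.val) := by
    refine Submodule.span_le.2 fun h hh => ?_
    have h₁ : comul (R := k) h = h ⊗ₜ[k] h := IsGroupLikeElem.comul_eq_tmul_self hh
    have h₂ : φ h = Finsupp.single ⟨h, hh⟩ 1 := hφ ⟨h, hh⟩
    by_cases hgh : (⟨h, hh⟩ : GroupLike k C) = g
    · subst hgh
      simp [leftTranslate, h₁, h₂]
    · simp [leftTranslate, h₁, h₂, Finsupp.single_eq_of_ne (Ne.symm hgh)]
  exact this (h𝒢 hx)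

lemma rightTranslate_eq_smul (h𝒢 : 𝒢.deg 0 ≤ Submodule.span k {g : C | IsGroupLikeElem k g})
    (hφ : ∀ g : GroupLike k C, φ g.val = Finsupp.single g 1) (g : GroupLike k C) {x : C}
    (hx : x ∈ 𝒢.deg 0) :
    rightTranslate (groupLikeCoeff φ g) x = groupLikeCoeff φ g x • g.val := by
  have : Submodule.span k {g : C | IsGroupLikeElem k g} ≤
      LinearMap.eqLocus (rightTranslate (groupLikeCoeff φ g))
        ((groupLikeCoeff φ g).smulRight g.val) := by
    refine Submodule.span_le.2 fun h hh => ?_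
    have h₁ : comul (R := k) h = h ⊗ₜ[k] h := IsGroupLikeElem.comul_eq_tmul_self hh
    have h₂ : φ h = Finsupp.single ⟨h, hh⟩ 1 := hφ ⟨h, hh⟩
    by_cases hgh : (⟨h, hh⟩ : GroupLike k C) = g
    · subst hgh
      simp [rightTranslate, h₁, h₂]
    · simp [rightTranslate, h₁, h₂, Finsupp.single_eq_of_ne (Ne.symm hgh)]
  exact this (h𝒢 hx)

/-- Cutting an element of degree `1` down on both sides makes it skew-primitive, because
`Δ(x) ∈ C₀ ⊗ C₁ + C₁ ⊗ C₀` and cutting down an element of `C₀` gives a multiple of a group-like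
element. -/
lemma isSkewPrimitive_translate (h𝒢 : 𝒢.deg 0 ≤ Submodule.span k {g : C | IsGroupLikeElem k g})
    (hc : 𝒢.IsConcentrated 0 φ) (hφ : ∀ g : GroupLike k C, φ g.val = Finsupp.single g 1)
    (g h : GroupLike k C) {x : C} (hx : x ∈ 𝒢.deg 1) :
    IsSkewPrimitive (k := k) g.val h.val
      (rightTranslate (groupLikeCoeff φ h) (leftTranslate (groupLikeCoeff φ g) x)) := by
  set L := leftTranslate (groupLikeCoeff φ g) with hL
  set R := rightTranslate (groupLikeCoeff φ h) with hR
  have hcoeff : ∀ g, 𝒢.IsConcentrated 0 (groupLikeCoeff φ g) := fun g => hc.comp _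
  have h₁ : comul (R := k) (R (L x)) = TensorProduct.map L R (comul (R := k) x) := by
    rw [hR, comul_rightTranslate, hL, comul_leftTranslate, TensorProduct.map_map]
    rfl
  have h₂ : R (L x) =
      TensorProduct.lid k C (TensorProduct.map (groupLikeCoeff φ g) R (comul (R := k) x)) := by
    have : ∀ z : C ⊗[k] C, R (TensorProduct.lid k C
        (TensorProduct.map (groupLikeCoeff φ g) LinearMap.id z)) =
          TensorProduct.lid k C (TensorProduct.map (groupLikeCoeff φ g) R z) := by
      intro z
      induction z with
      | zero => simp
      | add x y hx hy => simp only [map_add, hx, hy]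
      | tmul x y => simp
    exact this _
  have h₃ : R (L x) =
      TensorProduct.rid k C (TensorProduct.map L (groupLikeCoeff φ h) (comul (R := k) x)) := by
    change TensorProduct.rid k C (TensorProduct.map LinearMap.id (groupLikeCoeff φ h)
      (comul (R := k) (L x))) = _
    rw [hL, comul_leftTranslate, TensorProduct.map_map]
    rfl
  have h₄ := eq_on_tensorDegree (TensorProduct.map L R)
    (TensorProduct.mk k C C g.val ∘ₗ (TensorProduct.lid k C).toLinearMap ∘ₗ
        TensorProduct.map (groupLikeCoeff φ g) R +
      (TensorProduct.mk k C C).flip h.val ∘ₗ (TensorProduct.rid k C).toLinearMap ∘ₗ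
        TensorProduct.map L (groupLikeCoeff φ h)) (fun i j hij a ha b hb => by
      have hcases : (i = 0 ∧ j = 1) ∨ (i = 1 ∧ j = 0) := by omega
      rcases hcases with ⟨rfl, rfl⟩ | ⟨rfl, rfl⟩
      · have hb0 : groupLikeCoeff φ h b = 0 := (hcoeff h).eq_zero one_ne_zero hb
        rw [LinearMap.add_apply]
        simp only [LinearMap.comp_apply, TensorProduct.map_tmul, hb0]
        rw [hL, leftTranslate_eq_smul h𝒢 hφ g ha]
        simp [TensorProduct.smul_tmul]
      · have ha0 : groupLikeCoeff φ g a = 0 := (hcoeff g).eq_zero one_ne_zero ha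
        rw [LinearMap.add_apply]
        simp only [LinearMap.comp_apply, TensorProduct.map_tmul, ha0]
        rw [hR, rightTranslate_eq_smul h𝒢 hφ h hb]
        simp) (𝒢.comul_mem hx)
  rw [IsSkewPrimitive, h₁, h₄]
  simp only [LinearMap.add_apply, LinearMap.comp_apply, LinearEquiv.coe_coe, ← h₂, ← h₃]
  rfl

/-- If the component of degree `0` is spanned by group-like elements, then the component of
degree `1` is spanned by skew-primitive elements. -/
lemma deg_one_le_span_isSkewPrimitive
    (h𝒢 : 𝒢.deg 0 ≤ Submodule.span k {g : C | IsGroupLikeElem k g}) :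
    𝒢.deg 1 ≤ Submodule.span k
      {x : C | x ∈ 𝒢.deg 1 ∧ ∃ g h : GroupLike k C, IsSkewPrimitive (k := k) g.val h.val x} := by
  obtain ⟨φ, hc, hφ⟩ := exists_groupLike_coeff 𝒢
  intro x hx
  refine Submodule.span_le.2 ?_ (mem_span_leftTranslate h𝒢 hc hφ x)
  rintro _ ⟨g, rfl⟩
  refine Submodule.span_le.2 ?_ (mem_span_rightTranslate h𝒢 hc hφ _)
  rintro _ ⟨h, rfl⟩
  exact Submodule.subset_span ⟨rightTranslate_mem (hc.comp _) (leftTranslate_mem (hc.comp _) hx),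
    g, h, isSkewPrimitive_translate h𝒢 hc hφ g h hx⟩

end SkewPrimitive

end CoalgebraGrading

namespace PathCoalgebra

open Coalgebra CoalgebraGrading

variable (k : Type u) [Field k] {V : Type w₁} [Quiver.{w₂} V]

lemma isGroupLikeElem_ofPath_nil (a : V) :
    IsGroupLikeElem k (ofPath k (Quiver.Path.nil : Quiver.Path a a)) where
  counit_eq_one := by rw [counit_ofPath]; exact if_pos rfl
  comul_eq_tmul_self := by rw [comul_ofPath]; simp [pathSplits]

lemma isSkewPrimitive_ofPath_arrow {a b : V} (e : a ⟶ b) :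
    IsSkewPrimitive (k := k) (ofPath k (Quiver.Path.nil : Quiver.Path b b))
      (ofPath k (Quiver.Path.nil : Quiver.Path a a)) (ofPath k (Quiver.Path.nil.cons e)) := by
  rw [IsSkewPrimitive, comul_ofPath]
  simp [pathSplits]

lemma ofPath_nil_mem_degree (a : V) :
    ofPath k (Quiver.Path.nil : Quiver.Path a a) ∈ degree k V 0 :=
  Submodule.subset_span ⟨a, a, _, rfl, rfl⟩

lemma ofPath_arrow_mem_degree {a b : V} (e : a ⟶ b) :
    ofPath k (Quiver.Path.nil.cons e) ∈ degree k V 1 :=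
  Submodule.subset_span ⟨a, b, _, rfl, rfl⟩

variable {k}

/-- Two linear maps which agree on the vertices agree on the component of degree `0`. -/
lemma eq_on_degree_zero {M : Type*} [AddCommGroup M] [Module k M]
    {f g : PathCoalgebra k V →ₗ[k] M}
    (h : ∀ a : V, f (ofPath k (Quiver.Path.nil : Quiver.Path a a)) =
      g (ofPath k (Quiver.Path.nil : Quiver.Path a a)))
    {x : PathCoalgebra k V} (hx : x ∈ degree k V 0) : f x = g x := by
  refine eq_on_degree (fun a b p hp => ?_) hx
  obtain rfl := Quiver.Path.eq_of_length_zero p hp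
  obtain rfl := Quiver.Path.eq_nil_of_length_zero p hp
  exact h a

lemma exists_arrow_of_length_eq_one {a b : V} (p : Quiver.Path a b) (hp : p.length = 1) :
    ∃ e : a ⟶ b, p = Quiver.Path.nil.cons e := by
  cases p with
  | nil => simp at hp
  | cons p e =>
    obtain rfl := Quiver.Path.eq_of_length_zero p (by simpa using hp)
    obtain rfl := Quiver.Path.eq_nil_of_length_zero p (by simpa using hp)
    exact ⟨e, rfl⟩

/-- Two linear maps which agree on the arrows agree on the component of degree `1`. -/
lemma eq_on_degree_one {M : Type*} [AddCommGroup M] [Module k M]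
    {f g : PathCoalgebra k V →ₗ[k] M}
    (h : ∀ (a b : V) (e : a ⟶ b), f (ofPath k (Quiver.Path.nil.cons e)) =
      g (ofPath k (Quiver.Path.nil.cons e)))
    {x : PathCoalgebra k V} (hx : x ∈ degree k V 1) : f x = g x := by
  refine eq_on_degree (fun a b p hp => ?_) hx
  obtain ⟨e, rfl⟩ := exists_arrow_of_length_eq_one p hp
  exact h a b e

variable {M : Type*} [AddCommGroup M] [Module k M]

/-- The linear map, concentrated in degree `0`, with prescribed values on the vertices. -/
def vertexLift (F : V → M) : PathCoalgebra k V →ₗ[k] M :=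
  (basis k V).constr k fun p => if p.path.length = 0 then F p.src else 0

lemma vertexLift_ofPath_nil (F : V → M) (a : V) :
    vertexLift F (ofPath k (Quiver.Path.nil : Quiver.Path a a)) = F a :=
  ((basis k V).constr_basis k _ _).trans (if_pos rfl)

lemma vertexLift_isConcentrated (F : V → M) :
    (lengthGrading k V).IsConcentrated 0 (vertexLift F) :=
  isConcentrated_iff.2 fun _ hm _ hx => eq_on_degree (f := vertexLift F) (g := 0)
    (fun _ _ _ hp => ((basis k V).constr_basis k _ _).trans (if_neg (hp ▸ hm))) hx

/-- The value on a path of a family indexed by the arrows: the value at `e` for the path consisting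
of the arrow `e`, and zero for all other paths. -/
def arrowValue (F : ∀ a b : V, (a ⟶ b) → M) : ∀ {a b : V}, Quiver.Path a b → M
  | _, _, .nil => 0
  | _, _, .cons p e => if p.length = 0 then F _ _ e else 0

/-- The linear map, concentrated in degree `1`, with prescribed values on the arrows. -/
def arrowLift (F : ∀ a b : V, (a ⟶ b) → M) : PathCoalgebra k V →ₗ[k] M :=
  (basis k V).constr k fun p => arrowValue F p.path

lemma arrowLift_ofPath_arrow (F : ∀ a b : V, (a ⟶ b) → M) {a b : V} (e : a ⟶ b) :
    arrowLift F (ofPath k (Quiver.Path.nil.cons e)) = F a b e :=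
  ((basis k V).constr_basis k _ _).trans
    (if_pos (c := (Quiver.Path.nil : Quiver.Path a a).length = 0) (t := F a b e) (e := 0) rfl)

lemma arrowLift_isConcentrated (F : ∀ a b : V, (a ⟶ b) → M) :
    (lengthGrading k V).IsConcentrated 1 (arrowLift F) :=
  isConcentrated_iff.2 fun n hn _ hx => eq_on_degree (f := arrowLift F) (g := 0)
    (fun a b p hp => by
      refine ((basis k V).constr_basis k _ _).trans ?_
      cases p with
      | nil => rfl
      | cons p e => exact if_neg (fun h => hn (by rw [← hp, Quiver.Path.length_cons, h]))) hx

variable {C : Type v} [AddCommGroup C] [Module k C] [Coalgebra k C]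

/-- The quiver of a graded coalgebra whose component of degree `0` is spanned by group-like
elements: its vertices are the group-like elements, and its arrows from `h` to `g` are the
`(g, h)`-skew-primitive members of a basis of the component of degree `1`. -/
lemma exists_quiver_truncatedIso (𝒢 : CoalgebraGrading k C)
    (h𝒢 : 𝒢.deg 0 ≤ Submodule.span k {g : C | IsGroupLikeElem k g}) :
    ∃ (V : Type v) (_ : Quiver.{v} V), Nonempty (TruncatedIso (lengthGrading k V) 𝒢) := by
  obtain ⟨T, hTS, hspan, hli⟩ := exists_linearIndependent k
    {x : C | x ∈ 𝒢.deg 1 ∧ ∃ g h : GroupLike k C, IsSkewPrimitive (k := k) g.val h.val x}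
  have hT₁ : ∀ t : T, (t : C) ∈ 𝒢.deg 1 := fun t => (hTS t.2).1
  have hT : ∀ t : T, ∃ g h : GroupLike k C, IsSkewPrimitive (k := k) g.val h.val (t : C) :=
    fun t => (hTS t.2).2
  choose tgt src hskew using hT
  let _ : Quiver.{v} (GroupLike k C) := ⟨fun a b => {t : T // src t = a ∧ tgt t = b}⟩
  refine ⟨GroupLike k C, inferInstance, ?_⟩
  let ℒ := lengthGrading k (GroupLike k C)
  let σ₀ : PathCoalgebra k (GroupLike k C) →ₗ[k] C := vertexLift GroupLike.val
  let σ₁ : PathCoalgebra k (GroupLike k C) →ₗ[k] C :=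
    arrowLift fun a b (e : {t : T // src t = a ∧ tgt t = b}) => (e.1 : C)
  have hσ₀ : ∀ a : GroupLike k C,
      σ₀ (ofPath k (Quiver.Path.nil : Quiver.Path a a)) = a.val := vertexLift_ofPath_nil _
  have hσ₁ : ∀ (a b : GroupLike k C) (e : a ⟶ b),
      σ₁ (ofPath k (Quiver.Path.nil.cons e)) = (e.1 : C) :=
    fun a b e => arrowLift_ofPath_arrow _ e
  have hc₀ : ℒ.IsConcentrated 0 σ₀ := vertexLift_isConcentrated _
  have hc₁ : ℒ.IsConcentrated 1 σ₁ := arrowLift_isConcentrated _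
  have hm₀ : ∀ x ∈ ℒ.deg 0, σ₀ x ∈ 𝒢.deg 0 := fun x hx =>
    (eq_on_degree_zero (f := 𝒢.proj 0 ∘ₗ σ₀) (g := σ₀) (fun a => by
      rw [LinearMap.comp_apply, hσ₀]
      exact 𝒢.proj_of_mem (𝒢.mem_deg_zero_of_isGroupLikeElem a.2)) hx) ▸ 𝒢.proj_mem 0 _
  have hm₁ : ∀ x ∈ ℒ.deg 1, σ₁ x ∈ 𝒢.deg 1 := fun x hx =>
    (eq_on_degree_one (f := 𝒢.proj 1 ∘ₗ σ₁) (g := σ₁) (fun a b e => by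
      rw [LinearMap.comp_apply, hσ₁]
      exact 𝒢.proj_of_mem (hT₁ _)) hx) ▸ 𝒢.proj_mem 1 _
  have hσ : IsTruncatedHom ℒ 𝒢 σ₀ σ₁ := by
    refine ⟨hc₀, hc₁, fun x => hc₀ x ▸ hm₀ _ (ℒ.proj_mem 0 x),
      fun x => hc₁ x ▸ hm₁ _ (ℒ.proj_mem 1 x),
      fun x => LinearMap.congr_fun (f := counit (R := k) ∘ₗ σ₀) (g := counit (R := k)) ?_ x,
      fun x => LinearMap.congr_fun (f := comul (R := k) ∘ₗ σ₀)
        (g := TensorProduct.map σ₀ σ₀ ∘ₗ comul (R := k)) ?_ x,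
      fun x => LinearMap.congr_fun (f := comul (R := k) ∘ₗ σ₁) (g := TensorProduct.map σ₀ σ₁ ∘ₗ
        comul (R := k) + TensorProduct.map σ₁ σ₀ ∘ₗ comul (R := k)) ?_ x⟩
    · refine (hc₀.comp (counit (R := k))).ext ℒ.counit_proj_zero fun x hx =>
        eq_on_degree_zero (fun a => ?_) hx
      rw [LinearMap.comp_apply, hσ₀, a.2.counit_eq_one,
        (isGroupLikeElem_ofPath_nil k a).counit_eq_one]
    · refine (hc₀.comp (comul (R := k))).ext (hc₀.map_comul hc₀ rfl) fun x hx =>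
        eq_on_degree_zero (fun a => ?_) hx
      rw [LinearMap.comp_apply, LinearMap.comp_apply, hσ₀, a.2.comul_eq_tmul_self,
        (isGroupLikeElem_ofPath_nil k a).comul_eq_tmul_self, TensorProduct.map_tmul, hσ₀]
    · have hsum : ℒ.IsConcentrated 1 (TensorProduct.map σ₀ σ₁ ∘ₗ comul (R := k) +
          TensorProduct.map σ₁ σ₀ ∘ₗ comul (R := k)) := fun x =>
        congrArg₂ (· + ·) (hc₀.map_comul hc₁ rfl x) (hc₁.map_comul hc₀ rfl x)
      refine (hc₁.comp (comul (R := k))).ext hsum fun x hx =>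
        eq_on_degree_one (fun a b e => ?_) hx
      have h₁₀ : ∀ a : GroupLike k C,
          σ₁ (ofPath k (Quiver.Path.nil : Quiver.Path a a)) = 0 := fun a =>
        hc₁.eq_zero zero_ne_one (ofPath_nil_mem_degree k a)
      have h₀₁ : σ₀ (ofPath k (Quiver.Path.nil.cons e)) = 0 :=
        hc₀.eq_zero one_ne_zero (ofPath_arrow_mem_degree k e)
      have hs := hskew e.1
      rw [e.2.1, e.2.2] at hs
      have hp := isSkewPrimitive_ofPath_arrow k e
      rw [IsSkewPrimitive] at hs hp
      rw [LinearMap.add_apply, LinearMap.comp_apply, LinearMap.comp_apply, LinearMap.comp_apply,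
        hσ₁, hp, hs]
      simp only [map_add, TensorProduct.map_tmul, hσ₀, hσ₁, h₁₀, h₀₁,
        TensorProduct.tmul_zero, add_zero, zero_add]
  -- `θ₀` and `θ₁` are left inverses of `σ₀` and `σ₁`, built from the coefficients with respect to
  -- the group-like elements and to the basis `T`.
  obtain ⟨φ, -, hφ⟩ := exists_groupLike_coeff 𝒢
  obtain ⟨ψ, hψ⟩ := LinearMap.exists_extend hli.repr
  have hψ' : ∀ t : T, ψ t = Finsupp.single t 1 := fun t =>
    (LinearMap.congr_fun hψ ⟨(t : C), Submodule.subset_span ⟨t, rfl⟩⟩).trans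
      (hli.repr_eq_single t _ rfl)
  let θ₀ : C →ₗ[k] PathCoalgebra k (GroupLike k C) := Finsupp.linearCombination k
    (fun a : GroupLike k C => ofPath k (Quiver.Path.nil : Quiver.Path a a)) ∘ₗ φ
  let arr : ∀ t : T, src t ⟶ tgt t := fun t => ⟨t, rfl, rfl⟩
  let θ₁ : C →ₗ[k] PathCoalgebra k (GroupLike k C) := Finsupp.linearCombination k
    (fun t : T => ofPath k (Quiver.Path.nil.cons (arr t))) ∘ₗ ψ
  have hθ₀ : ∀ a : GroupLike k C,
      θ₀ a.val = ofPath k (Quiver.Path.nil : Quiver.Path a a) := fun a => by simp [θ₀, hφ]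
  have hθ₁ : ∀ t : T, θ₁ t = ofPath k (Quiver.Path.nil.cons (arr t)) := fun t => by
    simp [θ₁, hψ']
  have hinj₀ : ∀ x ∈ ℒ.deg 0, σ₀ x = 0 → x = 0 := fun x hx h => by
    have : (θ₀ ∘ₗ σ₀) x = LinearMap.id x := eq_on_degree_zero (fun a => by
      rw [LinearMap.comp_apply, hσ₀, hθ₀, LinearMap.id_apply]) hx
    rw [← LinearMap.id_apply (R := k) x, ← this, LinearMap.comp_apply, h, map_zero]
  have hinj₁ : ∀ x ∈ ℒ.deg 1, σ₁ x = 0 → x = 0 := fun x hx h => by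
    have : (θ₁ ∘ₗ σ₁) x = LinearMap.id x := eq_on_degree_one (fun a b e => by
      obtain ⟨t, rfl, rfl⟩ := e
      rw [LinearMap.comp_apply, hσ₁]
      exact hθ₁ t) hx
    rw [← LinearMap.id_apply (R := k) x, ← this, LinearMap.comp_apply, h, map_zero]
  have hsurj₀ : 𝒢.deg 0 ≤ (ℒ.deg 0).map σ₀ := by
    refine h𝒢.trans (Submodule.span_le.2 fun g hg => ?_)
    exact Submodule.mem_map.2 ⟨_, ofPath_nil_mem_degree k (⟨g, hg⟩ : GroupLike k C), hσ₀ _⟩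
  have hsurj₁ : 𝒢.deg 1 ≤ (ℒ.deg 1).map σ₁ := by
    refine (deg_one_le_span_isSkewPrimitive h𝒢).trans ?_
    rw [← hspan]
    refine Submodule.span_le.2 fun t ht => ?_
    exact Submodule.mem_map.2 ⟨_, ofPath_arrow_mem_degree k (arr ⟨t, ht⟩), hσ₁ _ _ _⟩
  obtain ⟨e, -, -⟩ := TruncatedIso.exists_of_bijective hσ hinj₀ hinj₁
    (fun y hy => Submodule.mem_map.1 (hsurj₀ hy)) (fun y hy => Submodule.mem_map.1 (hsurj₁ hy))
  exact ⟨e⟩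

/-- A truncated isomorphism between path coalgebras extends to an isomorphism `F` of graded
coalgebras, whose inverse `F'` is the extension of the inverse truncated isomorphism. -/
lemma exists_coalgHom_inverse {W : Type*} [Quiver W]
    (e : TruncatedIso (lengthGrading k V) (lengthGrading k W)) :
    ∃ (F : PathCoalgebra k V →ₗc[k] PathCoalgebra k W)
      (F' : PathCoalgebra k W →ₗc[k] PathCoalgebra k V),
      (∀ n, ∀ x ∈ degree k V n, F x ∈ degree k W n) ∧
      (∀ n, ∀ x ∈ degree k W n, F' x ∈ degree k V n) ∧
      (∀ x ∈ degree k V 0, F x = e.f₀ x) ∧ (∀ x ∈ degree k V 1, F x = e.f₁ x) ∧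
      (∀ x, F' (F x) = x) ∧ ∀ y, F (F' y) = y := by
  obtain ⟨F, hF, hF₀, hF₁⟩ := exists_coalgHom_extending e.hom
  obtain ⟨F', hF', hF'₀, hF'₁⟩ := exists_coalgHom_extending e.inv
  refine ⟨F, F', hF, hF', hF₀, hF₁, fun x => ?_, fun y => ?_⟩
  · have : F'.comp F = CoalgHom.id k _ := coalgHom_ext (𝒢 := lengthGrading k V)
      (fun n x hx => hF' n _ (hF n x hx)) (fun n x hx => hx)
      (fun x hx => by
        rw [CoalgHom.comp_apply, hF₀ x hx, hF'₀ _ (e.hom.mem_zero x), e.left_inv_zero x hx]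
        rfl)
      (fun x hx => by
        rw [CoalgHom.comp_apply, hF₁ x hx, hF'₁ _ (e.hom.mem_one x), e.left_inv_one x hx]
        rfl)
    exact congrArg (fun f => f x) this
  · have : F.comp F' = CoalgHom.id k _ := coalgHom_ext (𝒢 := lengthGrading k W)
      (fun n x hx => hF n _ (hF' n x hx)) (fun n x hx => hx)
      (fun x hx => by
        rw [CoalgHom.comp_apply, hF'₀ x hx, hF₀ _ (e.inv.mem_zero x), e.right_inv_zero x hx]
        rfl)
      (fun x hx => by
        rw [CoalgHom.comp_apply, hF'₁ x hx, hF₁ _ (e.inv.mem_one x), e.right_inv_one x hx]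
        rfl)
    exact congrArg (fun f => f y) this

end PathCoalgebra

/-! ### The graded bialgebra structure on the path coalgebra -/

namespace CoalgebraGrading

open Coalgebra

variable {k : Type*} [Field k] {C D E P : Type*}
  [AddCommGroup C] [Module k C] [Coalgebra k C] [AddCommGroup D] [Module k D] [Coalgebra k D]
  [AddCommGroup E] [Module k E] [Coalgebra k E] [AddCommGroup P] [Module k P] [Coalgebra k P]
  {𝒢 : CoalgebraGrading k C} {ℋ : CoalgebraGrading k D} {𝒦 : CoalgebraGrading k E}
  {𝒬 : CoalgebraGrading k P}

lemma isGraded_tensor {f : C ⊗[k] D →ₗ[k] P}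
    (h : ∀ i j, ∀ x ∈ 𝒢.deg i, ∀ y ∈ ℋ.deg j, f (x ⊗ₜ y) ∈ 𝒬.deg (i + j)) :
    IsGraded (𝒢.tensor ℋ) 𝒬 f := fun n z hz => by
  have : tensorDegree 𝒢.deg ℋ.deg n ≤ (𝒬.deg n).comap f :=
    tensorDegree_le fun i j hij a ha b hb => hij ▸ h i j a ha b hb
  exact this hz

lemma eq_on_tensor {M : Type*} [AddCommGroup M] [Module k M] {f g : C ⊗[k] D →ₗ[k] M} {n : ℕ}
    (h : ∀ i j, i + j = n → ∀ x ∈ 𝒢.deg i, ∀ y ∈ ℋ.deg j, f (x ⊗ₜ y) = g (x ⊗ₜ y)) :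
    ∀ z ∈ (𝒢.tensor ℋ).deg n, f z = g z :=
  fun _ hz => eq_on_tensorDegree f g h hz

lemma isGraded_tensor_tensor {f : (C ⊗[k] D) ⊗[k] E →ₗ[k] P}
    (h : ∀ i j l, ∀ x ∈ 𝒢.deg i, ∀ y ∈ ℋ.deg j, ∀ z ∈ 𝒦.deg l,
      f ((x ⊗ₜ y) ⊗ₜ z) ∈ 𝒬.deg (i + j + l)) :
    IsGraded ((𝒢.tensor ℋ).tensor 𝒦) 𝒬 f := isGraded_tensor fun n l w hw z hz => by
  have : tensorDegree 𝒢.deg ℋ.deg n ≤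
      (𝒬.deg (n + l)).comap (f ∘ₗ (TensorProduct.mk k _ _).flip z) :=
    tensorDegree_le fun i j hij a ha b hb => hij ▸ h i j l a ha b hb z hz
  exact this hw

lemma eq_on_tensor_tensor {M : Type*} [AddCommGroup M] [Module k M]
    {f g : (C ⊗[k] D) ⊗[k] E →ₗ[k] M} {n : ℕ}
    (h : ∀ i j l, i + j + l = n → ∀ x ∈ 𝒢.deg i, ∀ y ∈ ℋ.deg j, ∀ z ∈ 𝒦.deg l,
      f ((x ⊗ₜ y) ⊗ₜ z) = g ((x ⊗ₜ y) ⊗ₜ z)) :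
    ∀ z ∈ ((𝒢.tensor ℋ).tensor 𝒦).deg n, f z = g z :=
  eq_on_tensor fun _ l hml w hw z hz =>
    eq_on_tensorDegree (f ∘ₗ (TensorProduct.mk k _ _).flip z)
      (g ∘ₗ (TensorProduct.mk k _ _).flip z)
      (fun i j hij a ha b hb => h i j l (by omega) a ha b hb z hz) hw

end CoalgebraGrading

namespace PathCoalgebra

open Coalgebra CoalgebraGrading

variable {k : Type u} [Field k] {V : Type w₁} [Quiver.{w₂} V]
  {G : Type v} [Ring G] [Bialgebra k G] {𝒢 : CoalgebraGrading k G}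

/-- The coalgebra maps `Θ : G → kQ` and `M : kQ ⊗ kQ → kQ` which extend a truncated isomorphism and
the multiplication of `G` in degrees at most `1`. -/
lemma exists_coalgHom_mul (hmul : ∀ i j, ∀ x ∈ 𝒢.deg i, ∀ y ∈ 𝒢.deg j, x * y ∈ 𝒢.deg (i + j))
    (e : TruncatedIso (lengthGrading k V) 𝒢) :
    ∃ (Θ : G →ₗc[k] PathCoalgebra k V)
      (M : PathCoalgebra k V ⊗[k] PathCoalgebra k V →ₗc[k] PathCoalgebra k V),
      (∀ n, ∀ x ∈ 𝒢.deg n, Θ x ∈ degree k V n) ∧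
      (∀ i j, ∀ x ∈ degree k V i, ∀ y ∈ degree k V j, M (x ⊗ₜ y) ∈ degree k V (i + j)) ∧
      (∀ n ≤ 1, ∀ x ∈ 𝒢.deg n, Θ x = 0 → x = 0) ∧
      (∀ n ≤ 1, ∀ y ∈ degree k V n, ∃ x ∈ 𝒢.deg n, Θ x = y) ∧
      ∀ i j, i + j ≤ 1 → ∀ x ∈ 𝒢.deg i, ∀ y ∈ 𝒢.deg j, M (Θ x ⊗ₜ Θ y) = Θ (x * y) := by
  let ℒ := lengthGrading k V
  obtain ⟨Θ, hΘ, hΘ₀, hΘ₁⟩ := exists_coalgHom_extending e.inv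
  replace hΘ : ∀ n, ∀ x ∈ 𝒢.deg n, Θ x ∈ degree k V n := hΘ
  have hm : IsGraded (𝒢.tensor 𝒢) 𝒢 (Bialgebra.mulCoalgHom k G : G ⊗[k] G →ₗ[k] G) :=
    isGraded_tensor fun i j x hx y hy => by
      rw [Bialgebra.toLinearMap_mulCoalgHom, LinearMap.mul'_apply]
      exact hmul i j x hx y hy
  obtain ⟨M, hM, hM₀, hM₁⟩ := exists_coalgHom_extending
    (e.inv.comp ((IsTruncatedHom.of_isGraded hm).comp (e.hom.tensor e.hom)))
  have hf₀Θ : ∀ x ∈ 𝒢.deg 0, e.f₀ (Θ x) = x := fun x hx => by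
    rw [hΘ₀ x hx, e.right_inv_zero x hx]
  have hf₁Θ : ∀ x ∈ 𝒢.deg 1, e.f₁ (Θ x) = x := fun x hx => by
    rw [hΘ₁ x hx, e.right_inv_one x hx]
  have hf₁Θ' : ∀ x ∈ 𝒢.deg 0, e.f₁ (Θ x) = 0 := fun x hx =>
    e.hom.conc_one.eq_zero zero_ne_one (hΘ 0 x hx)
  have hf₀Θ' : ∀ x ∈ 𝒢.deg 1, e.f₀ (Θ x) = 0 := fun x hx =>
    e.hom.conc_zero.eq_zero one_ne_zero (hΘ 1 x hx)
  refine ⟨Θ, M, hΘ, fun i j x hx y hy => hM (i + j) _ (tmul_mem_tensor ℒ ℒ rfl hx hy), ?_, ?_, ?_⟩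
  · intro n hn x hx h
    obtain rfl | rfl : n = 0 ∨ n = 1 := by omega
    · rw [← hf₀Θ x hx, h, map_zero]
    · rw [← hf₁Θ x hx, h, map_zero]
  · intro n hn y hy
    obtain rfl | rfl : n = 0 ∨ n = 1 := by omega
    · exact ⟨e.f₀ y, e.hom.mem_zero y, by
        rw [hΘ₀ _ (e.hom.mem_zero y), e.left_inv_zero y hy]⟩
    · exact ⟨e.f₁ y, e.hom.mem_one y, by
        rw [hΘ₁ _ (e.hom.mem_one y), e.left_inv_one y hy]⟩
  · intro i j hij x hx y hy
    have hcases : (i = 0 ∧ j = 0) ∨ (i = 0 ∧ j = 1) ∨ (i = 1 ∧ j = 0) := by omega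
    rcases hcases with ⟨rfl, rfl⟩ | ⟨rfl, rfl⟩ | ⟨rfl, rfl⟩
    · rw [hM₀ _ (tmul_mem_tensor ℒ ℒ (add_zero 0) (hΘ 0 x hx) (hΘ 0 y hy)), LinearMap.comp_apply,
        LinearMap.comp_apply, LinearMap.comp_apply, TensorProduct.map_tmul, hf₀Θ x hx, hf₀Θ y hy,
        (𝒢.tensor 𝒢).proj_of_mem (tmul_mem_tensor 𝒢 𝒢 (add_zero 0) hx hy),
        hΘ₀ _ (hmul 0 0 x hx y hy)]
      rfl
    · rw [hM₁ _ (tmul_mem_tensor ℒ ℒ (zero_add 1) (hΘ 0 x hx) (hΘ 1 y hy)), LinearMap.comp_apply,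
        LinearMap.comp_apply, LinearMap.comp_apply, LinearMap.add_apply, TensorProduct.map_tmul,
        TensorProduct.map_tmul, hf₀Θ x hx, hf₁Θ y hy, hf₁Θ' x hx, TensorProduct.zero_tmul, add_zero,
        (𝒢.tensor 𝒢).proj_of_mem (tmul_mem_tensor 𝒢 𝒢 (zero_add 1) hx hy),
        hΘ₁ _ (hmul 0 1 x hx y hy)]
      rfl
    · rw [hM₁ _ (tmul_mem_tensor ℒ ℒ (add_zero 1) (hΘ 1 x hx) (hΘ 0 y hy)), LinearMap.comp_apply,
        LinearMap.comp_apply, LinearMap.comp_apply, LinearMap.add_apply, TensorProduct.map_tmul,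
        TensorProduct.map_tmul, hf₁Θ x hx, hf₀Θ y hy, hf₀Θ' x hx, TensorProduct.zero_tmul, zero_add,
        (𝒢.tensor 𝒢).proj_of_mem (tmul_mem_tensor 𝒢 𝒢 (add_zero 1) hx hy),
        hΘ₁ _ (hmul 1 0 x hx y hy)]
      rfl

section Structure

variable {Θ : G →ₗc[k] PathCoalgebra k V}
  {M : PathCoalgebra k V ⊗[k] PathCoalgebra k V →ₗc[k] PathCoalgebra k V}

/-- The multiplication `M` is associative: both sides are graded coalgebra maps
`kQ ⊗ kQ ⊗ kQ → kQ`, and in degrees at most `1`, where `Θ` is surjective, they agree by the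
associativity of `G`. The unit laws and the multiplicativity of `Θ` follow in the same way. -/
lemma coalgHom_mul_assoc
    (hmul : ∀ i j, ∀ x ∈ 𝒢.deg i, ∀ y ∈ 𝒢.deg j, x * y ∈ 𝒢.deg (i + j))
    (hM : ∀ i j, ∀ x ∈ degree k V i, ∀ y ∈ degree k V j, M (x ⊗ₜ y) ∈ degree k V (i + j))
    (hsurj : ∀ n ≤ 1, ∀ y ∈ degree k V n, ∃ x ∈ 𝒢.deg n, Θ x = y)
    (hMΘ : ∀ i j, i + j ≤ 1 → ∀ x ∈ 𝒢.deg i, ∀ y ∈ 𝒢.deg j, M (Θ x ⊗ₜ Θ y) = Θ (x * y))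
    (x y z : PathCoalgebra k V) : M (M (x ⊗ₜ y) ⊗ₜ z) = M (x ⊗ₜ M (y ⊗ₜ z)) := by
  let f : (PathCoalgebra k V ⊗[k] PathCoalgebra k V) ⊗[k] PathCoalgebra k V →ₗc[k]
      PathCoalgebra k V := M.comp (Coalgebra.TensorProduct.map M (CoalgHom.id k _))
  let g : (PathCoalgebra k V ⊗[k] PathCoalgebra k V) ⊗[k] PathCoalgebra k V →ₗc[k]
      PathCoalgebra k V := (M.comp (Coalgebra.TensorProduct.map (CoalgHom.id k _) M)).comp
        (Coalgebra.TensorProduct.assoc k k (PathCoalgebra k V) (PathCoalgebra k V)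
          (PathCoalgebra k V)).toCoalgHom
  let ℒ := lengthGrading k V
  have key : ∀ i j l, i + j + l ≤ 1 → ∀ x ∈ ℒ.deg i, ∀ y ∈ ℒ.deg j, ∀ z ∈ ℒ.deg l,
      f ((x ⊗ₜ y) ⊗ₜ z) = g ((x ⊗ₜ y) ⊗ₜ z) := by
    intro i j l hijl x hx y hy z hz
    obtain ⟨a, ha, rfl⟩ := hsurj i (by omega) x hx
    obtain ⟨b, hb, rfl⟩ := hsurj j (by omega) y hy
    obtain ⟨c, hc, rfl⟩ := hsurj l (by omega) z hz
    change M (M (Θ a ⊗ₜ Θ b) ⊗ₜ Θ c) = M (Θ a ⊗ₜ M (Θ b ⊗ₜ Θ c))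
    rw [hMΘ i j (by omega) a ha b hb, hMΘ j l (by omega) b hb c hc,
      hMΘ (i + j) l hijl _ (hmul i j a ha b hb) c hc,
      hMΘ i (j + l) (by omega) a ha _ (hmul j l b hb c hc), mul_assoc]
  have heq : ∀ n ≤ 1, ∀ w ∈ ((ℒ.tensor ℒ).tensor ℒ).deg n, f w = g w := fun n hn =>
    eq_on_tensor_tensor (f := f.toLinearMap) (g := g.toLinearMap)
      fun i j l h => key i j l (by omega)
  have hfg : f = g := coalgHom_ext (𝒢 := (ℒ.tensor ℒ).tensor ℒ)
    (isGraded_tensor_tensor fun i j l x hx y hy z hz => hM _ l _ (hM i j x hx y hy) z hz)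
    (isGraded_tensor_tensor fun i j l x hx y hy z hz =>
      (add_assoc i j l).symm ▸ hM i _ x hx _ (hM j l y hy z hz))
    (heq 0 zero_le_one) (heq 1 le_rfl)
  exact congrArg (fun φ => φ ((x ⊗ₜ y) ⊗ₜ z)) hfg

lemma coalgHom_one_mul (hone : (1 : G) ∈ 𝒢.deg 0) (hΘ : ∀ n, ∀ x ∈ 𝒢.deg n, Θ x ∈ degree k V n)
    (hM : ∀ i j, ∀ x ∈ degree k V i, ∀ y ∈ degree k V j, M (x ⊗ₜ y) ∈ degree k V (i + j))
    (hsurj : ∀ n ≤ 1, ∀ y ∈ degree k V n, ∃ x ∈ 𝒢.deg n, Θ x = y)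
    (hMΘ : ∀ i j, i + j ≤ 1 → ∀ x ∈ 𝒢.deg i, ∀ y ∈ 𝒢.deg j, M (Θ x ⊗ₜ Θ y) = Θ (x * y))
    (x : PathCoalgebra k V) : M (Θ 1 ⊗ₜ x) = x := by
  let f : PathCoalgebra k V →ₗc[k] PathCoalgebra k V :=
    (M.comp (Coalgebra.TensorProduct.map (Θ.comp (Bialgebra.unitBialgHom k G : k →ₗc[k] G))
      (CoalgHom.id k _))).comp (Coalgebra.TensorProduct.lid k (PathCoalgebra k V)).symm.toCoalgHom
  have hf : ∀ x, f x = M (Θ 1 ⊗ₜ x) := fun x => by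
    change M (Θ (algebraMap k G 1) ⊗ₜ x) = _
    rw [map_one]
  have key : ∀ n ≤ 1, ∀ x ∈ degree k V n, f x = x := by
    intro n hn x hx
    obtain ⟨a, ha, rfl⟩ := hsurj n hn x hx
    rw [hf, hMΘ 0 n (by omega) 1 hone a ha, one_mul]
  have hfid : f = CoalgHom.id k _ := coalgHom_ext (𝒢 := lengthGrading k V)
    (fun n x hx => by
      have := hM 0 n _ (hΘ 0 1 hone) x hx
      rw [zero_add, ← hf] at this
      exact this) (fun n x hx => hx) (key 0 (by omega)) (key 1 le_rfl)
  exact (hf x).symm.trans (congrArg (fun φ => φ x) hfid)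

lemma coalgHom_mul_one (hone : (1 : G) ∈ 𝒢.deg 0) (hΘ : ∀ n, ∀ x ∈ 𝒢.deg n, Θ x ∈ degree k V n)
    (hM : ∀ i j, ∀ x ∈ degree k V i, ∀ y ∈ degree k V j, M (x ⊗ₜ y) ∈ degree k V (i + j))
    (hsurj : ∀ n ≤ 1, ∀ y ∈ degree k V n, ∃ x ∈ 𝒢.deg n, Θ x = y)
    (hMΘ : ∀ i j, i + j ≤ 1 → ∀ x ∈ 𝒢.deg i, ∀ y ∈ 𝒢.deg j, M (Θ x ⊗ₜ Θ y) = Θ (x * y))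
    (x : PathCoalgebra k V) : M (x ⊗ₜ Θ 1) = x := by
  let f : PathCoalgebra k V →ₗc[k] PathCoalgebra k V :=
    (M.comp (Coalgebra.TensorProduct.map (CoalgHom.id k _)
      (Θ.comp (Bialgebra.unitBialgHom k G : k →ₗc[k] G)))).comp
        (Coalgebra.TensorProduct.rid k k (PathCoalgebra k V)).symm.toCoalgHom
  have hf : ∀ x, f x = M (x ⊗ₜ Θ 1) := fun x => by
    change M (x ⊗ₜ Θ (algebraMap k G 1)) = _
    rw [map_one]
  have key : ∀ n ≤ 1, ∀ x ∈ degree k V n, f x = x := by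
    intro n hn x hx
    obtain ⟨a, ha, rfl⟩ := hsurj n hn x hx
    rw [hf, hMΘ n 0 (by omega) a ha 1 hone, mul_one]
  have hfid : f = CoalgHom.id k _ := coalgHom_ext (𝒢 := lengthGrading k V)
    (fun n x hx => by
      have := hM n 0 x hx _ (hΘ 0 1 hone)
      rw [add_zero, ← hf] at this
      exact this) (fun n x hx => hx) (key 0 (by omega)) (key 1 le_rfl)
  exact (hf x).symm.trans (congrArg (fun φ => φ x) hfid)

lemma coalgHom_map_mul
    (hmul : ∀ i j, ∀ x ∈ 𝒢.deg i, ∀ y ∈ 𝒢.deg j, x * y ∈ 𝒢.deg (i + j))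
    (hΘ : ∀ n, ∀ x ∈ 𝒢.deg n, Θ x ∈ degree k V n)
    (hM : ∀ i j, ∀ x ∈ degree k V i, ∀ y ∈ degree k V j, M (x ⊗ₜ y) ∈ degree k V (i + j))
    (hMΘ : ∀ i j, i + j ≤ 1 → ∀ x ∈ 𝒢.deg i, ∀ y ∈ 𝒢.deg j, M (Θ x ⊗ₜ Θ y) = Θ (x * y))
    (x y : G) : Θ (x * y) = M (Θ x ⊗ₜ Θ y) := by
  let f : G ⊗[k] G →ₗc[k] PathCoalgebra k V := Θ.comp (Bialgebra.mulCoalgHom k G)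
  let g : G ⊗[k] G →ₗc[k] PathCoalgebra k V := M.comp (Coalgebra.TensorProduct.map Θ Θ)
  have hf : ∀ x y, f (x ⊗ₜ y) = Θ (x * y) := fun x y => rfl
  have hg : ∀ x y, g (x ⊗ₜ y) = M (Θ x ⊗ₜ Θ y) := fun x y => rfl
  have heq : ∀ n ≤ 1, ∀ w ∈ (𝒢.tensor 𝒢).deg n, f w = g w := fun n hn =>
    eq_on_tensor (f := f.toLinearMap) (g := g.toLinearMap)
      fun i j h x hx y hy => (hMΘ i j (by omega) x hx y hy).symm
  have hfg : f = g := coalgHom_ext (𝒢 := 𝒢.tensor 𝒢)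
    (isGraded_tensor fun i j x hx y hy => hΘ _ _ (hmul i j x hx y hy))
    (isGraded_tensor fun i j x hx y hy => hM i j _ (hΘ i x hx) _ (hΘ j y hy))
    (heq 0 zero_le_one) (heq 1 le_rfl)
  rw [← hf, ← hg, hfg]

lemma map_tensorTensorTensorComm (φ : PathCoalgebra k V ⊗[k] PathCoalgebra k V →ₗ[k]
      PathCoalgebra k V) (z w : PathCoalgebra k V ⊗[k] PathCoalgebra k V) :
    TensorProduct.map φ φ
      (TensorProduct.AlgebraTensorModule.tensorTensorTensorComm k k k k _ _ _ _ (z ⊗ₜ w)) =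
      TensorProduct.map₂ (TensorProduct.curry φ) (TensorProduct.curry φ) z w := by
  induction z with
  | zero => simp
  | add z z' hz hz' => simp only [TensorProduct.add_tmul, map_add, LinearMap.add_apply, hz, hz']
  | tmul a b =>
    induction w with
    | zero => simp
    | add w w' hw hw' => simp only [TensorProduct.tmul_add, map_add, hw, hw']
    | tmul c d => rw [TensorProduct.map₂_apply_tmul]; simp

/-- Existence of the quiver and of the embedding: a truncated isomorphism from a path coalgebra to a
graded bialgebra `G` transports the multiplication to the path coalgebra. -/
lemma exists_structure (hstrict : 𝒢.IsStrict) (hone : (1 : G) ∈ 𝒢.deg 0)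
    (hmul : ∀ i j, ∀ x ∈ 𝒢.deg i, ∀ y ∈ 𝒢.deg j, x * y ∈ 𝒢.deg (i + j))
    (e : TruncatedIso (lengthGrading k V) 𝒢) :
    ∃ (S : PathBialgebraStructure k V) (Θ : G →ₐc[k] PathBialgebra S),
      Function.Injective Θ ∧
      (∀ y ∈ PathBialgebra.degree S 0 ⊔ PathBialgebra.degree S 1, y ∈ Set.range Θ) ∧
      ∀ n, ∀ x ∈ 𝒢.deg n, Θ x ∈ PathBialgebra.degree S n := by
  obtain ⟨Θ, M, hΘ, hM, hinj, hsurj, hMΘ⟩ := exists_coalgHom_mul hmul e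
  have hassoc := coalgHom_mul_assoc hmul hM hsurj hMΘ
  have honemul := coalgHom_one_mul hone hΘ hM hsurj hMΘ
  have hmulone := coalgHom_mul_one hone hΘ hM hsurj hMΘ
  have hmapmul := coalgHom_map_mul hmul hΘ hM hMΘ
  have hgl : IsGroupLikeElem k (Θ 1) := IsGroupLikeElem.one.map Θ
  let S : PathBialgebraStructure k V :=
    { mul := TensorProduct.curry (M : PathCoalgebra k V ⊗[k] PathCoalgebra k V →ₗ[k] _)
      one := Θ 1
      mul_assoc := hassoc
      one_mul := honemul
      mul_one := hmulone
      comul_one := hgl.comul_eq_tmul_self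
      counit_one := hgl.counit_eq_one
      comul_mul := fun x y => by
        refine (CoalgHomClass.map_comp_comul_apply M (x ⊗ₜ y)).symm.trans ?_
        rw [TensorProduct.comul_tmul]
        exact map_tensorTensorTensorComm _ _ _
      counit_mul := fun x y => by
        refine (CoalgHomClass.counit_comp_apply M (x ⊗ₜ y)).trans ?_
        rw [TensorProduct.counit_tmul, smul_eq_mul, mul_comm]
      one_mem := hΘ 0 1 hone
      mul_mem := fun hx hy => hM _ _ _ hx _ hy }
  let Θ' : G →ₐc[k] PathBialgebra S :=
    { (Θ : G →ₗc[k] PathCoalgebra k V) with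
      map_one' := rfl
      map_mul' := hmapmul }
  refine ⟨S, Θ', ?_, ?_, hΘ⟩
  · exact hstrict.injective Θ (ℋ := lengthGrading k V) hΘ (hinj 0 (by omega)) (hinj 1 le_rfl)
  · intro y hy
    obtain ⟨y₀, hy₀, y₁, hy₁, rfl⟩ := Submodule.mem_sup.1 hy
    obtain ⟨x₀, -, rfl⟩ := hsurj 0 (by omega) y₀ hy₀
    obtain ⟨x₁, -, rfl⟩ := hsurj 1 le_rfl y₁ hy₁
    exact ⟨x₀ + x₁, map_add Θ x₀ x₁⟩

end Structure

end PathCoalgebra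

/-! ### Injective coalgebra maps which are surjective in degrees at most one -/

namespace CoalgebraGrading

open Coalgebra

variable {k : Type*} [Field k] {C D : Type*} [AddCommGroup C] [Module k C] [Coalgebra k C]
  [AddCommGroup D] [Module k D] [Coalgebra k D]
  {𝒢 : CoalgebraGrading k C} {ℋ : CoalgebraGrading k D}

/-- If the target is strictly graded, then a coalgebra map which preserves the components of degree
zero sends elements of degree `1` to elements with components of degrees `0` and `1` only. The
comultiplicativity is needed at the given element only. -/
lemma IsStrict.proj_map_eq_zero (hℋ : ℋ.IsStrict) {f : C →ₗ[k] D}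
    (h₀ : ∀ x ∈ 𝒢.deg 0, f x ∈ ℋ.deg 0) {x : C} (hx : x ∈ 𝒢.deg 1)
    (hΔ : comul (R := k) (f x) = TensorProduct.map f f (comul (R := k) x)) :
    ∀ n ≥ 2, ℋ.proj n (f x) = 0 := by
  intro n hn
  obtain ⟨m, rfl⟩ : ∃ m, n = 1 + (m + 1) := ⟨n - 2, by omega⟩
  refine hℋ (m + 1) _ ((add_comm 1 (m + 1)) ▸ ℋ.proj_mem _ _) ?_
  rw [(ℋ.isConcentrated_proj 1).map_comul_proj (ℋ.isConcentrated_proj (m + 1)), hΔ,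
    TensorProduct.map_map]
  refine eq_on_tensorDegree (TensorProduct.map (ℋ.proj 1 ∘ₗ f) (ℋ.proj (m + 1) ∘ₗ f)) 0
    (fun i j hij a ha b hb => ?_) (𝒢.comul_mem hx)
  rw [TensorProduct.map_tmul, LinearMap.zero_apply, LinearMap.comp_apply, LinearMap.comp_apply]
  rcases Nat.eq_zero_or_pos i with rfl | hi
  · rw [ℋ.proj_of_mem_ne (h₀ a ha) zero_ne_one, TensorProduct.zero_tmul]
  · obtain rfl : j = 0 := by omega
    rw [ℋ.proj_of_mem_ne (h₀ b hb) (m.succ_ne_zero.symm), TensorProduct.tmul_zero]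

/-- An injective coalgebra map between strictly graded coalgebras whose image contains the
components of degrees `0` and `1` induces a truncated isomorphism, even if it is not graded. -/
lemma IsStrict.exists_truncatedIso (h𝒢 : 𝒢.IsStrict) (hℋ : ℋ.IsStrict)
    (hgl : 𝒢.deg 0 ≤ Submodule.span k {g : C | IsGroupLikeElem k g})
    (hgl' : ℋ.deg 0 ≤ Submodule.span k {g : D | IsGroupLikeElem k g})
    (f : C →ₗc[k] D) (hf : Function.Injective f) (hr₀ : ∀ y ∈ ℋ.deg 0, y ∈ Set.range f)
    (hr₁ : ∀ y ∈ ℋ.deg 1, y ∈ Set.range f) :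
    ∃ e : TruncatedIso 𝒢 ℋ, (∀ x ∈ 𝒢.deg 0, e.f₀ x = f x) ∧
      ∀ x ∈ 𝒢.deg 1, e.f₁ x = ℋ.proj 1 (f x) := by
  have hΔ : ∀ x, comul (R := k) (f x) = TensorProduct.map f.toLinearMap f.toLinearMap
      (comul (R := k) x) := fun x => (CoalgHomClass.map_comp_comul_apply f x).symm
  obtain ⟨l, hl⟩ := exists_linearMap_comp_eq (f : C →ₗ[k] D) (LinearMap.id : C →ₗ[k] C)
    fun x hx => hf (hx.trans (map_zero f).symm)
  replace hl : ∀ x, l (f x) = x := hl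
  have hlf : l ∘ₗ f.toLinearMap = LinearMap.id := LinearMap.ext hl
  have hlΔ : ∀ x, TensorProduct.map l l (comul (R := k) (f x)) = comul (R := k) x := fun x => by
    rw [hΔ, TensorProduct.map_map, hlf, TensorProduct.map_id, LinearMap.id_apply]
  have hf₀ : ∀ x ∈ 𝒢.deg 0, f x ∈ ℋ.deg 0 := fun x hx => by
    have : Submodule.span k {g : C | IsGroupLikeElem k g} ≤ (ℋ.deg 0).comap f.toLinearMap :=
      Submodule.span_le.2 fun g hg => ℋ.mem_deg_zero_of_isGroupLikeElem (hg.map f)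
    exact this (hgl hx)
  have hl₀ : ∀ y ∈ ℋ.deg 0, l y ∈ 𝒢.deg 0 := fun y hy => by
    have : Submodule.span k {g : D | IsGroupLikeElem k g} ≤ (𝒢.deg 0).comap l :=
      Submodule.span_le.2 fun g hg => by
        obtain ⟨x, rfl⟩ := hr₀ g (ℋ.mem_deg_zero_of_isGroupLikeElem hg)
        refine 𝒢.mem_deg_zero_of_isGroupLikeElem ⟨?_, ?_⟩
        · rw [hl, ← hg.counit_eq_one]
          exact (CoalgHomClass.counit_comp_apply f x).symm
        · rw [hl, ← hlΔ, hg.comul_eq_tmul_self, TensorProduct.map_tmul, hl]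
    exact this (hgl' hy)
  have hf₁ : ∀ x ∈ 𝒢.deg 1, ∀ n ≥ 2, ℋ.proj n (f x) = 0 := fun x hx =>
    hℋ.proj_map_eq_zero (f := f.toLinearMap) hf₀ hx (hΔ x)
  have hl₁ : ∀ y ∈ ℋ.deg 1, ∀ n ≥ 2, 𝒢.proj n (l y) = 0 := fun y hy => by
    obtain ⟨x, rfl⟩ := hr₁ y hy
    exact h𝒢.proj_map_eq_zero hl₀ hy (by rw [hl, hlΔ])
  let t₀ : C →ₗ[k] D := f.toLinearMap ∘ₗ 𝒢.proj 0
  let t₁ : C →ₗ[k] D := ℋ.proj 1 ∘ₗ f.toLinearMap ∘ₗ 𝒢.proj 1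
  have h00 : ℋ.proj 0 ∘ₗ f.toLinearMap ∘ₗ 𝒢.proj 0 = t₀ :=
    LinearMap.ext fun x => ℋ.proj_of_mem (hf₀ _ (𝒢.proj_mem 0 x))
  have h10 : ℋ.proj 1 ∘ₗ f.toLinearMap ∘ₗ 𝒢.proj 0 = 0 :=
    LinearMap.ext fun x => ℋ.proj_of_mem_ne (hf₀ _ (𝒢.proj_mem 0 x)) zero_ne_one
  have ht : IsTruncatedHom 𝒢 ℋ t₀ t₁ :=
    { conc_zero := (𝒢.isConcentrated_proj 0).comp _
      conc_one := ((𝒢.isConcentrated_proj 1).comp _).comp _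
      mem_zero := fun x => hf₀ _ (𝒢.proj_mem 0 x)
      mem_one := fun x => ℋ.proj_mem 1 _
      counit_zero := fun x => (CoalgHomClass.counit_comp_apply f _).trans (𝒢.counit_proj_zero x)
      comul_zero := fun x => by
        refine (hΔ _).trans ?_
        rw [𝒢.comul_proj_zero, TensorProduct.map_map]
      comul_one := fun x => by
        have h : comul (R := k) (t₁ x) = _ := ℋ.comul_proj_one (f (𝒢.proj 1 x))
        rw [h, hΔ, 𝒢.comul_proj_one]
        simp only [map_add, TensorProduct.map_map, h00, h10,
          TensorProduct.map_zero_left, TensorProduct.map_zero_right, LinearMap.zero_apply,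
          add_zero, zero_add]
        rfl }
  obtain ⟨e, he₀, he₁⟩ := TruncatedIso.exists_of_bijective ht
    (fun x hx h => hf (by
      rw [map_zero, ← h]
      exact congrArg f (𝒢.proj_of_mem hx).symm))
    (fun x hx h => by
      have h1 : ℋ.proj 1 (f x) = 0 := by
        rw [← h]
        exact congrArg (fun z => ℋ.proj 1 (f z)) (𝒢.proj_of_mem hx).symm
      have h2 : f x ∈ ℋ.deg 0 := by
        rw [ℋ.eq_proj_zero_add_proj_one (hf₁ x hx), h1, add_zero]
        exact ℋ.proj_mem 0 _
      have h3 := hl₀ _ h2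
      rw [hl] at h3
      rw [← 𝒢.proj_of_mem hx, 𝒢.proj_of_mem_ne h3 zero_ne_one])
    (fun y hy => by
      obtain ⟨x, rfl⟩ := hr₀ y hy
      have hx := hl₀ _ hy
      rw [hl] at hx
      exact ⟨x, hx, congrArg f (𝒢.proj_of_mem hx)⟩)
    (fun y hy => by
      obtain ⟨x, rfl⟩ := hr₁ y hy
      have hx := hl₁ _ hy
      rw [hl] at hx
      refine ⟨𝒢.proj 1 x, 𝒢.proj_mem 1 x, ?_⟩
      have h : ℋ.proj 1 (f (𝒢.proj 0 x)) = 0 := LinearMap.congr_fun h10 x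
      have h' : ℋ.proj 1 (f x) = ℋ.proj 1 (f (𝒢.proj 0 x)) + ℋ.proj 1 (f (𝒢.proj 1 x)) := by
        rw [← map_add, ← map_add, ← 𝒢.eq_proj_zero_add_proj_one hx]
      rw [← ℋ.proj_of_mem hy, h', h, zero_add]
      exact congrArg (fun z => ℋ.proj 1 (f z)) (𝒢.proj_proj 1 x))
  refine ⟨e, fun x hx => ?_, fun x hx => ?_⟩
  · rw [he₀]
    exact congrArg f (𝒢.proj_of_mem hx)
  · rw [he₁]
    exact congrArg (fun z => ℋ.proj 1 (f z)) (𝒢.proj_of_mem hx)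

end CoalgebraGrading

/-! ### Recovering the quiver from the graded path coalgebra -/

namespace PathCoalgebra

open Coalgebra CoalgebraGrading

variable {k : Type u} [Field k] {V : Type*} [Quiver V] {W : Type*} [Quiver W]

lemma ofPath_nil_injective :
    Function.Injective fun a : V => ofPath k (Quiver.Path.nil : Quiver.Path a a) := fun _ _ h =>
  congrArg QuiverPath.src ((basis k V).injective h)

lemma degree_zero_eq_span : degree k V 0 =
    Submodule.span k (Set.range fun a : V => ofPath k (Quiver.Path.nil : Quiver.Path a a)) := by
  refine le_antisymm (Submodule.span_le.2 ?_) (Submodule.span_le.2 ?_)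
  · rintro _ ⟨a, b, p, hp, rfl⟩
    obtain rfl := Quiver.Path.eq_of_length_zero p hp
    obtain rfl := Quiver.Path.eq_nil_of_length_zero p hp
    exact Submodule.subset_span ⟨a, rfl⟩
  · rintro _ ⟨a, rfl⟩
    exact ofPath_nil_mem_degree k a

variable (k V) in
lemma degree_zero_le_span_isGroupLikeElem :
    (lengthGrading k V).deg 0 ≤ Submodule.span k {g | IsGroupLikeElem k g} := by
  rw [lengthGrading_deg, degree_zero_eq_span]
  refine Submodule.span_mono ?_
  rintro _ ⟨a, rfl⟩
  exact isGroupLikeElem_ofPath_nil k a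

/-- The group-like elements of a path coalgebra are the vertices. -/
lemma exists_vertex_of_isGroupLikeElem {x : PathCoalgebra k V} (hx : IsGroupLikeElem k x) :
    ∃ a : V, x = ofPath k (Quiver.Path.nil : Quiver.Path a a) := by
  have hdeg : x ∈ degree k V 0 := (lengthGrading k V).mem_deg_zero_of_isGroupLikeElem hx
  rw [degree_zero_eq_span] at hdeg
  by_contra! h
  let s : Set (GroupLike k (PathCoalgebra k V)) :=
    Set.range fun a : V => ⟨_, isGroupLikeElem_ofPath_nil k a⟩
  refine (linearIndep_groupLikeVal (R := k) (A := PathCoalgebra k V)).notMem_span_image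
    (s := s) (x := ⟨x, hx⟩) ?_ ?_
  · rintro ⟨a, ha⟩
    exact h a (congrArg GroupLike.val ha).symm
  · rw [← Set.range_comp]
    exact hdeg

variable (k) in
/-- The span of the arrows from `a` to `b`. -/
def arrowSpan (a b : V) : Submodule k (PathCoalgebra k V) :=
  Submodule.span k (Set.range fun e : a ⟶ b => ofPath k (Quiver.Path.nil.cons e))

lemma linearIndependent_arrows (a b : V) :
    LinearIndependent k fun e : a ⟶ b => ofPath k (Quiver.Path.nil.cons e) :=
  (basis k V).linearIndependent.comp
    (fun e : a ⟶ b => (⟨a, b, Quiver.Path.nil.cons e⟩ : QuiverPath V)) fun e e' h => by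
      simpa using h

/-- The functional on the path coalgebra which is `1` at the vertex `a` and vanishes on all other
paths. -/
def vertexCoeff (a : V) : PathCoalgebra k V →ₗ[k] k :=
  open Classical in vertexLift fun b => if b = a then 1 else 0

lemma leftTranslate_vertexCoeff {c d : V} (e : c ⟶ d) (b : V) [Decidable (d = b)] :
    leftTranslate (vertexCoeff b) (ofPath k (Quiver.Path.nil.cons e)) =
      if d = b then ofPath k (Quiver.Path.nil.cons e) else 0 := by
  have h : vertexCoeff b (ofPath k (Quiver.Path.nil.cons e)) = 0 :=
    (vertexLift_isConcentrated _).eq_zero one_ne_zero (ofPath_arrow_mem_degree k e)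
  have h' : vertexCoeff b (ofPath k (Quiver.Path.nil : Quiver.Path d d)) = if d = b then 1 else 0 :=
    (vertexLift_ofPath_nil _ d).trans (by congr)
  have hp := isSkewPrimitive_ofPath_arrow k e
  rw [IsSkewPrimitive] at hp
  simp only [leftTranslate, LinearMap.comp_apply, hp, map_add, TensorProduct.map_tmul, h, h',
    LinearMap.id_apply, LinearEquiv.coe_coe, TensorProduct.lid_tmul, ite_smul, one_smul, zero_smul,
    add_zero]

lemma rightTranslate_vertexCoeff {c d : V} (e : c ⟶ d) (a : V) [Decidable (c = a)] :
    rightTranslate (vertexCoeff a) (ofPath k (Quiver.Path.nil.cons e)) =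
      if c = a then ofPath k (Quiver.Path.nil.cons e) else 0 := by
  have h : vertexCoeff a (ofPath k (Quiver.Path.nil.cons e)) = 0 :=
    (vertexLift_isConcentrated _).eq_zero one_ne_zero (ofPath_arrow_mem_degree k e)
  have h' : vertexCoeff a (ofPath k (Quiver.Path.nil : Quiver.Path c c)) = if c = a then 1 else 0 :=
    (vertexLift_ofPath_nil _ c).trans (by congr)
  have hp := isSkewPrimitive_ofPath_arrow k e
  rw [IsSkewPrimitive] at hp
  simp only [rightTranslate, LinearMap.comp_apply, hp, map_add, TensorProduct.map_tmul, h, h',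
    LinearMap.id_apply, LinearEquiv.coe_coe, TensorProduct.rid_tmul, ite_smul, one_smul, zero_smul,
    zero_add]

/-- The arrows from `a` to `b` span the homogeneous skew-primitive elements of degree `1` of the
corresponding type. -/
lemma mem_arrowSpan_iff {a b : V} {x : PathCoalgebra k V} : x ∈ arrowSpan k a b ↔
    x ∈ degree k V 1 ∧ IsSkewPrimitive (k := k) (ofPath k (Quiver.Path.nil : Quiver.Path b b))
      (ofPath k (Quiver.Path.nil : Quiver.Path a a)) x := by
  classical
  constructor
  · intro hx
    refine ⟨Submodule.span_le.2 ?_ hx, ?_⟩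
    · rintro _ ⟨e, rfl⟩
      exact ofPath_arrow_mem_degree k e
    · have : arrowSpan k a b ≤ LinearMap.eqLocus (comul (R := k))
          (TensorProduct.mk k _ _ (ofPath k (Quiver.Path.nil : Quiver.Path b b)) +
            (TensorProduct.mk k _ _).flip (ofPath k (Quiver.Path.nil : Quiver.Path a a))) := by
        refine Submodule.span_le.2 ?_
        rintro _ ⟨e, rfl⟩
        exact isSkewPrimitive_ofPath_arrow k e
      exact this hx
  · rintro ⟨hx, hΔ⟩
    rw [IsSkewPrimitive] at hΔ
    have h : ∀ c : V, vertexCoeff c x = 0 := fun c =>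
      (vertexLift_isConcentrated (k := k) _).eq_zero one_ne_zero
        (show x ∈ (lengthGrading k V).deg 1 from hx)
    have h' : ∀ c : V, vertexCoeff c (ofPath k (Quiver.Path.nil : Quiver.Path c c)) = 1 := fun c =>
      (vertexLift_ofPath_nil _ c).trans (if_pos rfl)
    have hL : leftTranslate (vertexCoeff b) x = x := by
      simp [leftTranslate, hΔ, h, h']
    have hR : rightTranslate (vertexCoeff a) x = x := by
      simp [rightTranslate, hΔ, h, h']
    -- Cutting down by the vertices `b` and `a` fixes `x` and kills all arrows which do not go from
    -- `a` to `b`.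
    have key : degree k V 1 ≤ (arrowSpan k a b).comap
        (rightTranslate (vertexCoeff a) ∘ₗ leftTranslate (vertexCoeff b)) := by
      refine Submodule.span_le.2 ?_
      rintro _ ⟨c, d, p, hp, rfl⟩
      obtain ⟨e, rfl⟩ := exists_arrow_of_length_eq_one p hp
      change rightTranslate (vertexCoeff a) (leftTranslate (vertexCoeff b) (ofPath k _)) ∈
        arrowSpan k a b
      rw [leftTranslate_vertexCoeff]
      split_ifs with hd
      · rw [rightTranslate_vertexCoeff]
        split_ifs with hc
        · subst hc hd
          exact Submodule.subset_span ⟨e, rfl⟩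
        · exact zero_mem _
      · rw [map_zero]
        exact zero_mem _
    have := key hx
    rwa [Submodule.mem_comap, LinearMap.comp_apply, hL, hR] at this

/-- An isomorphism of graded coalgebras between path coalgebras maps vertices to vertices, and the
number of arrows between two vertices is the dimension of a space of skew-primitive elements. -/
lemma nonempty_quiverIso (F : PathCoalgebra k V →ₗc[k] PathCoalgebra k W)
    (F' : PathCoalgebra k W →ₗc[k] PathCoalgebra k V)
    (hF : ∀ x ∈ degree k V 1, F x ∈ degree k W 1) (hF' : ∀ x ∈ degree k W 1, F' x ∈ degree k V 1)
    (hl : ∀ x, F' (F x) = x) (hr : ∀ y, F (F' y) = y) : Nonempty (QuiverIso V W) := by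
  choose φ hφ using fun a : V =>
    exists_vertex_of_isGroupLikeElem ((isGroupLikeElem_ofPath_nil k a).map F)
  choose ψ hψ using fun b : W =>
    exists_vertex_of_isGroupLikeElem ((isGroupLikeElem_ofPath_nil k b).map F')
  let vert : V ≃ W :=
    { toFun := φ
      invFun := ψ
      left_inv := fun a => ofPath_nil_injective (k := k) (by
        change ofPath k _ = ofPath k _
        rw [← hψ, ← hφ, hl])
      right_inv := fun b => ofPath_nil_injective (k := k) (by
        change ofPath k _ = ofPath k _
        rw [← hφ, ← hψ, hr]) }
  have hφ' : ∀ a, F' (ofPath k (Quiver.Path.nil : Quiver.Path (φ a) (φ a))) =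
      ofPath k (Quiver.Path.nil : Quiver.Path a a) := fun a => by rw [← hφ, hl]
  have hskew : ∀ a b, ∀ x ∈ arrowSpan k a b, F x ∈ arrowSpan k (φ a) (φ b) := by
    intro a b x hx
    rw [mem_arrowSpan_iff] at hx ⊢
    refine ⟨hF x hx.1, ?_⟩
    have h := hx.2
    rw [IsSkewPrimitive] at h ⊢
    rw [← CoalgHomClass.map_comp_comul_apply, h, map_add, TensorProduct.map_tmul,
      TensorProduct.map_tmul, ← hφ, ← hφ]
    rfl
  have hskew' : ∀ a b, ∀ x ∈ arrowSpan k (φ a) (φ b), F' x ∈ arrowSpan k a b := by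
    intro a b x hx
    rw [mem_arrowSpan_iff] at hx ⊢
    refine ⟨hF' x hx.1, ?_⟩
    have h := hx.2
    rw [IsSkewPrimitive] at h ⊢
    rw [← CoalgHomClass.map_comp_comul_apply, h, map_add, TensorProduct.map_tmul,
      TensorProduct.map_tmul, ← hφ', ← hφ']
    rfl
  let E : ∀ a b, arrowSpan k a b ≃ₗ[k] arrowSpan k (φ a) (φ b) := fun a b =>
    LinearEquiv.ofLinearMap (F.toLinearMap.restrict (hskew a b))
      (F'.toLinearMap.restrict (hskew' a b))
      (LinearMap.ext fun y => Subtype.ext (hr y)) (LinearMap.ext fun x => Subtype.ext (hl x))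
  exact ⟨⟨vert, fun a b =>
    ((Module.Basis.span (linearIndependent_arrows a b)).map (E a b)).indexEquiv
      (Module.Basis.span (linearIndependent_arrows (φ a) (φ b)))⟩⟩

end PathCoalgebra

/-! ### Uniqueness of the graded bialgebra structure -/

namespace PathBialgebra

open Coalgebra CoalgebraGrading PathCoalgebra

variable {k : Type u} [Field k] {V : Type*} [Quiver V] {W : Type*} [Quiver W]

/-- The length grading, as a grading of the path bialgebra. -/
def grading (S : PathBialgebraStructure k V) : CoalgebraGrading k (PathBialgebra S) :=
  lengthGrading k V

lemma proj_mul_left {S : PathBialgebraStructure k V} {x : PathBialgebra S} (hx : x ∈ degree S 0)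
    (n : ℕ) (y : PathBialgebra S) : (grading S).proj n (x * y) = x * (grading S).proj n y := by
  have h : IsGraded (grading S) (grading S) (LinearMap.mulLeft k x) := fun m z hz => by
    have := S.mul_mem hx hz
    rw [zero_add] at this
    exact this
  exact h.proj_comm n y

lemma proj_mul_right {S : PathBialgebraStructure k V} {x : PathBialgebra S} (hx : x ∈ degree S 0)
    (n : ℕ) (y : PathBialgebra S) : (grading S).proj n (y * x) = (grading S).proj n y * x := by
  have h : IsGraded (grading S) (grading S) (LinearMap.mulRight k x) := fun m z hz => by
    have : z * x ∈ degree S (m + 0) := S.mul_mem hz hx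
    rwa [add_zero] at this
  exact h.proj_comm n y

/-- A graded coalgebra isomorphism between path bialgebras which is multiplicative in degrees at
most `1` and preserves the units is an isomorphism of bialgebras. -/
lemma exists_bialgEquiv {S : PathBialgebraStructure k V} {S' : PathBialgebraStructure k W}
    (F : PathBialgebra S →ₗc[k] PathBialgebra S') (F' : PathBialgebra S' →ₗc[k] PathBialgebra S)
    (hF : ∀ n, ∀ x ∈ degree S n, F x ∈ degree S' n)
    (hF' : ∀ n, ∀ x ∈ degree S' n, F' x ∈ degree S n)
    (hl : ∀ x, F' (F x) = x) (hr : ∀ y, F (F' y) = y) (hone : F 1 = 1)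
    (hmul : ∀ i j, i + j ≤ 1 → ∀ x ∈ degree S i, ∀ y ∈ degree S j, F (x * y) = F x * F y) :
    ∃ E : PathBialgebra S ≃ₐc[k] PathBialgebra S', (∀ x, E x = F x) ∧
      ∀ n, (degree S n).map (E : PathBialgebra S →ₗ[k] PathBialgebra S') = degree S' n := by
  let f : PathBialgebra S ⊗[k] PathBialgebra S →ₗc[k] PathCoalgebra k W :=
    F.comp (Bialgebra.mulCoalgHom k (PathBialgebra S))
  let g : PathBialgebra S ⊗[k] PathBialgebra S →ₗc[k] PathCoalgebra k W :=
    (Bialgebra.mulCoalgHom k (PathBialgebra S')).comp (Coalgebra.TensorProduct.map F F)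
  have heq : ∀ n ≤ 1, ∀ w ∈ ((grading S).tensor (grading S)).deg n, f w = g w := fun n hn =>
    eq_on_tensor (f := f.toLinearMap) (g := g.toLinearMap)
      fun i j h x hx y hy => hmul i j (by omega) x hx y hy
  have hfg : f = g := coalgHom_ext (𝒢 := (grading S).tensor (grading S))
    (isGraded_tensor fun i j x hx y hy => hF _ _ (S.mul_mem hx hy))
    (isGraded_tensor fun i j x hx y hy => S'.mul_mem (hF i x hx) (hF j y hy))
    (heq 0 zero_le_one) (heq 1 le_rfl)
  have hmul' : ∀ x y, F (x * y) = F x * F y := fun x y =>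
    congrArg (fun φ => φ (x ⊗ₜ y)) hfg
  let Φ : PathBialgebra S →ₐc[k] PathBialgebra S' :=
    { F with
      map_one' := hone
      map_mul' := hmul' }
  have hΦ : Function.Bijective Φ :=
    ⟨Function.LeftInverse.injective (g := F') hl, Function.RightInverse.surjective (g := F') hr⟩
  refine ⟨BialgEquiv.ofBijective Φ hΦ, fun x => rfl, fun n => le_antisymm ?_ fun y hy => ?_⟩
  · rintro _ ⟨x, hx, rfl⟩
    exact hF n x hx
  · exact ⟨F' y, hF' n y hy, hr y⟩

/-- Isomorphisms of graded bialgebras are determined by their values on an embedded graded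
bialgebra which contains the components of degrees `0` and `1`. -/
lemma bialgEquiv_ext {S : PathBialgebraStructure k V} {S' : PathBialgebraStructure k W}
    {X : Type*} {Θ : X → PathBialgebra S} (hrange : ∀ y ∈ degree S 0 ⊔ degree S 1, y ∈ Set.range Θ)
    {E F : PathBialgebra S ≃ₐc[k] PathBialgebra S'}
    (hE : ∀ n, (degree S n).map (E : PathBialgebra S →ₗ[k] PathBialgebra S') = degree S' n)
    (hF : ∀ n, (degree S n).map (F : PathBialgebra S →ₗ[k] PathBialgebra S') = degree S' n)
    (h : ∀ x, E (Θ x) = F (Θ x)) : E = F := by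
  have heq : ∀ y ∈ degree S 0 ⊔ degree S 1, E y = F y := fun y hy => by
    obtain ⟨x, rfl⟩ := hrange y hy
    exact h x
  let f : PathCoalgebra k V →ₗc[k] PathCoalgebra k W :=
    (E : PathBialgebra S →ₗc[k] PathBialgebra S')
  let g : PathCoalgebra k V →ₗc[k] PathCoalgebra k W :=
    (F : PathBialgebra S →ₗc[k] PathBialgebra S')
  have hfg : f = g := coalgHom_ext (𝒢 := lengthGrading k V)
    (fun n x hx => (hE n).le ⟨x, hx, rfl⟩) (fun n x hx => (hF n).le ⟨x, hx, rfl⟩)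
    (fun x hx => heq x (Submodule.mem_sup_left hx)) (fun x hx => heq x (Submodule.mem_sup_right hx))
  exact BialgEquiv.ext fun x => congrArg (fun φ => φ x) hfg

variable {G : Type v} [Ring G] [Bialgebra k G] {𝒢 : CoalgebraGrading k G}

/-- Uniqueness of the path bialgebra: two embeddings of a strictly graded bialgebra into path
bialgebras give isomorphic quivers and isomorphic graded bialgebras. The first embedding has to be
graded, the second one need not be. On elements of degrees `0` and `1` the isomorphism sends the
first embedding to the homogeneous component of the same degree of the second one. -/
lemma exists_bialgEquiv_of_embeddings (hstrict : 𝒢.IsStrict)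
    (hgl : 𝒢.deg 0 ≤ Submodule.span k {g : G | IsGroupLikeElem k g}) (hone : (1 : G) ∈ 𝒢.deg 0)
    (hmul : ∀ i j, ∀ x ∈ 𝒢.deg i, ∀ y ∈ 𝒢.deg j, x * y ∈ 𝒢.deg (i + j))
    {S : PathBialgebraStructure k V} {S' : PathBialgebraStructure k W}
    (Θ : G →ₐc[k] PathBialgebra S) (hΘ : Function.Injective Θ)
    (hrange : ∀ y ∈ degree S 0 ⊔ degree S 1, y ∈ Set.range Θ)
    (hgr : ∀ n, ∀ x ∈ 𝒢.deg n, Θ x ∈ degree S n)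
    (Θ' : G →ₐc[k] PathBialgebra S') (hΘ' : Function.Injective Θ')
    (hrange' : ∀ y ∈ degree S' 0 ⊔ degree S' 1, y ∈ Set.range Θ') :
    Nonempty (QuiverIso V W) ∧
    ∃ F : PathBialgebra S ≃ₐc[k] PathBialgebra S',
      (∀ n, (degree S n).map (F : PathBialgebra S →ₗ[k] PathBialgebra S') = degree S' n) ∧
      (∀ x ∈ 𝒢.deg 0, F (Θ x) = Θ' x) ∧
      ∀ x ∈ 𝒢.deg 1, F (Θ x) = (grading S').proj 1 (Θ' x) := by
  obtain ⟨e, he₀, he₁⟩ := hstrict.exists_truncatedIso (lengthGrading_isStrict k) hgl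
    (degree_zero_le_span_isGroupLikeElem k V) (Θ : G →ₗc[k] PathBialgebra S) hΘ
    (fun y hy => hrange y (Submodule.mem_sup_left hy))
    (fun y hy => hrange y (Submodule.mem_sup_right hy))
  obtain ⟨e', he'₀, he'₁⟩ := hstrict.exists_truncatedIso (lengthGrading_isStrict k) hgl
    (degree_zero_le_span_isGroupLikeElem k W) (Θ' : G →ₗc[k] PathBialgebra S') hΘ'
    (fun y hy => hrange' y (Submodule.mem_sup_left hy))
    (fun y hy => hrange' y (Submodule.mem_sup_right hy))
  replace he₀ : ∀ x ∈ 𝒢.deg 0, e.f₀ x = Θ x := he₀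
  replace he₁ : ∀ x ∈ 𝒢.deg 1, e.f₁ x = Θ x := fun x hx =>
    (he₁ x hx).trans ((lengthGrading k V).proj_of_mem (hgr 1 x hx))
  replace he'₀ : ∀ x ∈ 𝒢.deg 0, e'.f₀ x = Θ' x := he'₀
  replace he'₁ : ∀ x ∈ 𝒢.deg 1, e'.f₁ x = (grading S').proj 1 (Θ' x) := he'₁
  have hΘ'₀ : ∀ x ∈ 𝒢.deg 0, Θ' x ∈ degree S' 0 := fun x hx => he'₀ x hx ▸ e'.hom.mem_zero x
  have hex : ∃ (F : PathBialgebra S →ₗc[k] PathBialgebra S')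
      (F' : PathBialgebra S' →ₗc[k] PathBialgebra S),
      (∀ n, ∀ x ∈ degree S n, F x ∈ degree S' n) ∧ (∀ n, ∀ x ∈ degree S' n, F' x ∈ degree S n) ∧
      (∀ x ∈ degree S 0, F x = e'.f₀ (e.g₀ x)) ∧ (∀ x ∈ degree S 1, F x = e'.f₁ (e.g₁ x)) ∧
      (∀ x, F' (F x) = x) ∧ ∀ y, F (F' y) = y := exists_coalgHom_inverse (e.symm.trans e')
  obtain ⟨F, F', hF, hF', hF₀, hF₁, hl, hr⟩ := hex
  refine ⟨nonempty_quiverIso F F' (hF 1) (hF' 1) hl hr, ?_⟩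
  have hFΘ₀ : ∀ x ∈ 𝒢.deg 0, F (Θ x) = Θ' x := fun x hx => by
    refine (hF₀ _ (hgr 0 x hx)).trans ?_
    rw [← he₀ x hx, e.left_inv_zero x hx, he'₀ x hx]
  have hFΘ₁ : ∀ x ∈ 𝒢.deg 1, F (Θ x) = (grading S').proj 1 (Θ' x) := fun x hx => by
    refine (hF₁ _ (hgr 1 x hx)).trans ?_
    rw [← he₁ x hx, e.left_inv_one x hx, he'₁ x hx]
  have hsurj₀ : ∀ y ∈ degree S 0, ∃ x ∈ 𝒢.deg 0, Θ x = y := fun y hy =>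
    ⟨e.g₀ y, e.inv.mem_zero y, by rw [← he₀ _ (e.inv.mem_zero y), e.right_inv_zero y hy]⟩
  have hsurj₁ : ∀ y ∈ degree S 1, ∃ x ∈ 𝒢.deg 1, Θ x = y := fun y hy =>
    ⟨e.g₁ y, e.inv.mem_one y, by rw [← he₁ _ (e.inv.mem_one y), e.right_inv_one y hy]⟩
  obtain ⟨E, hE, hEdeg⟩ := exists_bialgEquiv F F' hF hF' hl hr
    (by
      have := hFΘ₀ 1 hone
      rwa [map_one Θ, map_one Θ'] at this)
    (by
      intro i j hij x hx y hy
      have hcases : (i = 0 ∧ j = 0) ∨ (i = 0 ∧ j = 1) ∨ (i = 1 ∧ j = 0) := by omega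
      rcases hcases with ⟨rfl, rfl⟩ | ⟨rfl, rfl⟩ | ⟨rfl, rfl⟩
      · obtain ⟨a, ha, rfl⟩ := hsurj₀ x hx
        obtain ⟨b, hb, rfl⟩ := hsurj₀ y hy
        rw [hFΘ₀ a ha, hFΘ₀ b hb, ← map_mul, ← map_mul]
        exact hFΘ₀ _ (hmul 0 0 a ha b hb)
      · obtain ⟨a, ha, rfl⟩ := hsurj₀ x hx
        obtain ⟨b, hb, rfl⟩ := hsurj₁ y hy
        rw [hFΘ₀ a ha, hFΘ₁ b hb, ← proj_mul_left (hΘ'₀ a ha), ← map_mul, ← map_mul]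
        exact hFΘ₁ _ (hmul 0 1 a ha b hb)
      · obtain ⟨a, ha, rfl⟩ := hsurj₁ x hx
        obtain ⟨b, hb, rfl⟩ := hsurj₀ y hy
        rw [hFΘ₁ a ha, hFΘ₀ b hb, ← proj_mul_right (hΘ'₀ b hb), ← map_mul, ← map_mul]
        exact hFΘ₁ _ (hmul 1 0 a ha b hb))
  exact ⟨E, hEdeg, fun x hx => (hE _).trans (hFΘ₀ x hx), fun x hx => (hE _).trans (hFΘ₁ x hx)⟩

end PathBialgebra

end

theorem proposition3p3 {k : Type u} [Field k] {B : Type v} [Ring B] [Bialgebra k B]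
    (hB : IsPointedCoalgebra k B) :
    ∃ (V : Type v) (_ : Quiver.{v} V) (S : PathBialgebraStructure k V)
      (Θ : CoradicalGr hB →ₐc[k] PathBialgebra S),
      Function.Injective Θ ∧
      (∀ y ∈ PathBialgebra.degree S 0 ⊔ PathBialgebra.degree S 1, y ∈ Set.range Θ) ∧
      (∀ n, ∀ x ∈ (coradicalBialgebraFiltration hB).degree n, Θ x ∈ PathBialgebra.degree S n) ∧
      ∀ (V' : Type w₁) (_ : Quiver.{w₂} V') (S' : PathBialgebraStructure k V')
        (Θ' : CoradicalGr hB →ₐc[k] PathBialgebra S'),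
        Function.Injective Θ' →
        (∀ y ∈ PathBialgebra.degree S' 0 ⊔ PathBialgebra.degree S' 1, y ∈ Set.range Θ') →
        Nonempty (QuiverIso V V') ∧
        (∃ F : PathBialgebra S ≃ₐc[k] PathBialgebra S',
          ∀ n, (PathBialgebra.degree S n).map (F : PathBialgebra S →ₗ[k] PathBialgebra S') =
            PathBialgebra.degree S' n) ∧
        ((∀ n, ∀ x ∈ (coradicalBialgebraFiltration hB).degree n,
            Θ' x ∈ PathBialgebra.degree S' n) →
          ∃! F : PathBialgebra S ≃ₐc[k] PathBialgebra S',
            (∀ n, (PathBialgebra.degree S n).map (F : PathBialgebra S →ₗ[k] PathBialgebra S') =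
              PathBialgebra.degree S' n) ∧
            ∀ x, F (Θ x) = Θ' x) := by
  let 𝒢 := (coradicalBialgebraFiltration hB).grGrading
  have hgl : 𝒢.deg 0 ≤ Submodule.span k {g : CoradicalGr hB | IsGroupLikeElem k g} :=
    degree_zero_le_span_isGroupLikeElem hB
  have hone : (1 : CoradicalGr hB) ∈ 𝒢.deg 0 := (coradicalBialgebraFiltration hB).one_mem_degree
  have hmul : ∀ i j, ∀ x ∈ 𝒢.deg i, ∀ y ∈ 𝒢.deg j, x * y ∈ 𝒢.deg (i + j) :=
    fun i j x hx y hy => (coradicalBialgebraFiltration hB).mul_mem_degree hx hy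
  obtain ⟨V, _, ⟨e⟩⟩ := PathCoalgebra.exists_quiver_truncatedIso 𝒢 hgl
  obtain ⟨S, Θ, hΘ, hrange, hgr⟩ :=
    PathCoalgebra.exists_structure (coradicalGr_isStrict hB) hone hmul e
  refine ⟨V, inferInstance, S, Θ, hΘ, hrange, hgr, fun V' _ S' Θ' hΘ' hrange' => ?_⟩
  obtain ⟨hiso, F, hF, hF₀, hF₁⟩ := PathBialgebra.exists_bialgEquiv_of_embeddings
    (coradicalGr_isStrict hB) hgl hone hmul Θ hΘ hrange hgr Θ' hΘ' hrange'
  refine ⟨hiso, ⟨F, hF⟩, fun hgr' => ?_⟩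
  have hFΘ : ∀ x, F (Θ x) = Θ' x := by
    let f : CoradicalGr hB →ₗc[k] PathCoalgebra k V' :=
      (F : PathBialgebra S →ₗc[k] PathBialgebra S').comp
        (Θ : CoradicalGr hB →ₗc[k] PathBialgebra S)
    let g : CoradicalGr hB →ₗc[k] PathCoalgebra k V' :=
      (Θ' : CoradicalGr hB →ₗc[k] PathBialgebra S')
    have hfg : f = g := PathCoalgebra.coalgHom_ext (𝒢 := 𝒢)
      (fun n x hx => (hF n).le ⟨Θ x, hgr n x hx, rfl⟩) hgr' hF₀
      fun x hx => (hF₁ x hx).trans ((PathBialgebra.grading S').proj_of_mem (hgr' 1 x hx))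
    exact fun x => congrArg (fun φ => φ x) hfg
  exact ⟨F, ⟨hF, hFΘ⟩, fun E hE => PathBialgebra.bialgEquiv_ext hrange hE.1 hF
    fun x => (hE.2 x).trans (hFΘ x).symm⟩
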